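/- Let $p>2$ be a prime, $F$ a field containing a primitive $p$th root of unity $\xi_p$, and $K=F(\sqrt[p]{a})$, $a\in F^\times$, a cyclic extension of $F$ of degree $p$ with group $G=\langle\sigma\rangle$, where $\sigma(\sqrt[p]{a})=\xi_p\sqrt[p]{a}$. Put $\rho=\sigma-1$, so that $x^{\rho}=\sigma(x)/x$ for $x\in K^\times$, write $[x]$ for the class of $x$ in $J=K^\times/K^{\times p}$, and let $\Upsilon=1$ if $\xi_p\in N_{K/F}(K^\times)$ and $\Upsilon=0$ otherwise. All fields lie in a fixed algebraically closed extension of $F$. Let $A=\mathbb F_p[G]=\bigoplus_{s=0}^{p-1}\mathbb F_p\tau^s$, with $\sigma$ acting as multiplication by $\tau$, let $A_i$ be the ideal generated by $(\tau-1)^i$, and for $e\in\mathbb F_p$ let $B_{i,e}$ be the extension of $G$ by the $G$-module $A/A_i$ in which some lift $\tilde\sigma$ of $\sigma$ satisfies $\tilde\sigma^p=e\,\overline{(\tau-1)}^{\,i-1}$; thus $B_{j,0}=(A/A_j)\rtimes G$. Let $p\ge i>j\ge 1$, let $\gamma\in K^\times$, and let $L$ be the Galois closure of $K(\sqrt[p]{\gamma})$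 over $F$; suppose that $\mathrm{Gal}(L/F)\cong(A/A_j)\rtimes G$ as extensions of $G$. Let $e\ne0$ in $\mathbb F_p$. A solution of the embedding problem $$\mathcal E'_{i,j}(L)\colon\quad 1\to A_j/A_i\to B_{i,e}\to (A/A_j)\rtimes G=\mathrm{Gal}(L/F)\to 1$$ is a Galois extension $\tilde L/F$ with $\tilde L\supseteq L$ for which there are isomorphisms of extensions of $G$, $\mathrm{Gal}(\tilde L/F)\cong B_{i,e}$ and $\mathrm{Gal}(L/F)\cong (A/A_j)\rtimes G$, that carry the restriction map $\mathrm{Gal}(\tilde L/F)\to\mathrm{Gal}(L/F)$ to the projection $B_{i,e}\to (A/A_j)\rtimes G$. The problem is solvable if it has a solution. (1) Suppose that $i>j+1-\Upsilon$ or $j=p-1$. Then $\mathcal E'_{i,j}(L)$ is solvable if and only if $[\gamma]=[\omega]^{\rho^{p-j}}$ for some $\omega\in K^\times$. Moreover, in what follows let $f$ range over $F^\times$, let $\omega$ range over the elements of $K^\times$ with $[\omega]^{\rho^{p-j}}=[\gamma]$, and let $\omega'=\omega^{c_0+c_1\rho+\dots+c_{i-1}\rho^{i-1}}$, where $c_k\in\mathbb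 Z$ and $p\nmid c_0$. (1a) If $\Upsilon=1$, then there is an $\alpha\in K^\times$ such that $K(\sqrt[p]{\alpha})/F$ is cyclic of degree $p^2$, and for each such $\alpha$ the solutions of $\mathcal E'_{i,j}(L)$ are exactly the fields $$\tilde L=L\Bigl(\sqrt[p]{f\alpha\,\omega'^{\rho^{p-i}}},\ \sqrt[p]{\omega'^{\rho^{p-i+1}}},\ \dots,\ \sqrt[p]{\omega'^{\rho^{p-j-1}}}\Bigr)$$ (only the first radical occurs if $i=j+1$). (1b) If $\Upsilon=0$ and $i>j+1$, then the solutions are exactly the fields $$\tilde L=L\Bigl(\sqrt[p]{f\sqrt[p]{a}\,\omega'^{\rho^{p-i}}},\ \sqrt[p]{\xi_p\,\omega'^{\rho^{p-i+1}}},\ \sqrt[p]{\omega'^{\rho^{p-i+2}}},\ \dots,\ \sqrt[p]{\omega'^{\rho^{p-j-1}}}\Bigr)$$ (only the first two radicals occur if $i=j+2$). (1c) If $\Upsilon=0$ and $j=p-1$ (so $i=p$), then the solutions are exactly the fields $\tilde L=L(\sqrt[p]{f\omega'})$. (2) Suppose that $i=j+1$ and $\Upsilon=0$. Then $\mathcal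 E'_{j+1,j}(L)$ is solvable if and only if $[\gamma]=[\xi_p]^{m}[\omega]^{\rho^{p-j}}$ for some $\omega\in K^\times$ and some integer $m\not\equiv0\bmod p$. The solutions are exactly the fields $$\tilde L=L\Bigl(\sqrt[p]{f\,(\sqrt[p]{a})^{m}\,\omega^{\rho^{p-j-1}}}\Bigr),$$ where $f\in F^\times$ and $(\omega,m)$ ranges over all pairs with $\omega\in K^\times$, $m\not\equiv0\bmod p$ and $[\gamma]=[\xi_p]^m[\omega]^{\rho^{p-j}}$. -/

import Mathlib

/-! ## The modules `A / A_i` and the groups `B_{i,e}` -/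

noncomputable section

namespace CyclicEmbedding

/-- The group ring `A = ⊕ 𝔽_p τ^s` of the cyclic group of order `p`, written additively as `ZMod p`;
the generator `σ` of that group acts on `A` as multiplication by `τ`. -/
abbrev A (p : ℕ) : Type := MonoidAlgebra (ZMod p) (Multiplicative (ZMod p))

/-- The element `τ ^ s` of `A`. -/
def tauPow (p : ℕ) (s : ZMod p) : A p := MonoidAlgebra.of (ZMod p) _ (Multiplicative.ofAdd s)

/-- The element `τ` of `A`. -/
def tau (p : ℕ) : A p := tauPow p 1

/-- The submodule (ideal) `A_i` of `A` generated by `(τ - 1) ^ i`. -/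
def Asub (p i : ℕ) : Ideal (A p) := Ideal.span {(tau p - 1) ^ i}

/-- The cyclic module `A / A_i`. -/
abbrev AQuot (p i : ℕ) : Type := A p ⧸ Asub p i

/-- The class of `e (τ - 1) ^ (i - 1)` in `A / A_i`. -/
def topElt (p i : ℕ) (e : ZMod p) : AQuot p i :=
  Ideal.Quotient.mk (Asub p i) (algebraMap (ZMod p) (A p) e * (tau p - 1) ^ (i - 1))

/-- The carry (`0` or `1`) in the addition of the representatives of `s`, `t` in `{0, …, p - 1}`. -/
def carry (p : ℕ) (s t : ZMod p) : ℕ := (s.val + t.val) / p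

lemma tauPow_zero (p : ℕ) : tauPow p 0 = 1 := by
  rw [tauPow, ofAdd_zero, map_one]

lemma tauPow_add (p : ℕ) (s t : ZMod p) : tauPow p (s + t) = tauPow p s * tauPow p t := by
  rw [tauPow, ofAdd_add, map_mul]; rfl

lemma tau_pow (p n : ℕ) : tau p ^ n = tauPow p n := by
  induction n with
  | zero => simp [tauPow_zero]
  | succ n ih => rw [pow_succ, ih, tau, ← tauPow_add]; push_cast; rfl

lemma tauPow_mul_topElt (p : ℕ) [Fact p.Prime] (i : ℕ) (e s : ZMod p) :
    Ideal.Quotient.mk (Asub p i) (tauPow p s) * topElt p i e = topElt p i e := by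
  have hs : tauPow p s = tau p ^ s.val := by
    rw [tau_pow, ZMod.natCast_zmod_val]
  obtain ⟨q, hq⟩ := sub_one_dvd_pow_sub_one (tau p) s.val
  rw [topElt, ← map_mul, Ideal.Quotient.eq, Asub, Ideal.mem_span_singleton, hs]
  have h1 : (tau p - 1) ^ i ∣ (tau p - 1) * (tau p - 1) ^ (i - 1) := by
    rw [← pow_succ']
    exact pow_dvd_pow _ (by omega)
  have h2 : tau p ^ s.val * (algebraMap (ZMod p) (A p) e * (tau p - 1) ^ (i - 1))
      - algebraMap (ZMod p) (A p) e * (tau p - 1) ^ (i - 1)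
      = (tau p - 1) * (tau p - 1) ^ (i - 1) * (q * algebraMap (ZMod p) (A p) e) := by
    calc _ = (tau p ^ s.val - 1) * (tau p - 1) ^ (i - 1) * algebraMap (ZMod p) (A p) e := by ring
      _ = _ := by rw [hq]; ring
  rw [h2]
  exact Dvd.dvd.mul_right h1 _

lemma carry_assoc (p : ℕ) [Fact p.Prime] (s t u : ZMod p) :
    carry p s t + carry p (s + t) u = carry p t u + carry p s (t + u) := by
  have hp : 0 < p := (Fact.out : p.Prime).pos
  have key : ∀ x y : ZMod p, x.val + y.val = (x + y).val + p * carry p x y := by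
    intro x y
    rw [ZMod.val_add, carry, Nat.mod_add_div]
  have h1 := key s t
  have h2 := key (s + t) u
  have h3 := key t u
  have h4 := key s (t + u)
  rw [add_assoc] at h2
  have h5 : p * (carry p s t + carry p (s + t) u) = p * (carry p t u + carry p s (t + u)) := by
    rw [mul_add, mul_add]; omega
  exact Nat.eq_of_mul_eq_mul_left hp h5

/-- The group `B_{i,e}`: the extension of `A / A_i` by the cyclic group `G = ⟨σ⟩` of order `p` in which
the lift `⟨0, 1⟩` of `σ` acts on `A / A_i` by `τ` and has `p`-th power `e (τ - 1) ^ (i - 1)`.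
The element `⟨x, s⟩` is `x` times the `s`-th power (`0 ≤ s < p`) of that lift. -/
@[ext] structure B (p i : ℕ) (e : ZMod p) where
  /-- the component in `A / A_i` -/
  fst : AQuot p i
  /-- the exponent `s` of the image `σ ^ s` in `G` -/
  snd : ZMod p

variable {p i : ℕ} {e : ZMod p}

instance : Mul (B p i e) :=
  ⟨fun g h => ⟨g.fst + Ideal.Quotient.mk (Asub p i) (tauPow p g.snd) * h.fst
      + carry p g.snd h.snd • topElt p i e, g.snd + h.snd⟩⟩

instance : One (B p i e) := ⟨⟨0, 0⟩⟩

instance : Inv (B p i e) :=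
  ⟨fun g => ⟨-(Ideal.Quotient.mk (Asub p i) (tauPow p (-g.snd)) * g.fst)
      - carry p (-g.snd) g.snd • topElt p i e, -g.snd⟩⟩

lemma B.mul_fst (g h : B p i e) : (g * h).fst =
    g.fst + Ideal.Quotient.mk (Asub p i) (tauPow p g.snd) * h.fst
      + carry p g.snd h.snd • topElt p i e := rfl

lemma B.mul_snd (g h : B p i e) : (g * h).snd = g.snd + h.snd := rfl

lemma B.one_fst : (1 : B p i e).fst = 0 := rfl

lemma B.one_snd : (1 : B p i e).snd = 0 := rfl

lemma B.inv_fst (g : B p i e) : (g⁻¹).fst =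
    -(Ideal.Quotient.mk (Asub p i) (tauPow p (-g.snd)) * g.fst)
      - carry p (-g.snd) g.snd • topElt p i e := rfl

lemma B.inv_snd (g : B p i e) : (g⁻¹).snd = -g.snd := rfl

instance [Fact p.Prime] : Group (B p i e) :=
  Group.ofLeftAxioms
    (by
      intro x y z
      refine B.ext ?_ ?_
      · simp only [B.mul_fst, B.mul_snd, tauPow_add, map_mul, mul_add, mul_smul_comm,
          tauPow_mul_topElt]
        have h := congrArg (fun n : ℕ => n • topElt p i e) (carry_assoc p x.snd y.snd z.snd)
        simp only [add_smul] at h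
        calc _ = x.fst + Ideal.Quotient.mk (Asub p i) (tauPow p x.snd) * y.fst
              + Ideal.Quotient.mk (Asub p i) (tauPow p x.snd)
                * Ideal.Quotient.mk (Asub p i) (tauPow p y.snd) * z.fst
              + (carry p x.snd y.snd • topElt p i e
                + carry p (x.snd + y.snd) z.snd • topElt p i e) := by abel
          _ = _ := by rw [h, mul_assoc]; abel
      · simp only [B.mul_snd, add_assoc])
    (by
      intro x
      refine B.ext ?_ ?_
      · have hc : carry p 0 x.snd = 0 := by
          have hp : 0 < p := (Fact.out : p.Prime).pos
          have : NeZero p := ⟨hp.ne'⟩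
          simp [carry, Nat.div_eq_of_lt (ZMod.val_lt x.snd)]
        simp [B.mul_fst, B.one_fst, B.one_snd, tauPow_zero, hc]
      · simp [B.mul_snd, B.one_snd])
    (by
      intro x
      refine B.ext ?_ ?_
      · simp only [B.mul_fst, B.inv_fst, B.inv_snd, B.one_fst]
        abel
      · simp [B.mul_snd, B.inv_snd, B.one_snd])

lemma Asub_le {i j : ℕ} (h : j ≤ i) : Asub p i ≤ Asub p j := by
  rw [Asub, Asub, Ideal.span_singleton_le_span_singleton]
  exact pow_dvd_pow _ h

/-- The quotient map `A / A_i → A / A_j`, for `j ≤ i`. -/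
def quotMap (p : ℕ) {i j : ℕ} (h : j ≤ i) : AQuot p i →+* AQuot p j :=
  Ideal.Quotient.factor (Asub_le h)

lemma quotMap_mk {i j : ℕ} (h : j ≤ i) (x : A p) :
    quotMap p h (Ideal.Quotient.mk (Asub p i) x) = Ideal.Quotient.mk (Asub p j) x := rfl

lemma topElt_zero (j : ℕ) : topElt p j 0 = 0 := by
  rw [topElt, map_zero, zero_mul, map_zero]

lemma quotMap_topElt {i j : ℕ} (h : j < i) (e : ZMod p) : quotMap p h.le (topElt p i e) = 0 := by
  rw [topElt, quotMap_mk, Ideal.Quotient.eq_zero_iff_mem, Asub, Ideal.mem_span_singleton]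
  exact Dvd.dvd.mul_left (pow_dvd_pow _ (by omega)) _

/-- The surjection `B_{i,e} → B_{j,0} = (A / A_j) ⋊ G` with kernel `A_j / A_i`, for `j < i`. -/
def B.proj [Fact p.Prime] {i j : ℕ} (h : j < i) (e : ZMod p) : B p i e →* B p j 0 where
  toFun g := ⟨quotMap p h.le g.fst, g.snd⟩
  map_one' := B.ext (by rw [B.one_fst, map_zero, B.one_fst]) rfl
  map_mul' g k := B.ext
    (by rw [B.mul_fst, B.mul_fst, map_add, map_add, map_mul, map_nsmul, quotMap_mk,
          quotMap_topElt h, topElt_zero, smul_zero]) rfl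

/-! ## The classes of `K^×` modulo `p`-th powers and the operator `ρ = σ - 1` -/

/-- The operator `ρ = σ - 1` on the multiplicative group: `x ↦ σ(x) / x`. -/
def rho {F E : Type*} [Field F] [Field E] [Algebra F E] (σ : E ≃ₐ[F] E) : Eˣ →* Eˣ :=
  Units.map (σ : E →* E) / MonoidHom.id Eˣ

/-- The class `[x]` of `x` in `J = E^× / (E^×)^p`. -/
def cls (p : ℕ) {E : Type*} [Field E] (x : Eˣ) : Eˣ ⧸ (powMonoidHom p : Eˣ →* Eˣ).range :=
  QuotientGroup.mk x

/-- `ω ^ (c₀ + c₁ ρ + ⋯ + c_{i-1} ρ^{i-1})`. -/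
def rhoPoly {F E : Type*} [Field F] [Field E] [Algebra F E] (σ : E ≃ₐ[F] E) (i : ℕ)
    (c : ℕ → ℤ) (ω : Eˣ) : Eˣ :=
  ∏ k ∈ Finset.range i, ((rho σ)^[k] ω) ^ c k

/-- The inclusion `F^× → E^×`. -/
def incl {F : Type*} (E : Type*) [Field F] [Field E] [Algebra F E] : Fˣ →* Eˣ :=
  Units.map (algebraMap F E : F →* E)

open Classical in
/-- `Υ = 1` if `ξ` is a norm from `E^×`, and `Υ = 0` otherwise. -/
def Upsilon {F : Type*} (E : Type*) [Field F] [Field E] [Algebra F E] (ξ : Fˣ) : ℕ :=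
  if ∃ z : Eˣ, Algebra.norm F (z : E) = ξ then 1 else 0

/-! ## Fields and embedding problems, inside a big field `Ω` -/

section Fields

variable {F Ω : Type*} [Field F] [Field Ω] [Algebra F Ω]

/-- The field `E(ᵖ√s : s ∈ S)` inside `Ω`, for a set `S` of units of the subfield `K`. -/
def adjoinRoots (p : ℕ) {K : IntermediateField F Ω} (E : IntermediateField F Ω) (S : Set Kˣ) :
    IntermediateField F Ω :=
  IntermediateField.adjoin F
    ((E : Set Ω) ∪ {x : Ω | ∃ s ∈ S, x ^ p = ((s : K) : Ω)})

/-- `E / F` is a cyclic (Galois) extension of degree `n`. -/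
def IsCyclicOfDegree (E : IntermediateField F Ω) (n : ℕ) : Prop :=
  IsGalois F E ∧ IsCyclic (E ≃ₐ[F] E) ∧ Module.finrank F E = n

/-- The automorphism `h` of `E` is the restriction of the automorphism `g` of `E'` (where `E ≤ E'`). -/
def Restricts {E E' : IntermediateField F Ω} (h : E ≃ₐ[F] E) (g : E' ≃ₐ[F] E') : Prop :=
  ∀ (x : E) (y : E'), (x : Ω) = (y : Ω) → ((h x : E) : Ω) = ((g y : E') : Ω)

/-- The isomorphism `ψ : Gal(E/F) ≃ B_{i,e}` is one of `G`-extensions: the projection of `B_{i,e}`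
onto `G = Gal(K/F) = ⟨σ⟩` becomes the restriction `Gal(E/F) → Gal(K/F)`. -/
def IsGIso {p : ℕ} [Fact p.Prime] {K : IntermediateField F Ω} (σ : K ≃ₐ[F] K)
    {E : IntermediateField F Ω} {i : ℕ} {e : ZMod p} (ψ : (E ≃ₐ[F] E) ≃* B p i e) : Prop :=
  ∀ g : E ≃ₐ[F] E, Restricts (σ ^ (ψ g).snd.val) g

/-- `E / F` is Galois, contains `K`, and `Gal(E/F) ≅ B_{i,e}` as extensions of `G = Gal(K/F)`. -/
def HasGroupB (p : ℕ) [Fact p.Prime] {K : IntermediateField F Ω} (σ : K ≃ₐ[F] K)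
    (E : IntermediateField F Ω) (i : ℕ) (e : ZMod p) : Prop :=
  K ≤ E ∧ IsGalois F E ∧ ∃ ψ : (E ≃ₐ[F] E) ≃* B p i e, IsGIso σ ψ

/-- `L'` is a solution of the embedding problem
`1 → A_j / A_i → B_{i,e} → (A / A_j) ⋊ G = Gal(L/F) → 1`: a Galois extension of `F` containing `L`
such that, under identifications of `Gal(L'/F)` with `B_{i,e}` and of `Gal(L/F)` with
`B_{j,0} = (A / A_j) ⋊ G` as `G`-extensions, the restriction map `Gal(L'/F) → Gal(L/F)` is the
projection `B_{i,e} → B_{j,0}`. -/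
def IsSolution {p : ℕ} [Fact p.Prime] {K : IntermediateField F Ω} (σ : K ≃ₐ[F] K) {i j : ℕ}
    (hij : j < i) (e : ZMod p) (L L' : IntermediateField F Ω) : Prop :=
  K ≤ L ∧ L ≤ L' ∧ IsGalois F L ∧ IsGalois F L' ∧
    ∃ (φ : (L ≃ₐ[F] L) ≃* B p j 0) (ψ : (L' ≃ₐ[F] L') ≃* B p i e),
      IsGIso σ φ ∧ IsGIso σ ψ ∧
      ∀ (h : L ≃ₐ[F] L) (g : L' ≃ₐ[F] L'), Restricts h g → φ h = B.proj hij e (ψ g)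

end Fields

end CyclicEmbedding

end

set_option linter.unusedSectionVars false

namespace CyclicEmbedding

noncomputable section

/-! ## Ideals and linear functionals of the group ring `A` -/

section GroupRing

variable {p : ℕ} [Fact p.Prime]

/-! The proof is Kummer theory over `K` together with the action of `G`. The pairing between
`Gal(E/K)` and the classes in `J` that acquire `p`-th roots in `E` is nondegenerate and
`G`-invariant, and `A / A_i` is self-dual: its submodules form a chain with socle spanned by `(τ -
1)^(i-1)`. So fields `E` with `Gal(E/K) ≅ A / A_i` are generated by the roots of the conjugates of
one `β` of length `i`, that is, `[β]^{ρ^i} = 1` and `[β]^{ρ^{i-1}} ≠ 1`.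

The extension class is read off from a norm. If `c^p = β` and `g` lifts `σ`, then `∏ g^s(c)` is a
`p`-th root of `N(β)`, and `g` fixes it iff `g^p` fixes `c` (`apply_prod_eq_iff`). Hence for `e ≠ 0`
the group is `B_{i,e}` when `N(β) ∉ F^{×p}`; the value of `e` is adjusted by rescaling a generator
of `Gal(E/K)`. See `exists_generator` and `hasGroupB_adjoinRoots`. The kernel of `B_{i,e} → B_{j,0}`
fixes the roots of the conjugates of `γ`, so compatibility with the projection can always be
arranged. The solutions are therefore the fields generated over `L` by roots of `β^{ρ^l}`, `l < i -
j`, where `[β]^{ρ^{i-j}} = [γ]` and `N(β) ∉ F^{×p}` (`exists_of_isSolution`, `isSolution_of`).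

It remains to describe these `β`. Among the `x` with `[N(x)] = [x]^{ρ^{p-1}} = 1`, those in
`normPow` form a subgroup of index `p`, the quotient being generated by `r = ᵖ√a`. By Hilbert 90,
for `i < p` the elements of `normPow` of length at most `i` are `f ω^{ρ^{p-i}}` with `f ∈ F^×`
(`exists_eq_incl_mul_rho`). So, given `α ∉ normPow` killed by `ρ^{i-j}`, one gets `β^m = f α
ω^{ρ^{p-i}}` with `p ∤ m`, and applying `ρ^{i-j}` yields the criterion on `γ`. A Kummer generator of
a cyclic extension of degree `p^2` is killed by `ρ` and serves when `Υ = 1`; `r` is killed by `ρ^2`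
and serves when `i > j + 1`. If `i = j + 1` and `r` is used, `ρ(r^m) = ξ^m` survives in the class of
`γ`, whence case (2). If `i = p`, the norm condition is automatic because `[N(β)] = [β]^{ρ^{p-1}} ≠
1`. -/

instance : CharP (A p) p := charP_of_injective_algebraMap (algebraMap (ZMod p) (A p)).injective p

instance : Finite (A p) :=
  Finite.of_equiv _ (MonoidAlgebra.coeffEquiv (R := ZMod p) (M := Multiplicative (ZMod p))).symm

instance (i : ℕ) : Finite (AQuot p i) :=
  Finite.of_surjective _ Ideal.Quotient.mk_surjective

lemma sub_one_dvd_tauPow_sub_one (s : ZMod p) : tau p - 1 ∣ tauPow p s - 1 := by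
  have hs : tauPow p s = tau p ^ s.val := by rw [tau_pow, ZMod.natCast_zmod_val]
  exact hs ▸ sub_one_dvd_pow_sub_one (tau p) s.val

/-- Each `τ^s` is congruent to `1` modulo `τ - 1`. Applied repeatedly, this extracts the
coefficients of a `(τ - 1)`-adic expansion. -/
lemma exists_eq_algebraMap_add (x : A p) :
    ∃ (c : ZMod p) (y : A p), x = algebraMap (ZMod p) (A p) c + (tau p - 1) * y := by
  induction x using MonoidAlgebra.induction_on with
  | of m =>
    obtain ⟨y, hy⟩ := sub_one_dvd_tauPow_sub_one (Multiplicative.toAdd m)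
    refine ⟨1, y, ?_⟩
    rw [← hy, map_one, tauPow, ofAdd_toAdd]; ring
  | add x y hx hy =>
    obtain ⟨c, x', rfl⟩ := hx
    obtain ⟨d, y', rfl⟩ := hy
    exact ⟨c + d, x' + y', by rw [map_add]; ring⟩
  | smul r x hx =>
    obtain ⟨c, x', rfl⟩ := hx
    refine ⟨r * c, algebraMap (ZMod p) (A p) r * x', ?_⟩
    rw [Algebra.smul_def, map_mul]; ring

lemma tau_pow_prime : tau p ^ p = 1 := by
  rw [tau_pow, CharP.cast_eq_zero, tauPow_zero]

lemma tau_sub_one_pow_prime : (tau p - 1) ^ p = 0 := by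
  rw [sub_pow_char, tau_pow_prime, one_pow, sub_self]

lemma isNilpotent_tau_sub_one : IsNilpotent (tau p - 1) := ⟨p, tau_sub_one_pow_prime⟩

/-- The polynomial identity `(X - 1) ^ (p - 1) = 1 + X + ⋯ + X ^ (p - 1)` in characteristic `p`. -/
lemma X_sub_one_pow_eq_geom_sum (p : ℕ) [Fact p.Prime] :
    (Polynomial.X - 1 : Polynomial (ZMod p)) ^ (p - 1) =
      ∑ i ∈ Finset.range p, Polynomial.X ^ i := by
  have hp : p.Prime := Fact.out
  rw [← Polynomial.cyclotomic_prime (ZMod p) p]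
  have h := Polynomial.cyclotomic_mul_prime_eq_pow_of_not_dvd (ZMod p) (p := p) (n := 1)
    hp.not_dvd_one
  rw [one_mul, Polynomial.cyclotomic_one] at h
  exact h.symm

/-- The power equals the sum of all group elements, whose coefficient at the identity is `1`. Thus
`τ - 1` has nilpotency index exactly `p`. -/
lemma tau_sub_one_pow_ne_zero : (tau p - 1) ^ (p - 1) ≠ 0 := by
  have hp : p.Prime := Fact.out
  have h := congrArg (Polynomial.aeval (tau p)) (X_sub_one_pow_eq_geom_sum p)
  simp only [map_pow, map_sub, Polynomial.aeval_X, map_one, map_sum] at h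
  rw [h]
  intro h0
  have h1 := congrArg (fun x : A p => x.coeff (Multiplicative.ofAdd (0 : ZMod p))) h0
  simp only [MonoidAlgebra.coeff_sum, tau_pow, tauPow, MonoidAlgebra.of_apply,
    MonoidAlgebra.coeff_single, Finsupp.finsetSum_apply, Finsupp.single_apply,
    EmbeddingLike.apply_eq_iff_eq, MonoidAlgebra.coeff_zero, Finsupp.coe_zero, Pi.zero_apply] at h1
  rw [Finset.sum_eq_single 0] at h1
  · simp at h1
  · intro b hb hb0
    rw [if_neg]
    rw [CharP.cast_eq_zero_iff (ZMod p) p]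
    exact fun hd => hb0 (Nat.eq_zero_of_dvd_of_lt hd (Finset.mem_range.1 hb))
  · simp [hp.pos]

lemma mem_Asub {i : ℕ} {x : A p} : x ∈ Asub p i ↔ ∃ y, x = (tau p - 1) ^ i * y :=
  Ideal.mem_span_singleton

/-- Otherwise `(τ - 1)^n (1 - (τ - 1) y) = 0` for some `y`; the second factor is a unit, so `(τ -
1)^n`, and with it `(τ - 1)^(p-1)`, would vanish. -/
lemma pow_mem_Asub_succ {n : ℕ} (hn : n < p) : (tau p - 1) ^ n ∉ Asub p (n + 1) := by
  intro h
  obtain ⟨y, hy⟩ := mem_Asub.1 h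
  have hu : IsUnit (1 - (tau p - 1) * y) :=
    IsNilpotent.isUnit_one_sub ((Commute.all _ _).isNilpotent_mul_right isNilpotent_tau_sub_one)
  have h0 : (tau p - 1) ^ n * (1 - (tau p - 1) * y) = 0 := by
    rw [mul_sub, mul_one, ← mul_assoc, ← pow_succ, ← hy, sub_self]
  rw [hu.mul_left_eq_zero] at h0
  apply tau_sub_one_pow_ne_zero (p := p)
  rw [show p - 1 = n + (p - 1 - n) by omega, pow_add, h0, zero_mul]

/-- Induction along the filtration: an element of `A` lies in `A_i` as soon as its leading
coefficients vanish. -/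
lemma mem_Asub_of_forall {i : ℕ} {x : A p}
    (h : ∀ (m : ℕ) (c : ZMod p) (y : A p), m < i →
      x = (tau p - 1) ^ m * algebraMap (ZMod p) (A p) c + (tau p - 1) ^ (m + 1) * y → c = 0) :
    x ∈ Asub p i := by
  have key : ∀ m ≤ i, x ∈ Asub p m := by
    intro m
    induction m with
    | zero => intro _; exact mem_Asub.2 ⟨x, by simp⟩
    | succ m ih =>
      intro hm
      obtain ⟨x', hx'⟩ := mem_Asub.1 (ih (by omega))
      obtain ⟨c, y, hy⟩ := exists_eq_algebraMap_add x'
      have hx : x = (tau p - 1) ^ m * algebraMap (ZMod p) (A p) c + (tau p - 1) ^ (m + 1) * y := by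
        rw [hx', hy]; ring
      rw [h m c y (by omega) hx, map_zero, mul_zero, zero_add] at hx
      exact mem_Asub.2 ⟨y, hx⟩
  exact key i le_rfl

/-- Multiplication by `(τ - 1)^k` shifts a leading term of degree `m < i` to degree `k + m < p`,
where it cannot disappear. -/
lemma mem_Asub_of_mul_mem {i k : ℕ} (hi : k + i ≤ p) {x : A p}
    (hx : (tau p - 1) ^ k * x ∈ Asub p (k + i)) : x ∈ Asub p i := by
  refine mem_Asub_of_forall fun m c y hm hxc => ?_
  by_contra hc
  apply pow_mem_Asub_succ (p := p) (n := k + m) (by omega)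
  have h1 := Asub_le (p := p) (show k + m + 1 ≤ k + i by omega) hx
  rw [hxc] at h1
  have h2 : (tau p - 1) ^ (k + m + 1) * y ∈ Asub p (k + m + 1) := mem_Asub.2 ⟨y, rfl⟩
  have h3 := Ideal.sub_mem _ h1 h2
  have h4 := Ideal.mul_mem_left _ (algebraMap (ZMod p) (A p) c⁻¹) h3
  convert h4 using 1
  have h5 : algebraMap (ZMod p) (A p) c⁻¹ * algebraMap (ZMod p) (A p) c = 1 := by
    rw [← map_mul, inv_mul_cancel₀ hc, map_one]
  linear_combination -(tau p - 1) ^ (k + m) * h5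

/-- A functional on `A / A_i` that does not vanish on the socle generates the dual: its kernel
contains no nonzero submodule. -/
lemma mem_Asub_of_functional {i : ℕ} {l : A p →ₗ[ZMod p] ZMod p} (hl : ∀ x ∈ Asub p i, l x = 0)
    (hs : l ((tau p - 1) ^ (i - 1)) ≠ 0) {x : A p} (hx : ∀ y, l (x * y) = 0) : x ∈ Asub p i := by
  refine mem_Asub_of_forall fun m c y hm hxc => ?_
  -- This multiplier moves the leading term of `x` into the socle and the remainder into `A_i`.
  have h1 := hx ((tau p - 1) ^ (i - 1 - m))
  have h2 : x * (tau p - 1) ^ (i - 1 - m) = c • (tau p - 1) ^ (i - 1) + (tau p - 1) ^ i * y := by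
    have e1 : (tau p - 1) ^ (i - 1) = (tau p - 1) ^ m * (tau p - 1) ^ (i - 1 - m) := by
      rw [← pow_add]; congr 1; omega
    have e2 : (tau p - 1) ^ i = (tau p - 1) ^ (m + 1) * (tau p - 1) ^ (i - 1 - m) := by
      rw [← pow_add]; congr 1; omega
    rw [Algebra.smul_def, e1, e2, hxc]; ring
  rw [h2, map_add, map_smul, hl _ (mem_Asub.2 ⟨y, rfl⟩), add_zero, smul_eq_mul] at h1
  exact (mul_eq_zero.1 h1).resolve_right hs

/-- Every functional on `A / A_i` is a multiple of one that does not vanish on the socle. -/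
lemma exists_mul_functional {i : ℕ} {l m : A p →ₗ[ZMod p] ZMod p} (hl : ∀ x ∈ Asub p i, l x = 0)
    (hs : l ((tau p - 1) ^ (i - 1)) ≠ 0) (hm : ∀ x ∈ Asub p i, m x = 0) :
    ∃ x, ∀ y, m y = l (x * y) := by
  let S : Submodule (ZMod p) (A p) := (Asub p i).restrictScalars (ZMod p)
  let f : A p →ₗ[ZMod p] Module.Dual (ZMod p) (A p) :=
    l.compRight (ZMod p) ∘ₗ LinearMap.mul (ZMod p) (A p)
  have hf : ∀ x y, f x y = l (x * y) := fun x y => rfl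
  have hfS : ∀ x, f x ∈ S.dualAnnihilator := fun x =>
    (Submodule.mem_dualAnnihilator _).2 fun y hy => hl _ (Ideal.mul_mem_left _ _ hy)
  have hker : f.ker = S := by
    ext x
    rw [LinearMap.mem_ker]
    constructor
    · intro hx
      exact mem_Asub_of_functional hl hs fun y => by rw [← hf, hx]; rfl
    · intro hx
      ext y
      exact hl _ (Ideal.mul_mem_right _ _ hx)
  have : Module.Finite (ZMod p) (A p) := Module.Finite.of_finite
  have h1 := f.finrank_range_add_finrank_ker
  have h2 := Subspace.finrank_add_finrank_dualAnnihilator_eq S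
  -- Both sides have dimension `dim A - dim A_i`, so one inclusion suffices.
  have h3 : f.range = S.dualAnnihilator := by
    apply Submodule.eq_of_le_of_finrank_eq
    · rintro _ ⟨x, rfl⟩; exact hfS x
    · rw [hker] at h1; omega
  obtain ⟨x, hx⟩ : m ∈ f.range := h3 ▸ (Submodule.mem_dualAnnihilator _).2 fun y hy => hm y hy
  exact ⟨x, fun y => by rw [← hf, hx]⟩

/-- A functional on `A / A_i` vanishing on the socle vanishes on the image of `(1 - τ) ^ (i - 1)`. -/
lemma functional_eq_zero_of_socle {i : ℕ} (hi : 1 ≤ i) {l : A p →ₗ[ZMod p] ZMod p}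
    (hl : ∀ x ∈ Asub p i, l x = 0) (hs : l ((tau p - 1) ^ (i - 1)) = 0) (x : A p) :
    l ((1 - tau p) ^ (i - 1) * x) = 0 := by
  obtain ⟨c, y, hx⟩ := exists_eq_algebraMap_add ((-1) ^ (i - 1) * x)
  have h1 : (1 - tau p) ^ (i - 1) * x = c • (tau p - 1) ^ (i - 1) + (tau p - 1) ^ i * y := by
    obtain ⟨n, rfl⟩ := Nat.exists_eq_add_of_le' hi
    rw [Nat.add_sub_cancel] at hx ⊢
    rw [← neg_sub, neg_pow, mul_right_comm, hx, Algebra.smul_def]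
    ring
  rw [h1, map_add, map_smul, hs, smul_zero, zero_add, hl _ (mem_Asub.2 ⟨y, rfl⟩)]

lemma isUnit_tau : IsUnit (tau p) :=
  IsUnit.of_mul_eq_one (tau p ^ (p - 1)) (by
    rw [← pow_succ', Nat.sub_add_cancel (Fact.out : p.Prime).one_le, tau_pow_prime])

/-- A functional on `A / A_j` is, up to a power of `τ`, a multiple by `(1 - τ) ^ k` of a functional on
`A / A_{k+j}`. -/
lemma exists_functional {k j : ℕ} (hkj : k + j ≤ p) {χ : A p →ₗ[ZMod p] ZMod p}
    (hχ : ∀ x ∈ Asub p j, χ x = 0) :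
    ∃ l : A p →ₗ[ZMod p] ZMod p, (∀ x ∈ Asub p (k + j), l x = 0) ∧
      ∀ x, l ((1 - tau p) ^ k * x) = χ (tau p ^ k * x) := by
  let S : Submodule (ZMod p) (A p) := (Asub p (k + j)).restrictScalars (ZMod p)
  let f : A p →ₗ[ZMod p] (A p ⧸ S) := S.mkQ ∘ₗ LinearMap.mulLeft (ZMod p) ((1 - tau p) ^ k)
  -- The twist by `τ^k` is the one in `pair_iota_rho`, where `ρ^k` on Kummer classes corresponds to
  -- `(1 - τ)^k` on the group.
  let χ' : A p →ₗ[ZMod p] ZMod p := χ ∘ₗ LinearMap.mulLeft (ZMod p) (tau p ^ k)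
  -- A functional factors through `f` iff it kills the kernel of `f`; here the kernel lies in `A_j`,
  -- by cancelling `(τ - 1)^k`.
  have hmem : χ' ∈ f.dualMap.range := by
    rw [LinearMap.range_dualMap_eq_dualAnnihilator_ker, Submodule.mem_dualAnnihilator]
    intro x hx
    have h1 : (1 - tau p) ^ k * x ∈ Asub p (k + j) := by
      have := LinearMap.mem_ker.1 hx
      simpa [f, S, Submodule.Quotient.mk_eq_zero] using this
    have h2 : (tau p - 1) ^ k * x ∈ Asub p (k + j) := by
      have := Ideal.mul_mem_left _ ((-1) ^ k) h1
      rwa [← mul_assoc, ← mul_pow, neg_one_mul, neg_sub] at this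
    exact hχ _ (Ideal.mul_mem_left _ _ (mem_Asub_of_mul_mem hkj h2))
  obtain ⟨l, hl⟩ := hmem
  refine ⟨l ∘ₗ S.mkQ, fun x hx => ?_, fun x => ?_⟩
  · have : S.mkQ x = 0 := by
      rw [Submodule.mkQ_apply, Submodule.Quotient.mk_eq_zero]; exact hx
    rw [LinearMap.comp_apply, this, map_zero]
  · exact LinearMap.congr_fun hl x

/-- The functional on `A` with prescribed values on the powers of `τ`. -/
def functional (f : ZMod p → ZMod p) : A p →ₗ[ZMod p] ZMod p :=
  Finsupp.linearCombination (ZMod p) (fun m : Multiplicative (ZMod p) => f m.toAdd) ∘ₗ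
    (MonoidAlgebra.coeffLinearEquiv (ZMod p)).toLinearMap

lemma functional_tauPow (f : ZMod p → ZMod p) (s : ZMod p) : functional f (tauPow p s) = f s := by
  simp [functional, tauPow]

lemma functional_ext {l l' : A p →ₗ[ZMod p] ZMod p} (h : ∀ s, l (tauPow p s) = l' (tauPow p s)) :
    l = l' := by
  ext m
  exact h (Multiplicative.toAdd m)

end GroupRing

/-! ## Classes modulo `p`-th powers, and the norm of a cyclic Kummer extension -/

section Classes

variable {F E : Type*} [Field F] [Field E] [Algebra F E] {p : ℕ}

/-- The action of an automorphism on the multiplicative group. -/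
def act (g : E ≃ₐ[F] E) : Eˣ →* Eˣ := Units.map (g : E →* E)

lemma coe_act (g : E ≃ₐ[F] E) (x : Eˣ) : ((act g x : Eˣ) : E) = g x := rfl

lemma act_mul (g h : E ≃ₐ[F] E) (x : Eˣ) : act (g * h) x = act g (act h x) := rfl

lemma act_one (x : Eˣ) : act (1 : E ≃ₐ[F] E) x = x := rfl

lemma act_incl (g : E ≃ₐ[F] E) (f : Fˣ) : act g (incl E f) = incl E f :=
  Units.ext (g.commutes f)

lemma incl_injective : Function.Injective (incl E : Fˣ →* Eˣ) :=
  Units.map_injective (algebraMap F E).injective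

lemma coe_incl (f : Fˣ) : ((incl E f : Eˣ) : E) = algebraMap F E f := rfl

lemma rho_apply (g : E ≃ₐ[F] E) (x : Eˣ) : rho g x = act g x / x := rfl

lemma rho_incl (g : E ≃ₐ[F] E) (f : Fˣ) : rho g (incl E f) = 1 := by
  rw [rho_apply, act_incl, div_self']

lemma act_eq_rho_mul (g : E ≃ₐ[F] E) (x : Eˣ) : act g x = rho g x * x := by
  rw [rho_apply, div_mul_cancel]

lemma cls_mul (x y : Eˣ) : cls p (x * y) = cls p x * cls p y := rfl

lemma cls_one : cls p (1 : Eˣ) = 1 := rfl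

lemma cls_inv (x : Eˣ) : cls p x⁻¹ = (cls p x)⁻¹ := rfl

lemma cls_div (x y : Eˣ) : cls p (x / y) = cls p x / cls p y := rfl

lemma cls_zpow (x : Eˣ) (n : ℤ) : cls p (x ^ n) = cls p x ^ n := rfl

lemma cls_eq_one {x : Eˣ} : cls p x = 1 ↔ ∃ q : Eˣ, q ^ p = x := by
  rw [cls, QuotientGroup.eq_one_iff]; rfl

lemma cls_eq_cls {x y : Eˣ} : cls p x = cls p y ↔ ∃ q : Eˣ, x = y * q ^ p := by
  rw [← div_eq_one, ← cls_div, cls_eq_one]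
  exact exists_congr fun q => by rw [eq_div_iff_mul_eq', eq_comm, mul_comm]

lemma cls_pow_self (x : Eˣ) : cls p (x ^ p) = 1 := cls_eq_one.2 ⟨x, rfl⟩

/-- The endomorphism of `J` induced by `ρ`. -/
def rhoJ (p : ℕ) (g : E ≃ₐ[F] E) :
    (Eˣ ⧸ (powMonoidHom p : Eˣ →* Eˣ).range) →* (Eˣ ⧸ (powMonoidHom p : Eˣ →* Eˣ).range) :=
  QuotientGroup.map _ _ (rho g) (by
    rintro _ ⟨q, rfl⟩
    exact ⟨rho g q, (map_pow (rho g) q p).symm⟩)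

lemma cls_rho (g : E ≃ₐ[F] E) (x : Eˣ) : cls p (rho g x) = rhoJ p g (cls p x) := rfl

lemma cls_rho_iterate (g : E ≃ₐ[F] E) (k : ℕ) (x : Eˣ) :
    cls p ((rho g)^[k] x) = (rhoJ p g)^[k] (cls p x) :=
  (Function.Semiconj.iterate_right (f := cls p) (fun x => cls_rho g x) k) x

lemma cls_rho_congr {g : E ≃ₐ[F] E} {x y : Eˣ} (h : cls p x = cls p y) (k : ℕ) :
    cls p ((rho g)^[k] x) = cls p ((rho g)^[k] y) := by
  rw [cls_rho_iterate, cls_rho_iterate, h]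

lemma rho_iterate_mul (g : E ≃ₐ[F] E) (k : ℕ) (x y : Eˣ) :
    (rho g)^[k] (x * y) = (rho g)^[k] x * (rho g)^[k] y := iterate_map_mul (rho g) k x y

lemma rho_iterate_inv (g : E ≃ₐ[F] E) (k : ℕ) (x : Eˣ) :
    (rho g)^[k] x⁻¹ = ((rho g)^[k] x)⁻¹ := iterate_map_inv (rho g) k x

lemma rho_iterate_one (g : E ≃ₐ[F] E) (k : ℕ) : (rho g)^[k] 1 = 1 := iterate_map_one (rho g) k

lemma rho_iterate_pow (g : E ≃ₐ[F] E) (k : ℕ) (x : Eˣ) (n : ℕ) :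
    (rho g)^[k] (x ^ n) = ((rho g)^[k] x) ^ n := iterate_map_pow (rho g) k x n

lemma rho_iterate_zpow (g : E ≃ₐ[F] E) (k : ℕ) (x : Eˣ) (n : ℤ) :
    (rho g)^[k] (x ^ n) = ((rho g)^[k] x) ^ n := iterate_map_zpow (rho g) k x n

lemma rho_iterate_incl (g : E ≃ₐ[F] E) {k : ℕ} (hk : 1 ≤ k) (f : Fˣ) :
    (rho g)^[k] (incl E f) = 1 := by
  obtain ⟨k, rfl⟩ := Nat.exists_eq_add_of_le' hk
  rw [Function.iterate_succ_apply, rho_incl, rho_iterate_one]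

lemma rho_iterate_add (g : E ≃ₐ[F] E) (k l : ℕ) (x : Eˣ) :
    (rho g)^[k] ((rho g)^[l] x) = (rho g)^[k + l] x := (Function.iterate_add_apply _ k l x).symm

lemma cls_rho_eq_one_of_le {g : E ≃ₐ[F] E} {k l : ℕ} (h : k ≤ l) {x : Eˣ}
    (hx : cls p ((rho g)^[k] x) = 1) : cls p ((rho g)^[l] x) = 1 := by
  obtain ⟨m, rfl⟩ := Nat.exists_eq_add_of_le' h
  rw [← rho_iterate_add, cls_rho_iterate, hx, iterate_map_one]

/-- The norm `∏ σ^s(x)`, `0 ≤ s < p`. -/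
def nm (p : ℕ) (g : E ≃ₐ[F] E) : Eˣ →* Eˣ := ∏ s ∈ Finset.range p, act (g ^ s)

lemma nm_apply (g : E ≃ₐ[F] E) (x : Eˣ) : nm p g x = ∏ s ∈ Finset.range p, act (g ^ s) x := by
  rw [nm, MonoidHom.finsetProd_apply]

lemma nm_incl (g : E ≃ₐ[F] E) (f : Fˣ) : nm p g (incl E f) = incl E f ^ p := by
  simp [nm_apply, act_incl]

lemma end_sub_one_pow {V : Type*} [AddCommGroup V] [Fact p.Prime] [Module (ZMod p) V]
    (s : Module.End (ZMod p) V) :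
    (s - 1) ^ (p - 1) = ∑ i ∈ Finset.range p, s ^ i := by
  have h := congrArg (Polynomial.aeval s) (X_sub_one_pow_eq_geom_sum p)
  simpa only [map_pow, map_sub, Polynomial.aeval_X, map_one, map_sum] using h

/-- `(s - 1) ^ (p - 1) = 1 + s + ⋯ + s ^ (p - 1)` for an endomorphism `s` of an elementary abelian
`p`-group, in multiplicative notation. -/
lemma iterate_div_eq_prod {V : Type*} [CommGroup V] [Fact p.Prime] (hV : ∀ v : V, v ^ p = 1)
    (s : V →* V) (v : V) :
    (fun w => s w / w)^[p - 1] v = ∏ i ∈ Finset.range p, s^[i] v := by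
  have : Module (ZMod p) (Additive V) := AddCommGroup.zmodModule (n := p) hV
  let s' : Module.End (ZMod p) (Additive V) := AddMonoidHom.toZModLinearMap p s.toAdditive
  have h := LinearMap.congr_fun (end_sub_one_pow s') (Additive.ofMul v)
  rw [LinearMap.sum_apply, Module.End.pow_apply] at h
  simp only [Module.End.pow_apply] at h
  exact h

/-- `[N(x)] = [x] ^ {ρ^{p-1}}`. -/
lemma cls_nm [Fact p.Prime] (g : E ≃ₐ[F] E) (x : Eˣ) :
    cls p (nm p g x) = cls p ((rho g)^[p - 1] x) := by
  let s : (Eˣ ⧸ (powMonoidHom p : Eˣ →* Eˣ).range) →* (Eˣ ⧸ (powMonoidHom p : Eˣ →* Eˣ).range) :=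
    QuotientGroup.map _ _ (act g) (by
      rintro _ ⟨q, rfl⟩
      exact ⟨act g q, (map_pow (act g) q p).symm⟩)
  have h := iterate_div_eq_prod (p := p) (fun y => by
      obtain ⟨y, rfl⟩ := QuotientGroup.mk_surjective y
      exact cls_pow_self y) s (cls p x)
  have hsk : ∀ (k : ℕ) (y : Eˣ), s^[k] (cls p y) = cls p (act (g ^ k) y) := by
    intro k
    induction k with
    | zero => intro y; rfl
    | succ k ih =>
      intro y
      rw [Function.iterate_succ_apply, pow_succ, act_mul, ← ih]
      rfl
  have hr : ∀ (k : ℕ) (y : Eˣ), (fun w => s w / w)^[k] (cls p y) = cls p ((rho g)^[k] y) := by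
    intro k
    induction k with
    | zero => intro y; rfl
    | succ k ih =>
      intro y
      rw [Function.iterate_succ_apply, Function.iterate_succ_apply, ← ih]
      rfl
  rw [hr] at h
  simp only [hsk] at h
  rw [h, nm_apply]
  exact map_prod (QuotientGroup.mk' (powMonoidHom p : Eˣ →* Eˣ).range) _ _

end Classes

/-- `E = F(r)` is a cyclic Kummer extension of degree `p` of `F`, with `r ^ p ∈ F` and
`σ(r) = ξ r`. -/
structure IsKummer {F E : Type*} [Field F] [Field E] [Algebra F E] (p : ℕ) (ξ : Fˣ)
    (r : Eˣ) (σ : E ≃ₐ[F] E) : Prop where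
  odd : Odd p
  prim : IsPrimitiveRoot ξ p
  finrank : Module.finrank F E = p
  pow_mem : ∃ a : Fˣ, r ^ p = incl E a
  adjoin : IntermediateField.adjoin F {(r : E)} = ⊤
  act_r : act σ r = incl E ξ * r

/-! ### Galois group, norm and Hilbert 90 for `K = F(ᵖ√a)` -/

namespace IsKummer

variable {F E : Type*} [Field F] [Field E] [Algebra F E] {p : ℕ} [hpf : Fact p.Prime] {ξ : Fˣ}
  {r : Eˣ} {σ : E ≃ₐ[F] E} (hk : IsKummer p ξ r σ)

include hk

lemma finiteDimensional : FiniteDimensional F E :=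
  Module.finite_of_finrank_pos (hk.finrank ▸ hpf.out.pos)

lemma act_pow_r (n : ℕ) : act (σ ^ n) r = incl E ξ ^ n * r := by
  induction n with
  | zero => rw [pow_zero, act_one, pow_zero, one_mul]
  | succ n ih =>
    rw [pow_succ', act_mul, ih, map_mul, map_pow, act_incl, hk.act_r, pow_succ, mul_assoc]

lemma prim_incl : IsPrimitiveRoot (incl E ξ) p :=
  hk.prim.map_of_injective incl_injective

lemma exists_incl_pow_eq {z : Eˣ} (hz : z ^ p = 1) : ∃ n : ℕ, incl E ξ ^ n = z := by
  have h1 : IsPrimitiveRoot ((incl E ξ : Eˣ) : E) p :=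
    IsPrimitiveRoot.coe_units_iff.2 hk.prim_incl
  have : NeZero p := ⟨hpf.out.ne_zero⟩
  obtain ⟨n, -, hn⟩ := h1.eq_pow_of_pow_eq_one (ξ := (z : E)) (by
    rw [← Units.val_pow_eq_pow_val, hz, Units.val_one])
  exact ⟨n, Units.ext (by rw [Units.val_pow_eq_pow_val, hn])⟩

lemma ext_of_r {g h : E ≃ₐ[F] E} (hgh : g r = h r) : g = h := by
  ext x
  have hx : x ∈ IntermediateField.adjoin F {(r : E)} := hk.adjoin ▸ IntermediateField.mem_top
  induction hx using IntermediateField.adjoin_induction with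
  | mem x hx => rw [Set.mem_singleton_iff.1 hx, hgh]
  | algebraMap x => rw [g.commutes, h.commutes]
  | add x y _ _ hx hy => rw [map_add, map_add, hx, hy]
  | inv x _ hx => rw [map_inv₀, map_inv₀, hx]
  | mul x y _ _ hx hy => rw [map_mul, map_mul, hx, hy]

lemma pow_eq_one_iff (n : ℕ) : σ ^ n = 1 ↔ p ∣ n := by
  rw [← hk.prim_incl.pow_eq_one_iff_dvd n]
  constructor
  · intro h
    have := hk.act_pow_r n
    rw [h, act_one] at this
    exact (right_eq_mul.1 this)
  · intro h
    apply hk.ext_of_r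
    have := hk.act_pow_r n
    rw [h, one_mul] at this
    exact congrArg Units.val this

lemma orderOf : orderOf σ = p :=
  Nat.dvd_antisymm (orderOf_dvd_of_pow_eq_one ((hk.pow_eq_one_iff p).2 dvd_rfl))
    ((hk.pow_eq_one_iff _).1 (pow_orderOf_eq_one σ))

lemma card : Nat.card (E ≃ₐ[F] E) = p := by
  have := hk.finiteDimensional
  apply le_antisymm
  · rw [Nat.card_eq_fintype_card]
    exact AlgEquiv.card_le.trans_eq hk.finrank
  · have h := orderOf_le_card (x := σ)
    rwa [hk.orderOf] at h

lemma isGalois : IsGalois F E := by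
  have := hk.finiteDimensional
  exact IsGalois.of_card_aut_eq_finrank _ _ (by rw [hk.card, hk.finrank])

lemma exists_pow_eq (g : E ≃ₐ[F] E) : ∃ n < p, σ ^ n = g := by
  have := hk.finiteDimensional
  have h : g ∈ Subgroup.zpowers σ := by
    have := Subgroup.eq_top_of_card_eq (Subgroup.zpowers σ)
      (by rw [Nat.card_zpowers, hk.orderOf, hk.card])
    rw [this]; trivial
  classical
  rw [mem_zpowers_iff_mem_range_orderOf, hk.orderOf] at h
  obtain ⟨n, hn, rfl⟩ := Finset.mem_image.1 h
  exact ⟨n, Finset.mem_range.1 hn, rfl⟩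

lemma exists_incl_eq {x : Eˣ} (hx : act σ x = x) : ∃ f : Fˣ, incl E f = x := by
  have := hk.finiteDimensional
  have := hk.isGalois
  have h : ∀ g : E ≃ₐ[F] E, g x = x := by
    intro g
    obtain ⟨n, -, rfl⟩ := hk.exists_pow_eq g
    have : act (σ ^ n) x = x := by
      induction n with
      | zero => rfl
      | succ n ih => rw [pow_succ, act_mul, hx, ih]
    exact congrArg Units.val this
  obtain ⟨f, hf⟩ := (IsGalois.mem_range_algebraMap_iff_fixed (F := F) (x : E)).2 h
  have hf0 : f ≠ 0 := by
    rintro rfl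
    exact x.ne_zero (by rw [← hf, map_zero])
  exact ⟨Units.mk0 f hf0, Units.ext hf⟩

lemma pow_prime : σ ^ p = 1 := (hk.pow_eq_one_iff p).2 dvd_rfl

lemma act_nm (x : Eˣ) : act σ (nm p σ x) = nm p σ x := by
  rw [nm_apply, map_prod]
  simp only [← act_mul, ← pow_succ']
  have h1 := Finset.prod_range_succ (fun s => act (σ ^ s) x) p
  rw [Finset.prod_range_succ', hk.pow_prime, pow_zero] at h1
  exact mul_right_cancel h1

lemma nm_rho (x : Eˣ) : nm p σ (rho σ x) = 1 := by
  have h : nm p σ (act σ x) = act σ (nm p σ x) := by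
    rw [nm_apply, nm_apply, map_prod]
    simp only [← act_mul, ← pow_succ, ← pow_succ']
  rw [rho_apply, map_div, h, hk.act_nm, div_self']

lemma nm_rho_iterate {k : ℕ} (h1 : 1 ≤ k) (x : Eˣ) : nm p σ ((rho σ)^[k] x) = 1 := by
  obtain ⟨k, rfl⟩ := Nat.exists_eq_add_of_le' h1
  rw [Function.iterate_succ_apply', hk.nm_rho]

lemma coe_nm (x : Eˣ) : ((nm p σ x : Eˣ) : E) = algebraMap F E (Algebra.norm F (x : E)) := by
  have := hk.finiteDimensional
  have := hk.isGalois
  rw [Algebra.norm_eq_prod_automorphisms, nm_apply, Units.coe_prod]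
  refine Finset.prod_bij (fun s _ => σ ^ s) (fun _ _ => Finset.mem_univ _) ?_ ?_ fun _ _ => rfl
  · intro s hs t ht hst
    rw [Finset.mem_range] at hs ht
    exact pow_injOn_Iio_orderOf (by simpa [hk.orderOf] using hs) (by simpa [hk.orderOf] using ht)
      hst
  · intro g _
    obtain ⟨n, hn, rfl⟩ := hk.exists_pow_eq g
    exact ⟨n, Finset.mem_range.2 hn, rfl⟩

lemma rho_r : rho σ r = incl E ξ := by
  rw [rho_apply, hk.act_r, mul_div_cancel_right]

lemma rho_iterate_r {k : ℕ} (h2 : 2 ≤ k) : (rho σ)^[k] r = 1 := by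
  obtain ⟨k, rfl⟩ := Nat.exists_eq_add_of_le' h2
  rw [Function.iterate_add_apply, Function.iterate_succ_apply, hk.rho_r,
    rho_iterate_incl _ le_rfl, rho_iterate_one]

lemma nm_r : nm p σ r = r ^ p := by
  rw [nm_apply]
  simp only [hk.act_pow_r]
  rw [Finset.prod_mul_distrib, Finset.prod_pow_eq_pow_sum, Finset.prod_const, Finset.card_range]
  -- Oddness of `p` enters here: `ξ` occurs with exponent `p (p - 1) / 2`. For `p = 2` the norm
  -- would be `-r^2`.
  have : p ∣ ∑ i ∈ Finset.range p, i := by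
    rw [Finset.sum_range_id]
    obtain ⟨m, hm⟩ := hk.odd
    refine ⟨m, ?_⟩
    rw [hm, show 2 * m + 1 - 1 = 2 * m by omega, mul_left_comm, Nat.mul_div_cancel_left _ two_pos]
  rw [(hk.prim_incl.pow_eq_one_iff_dvd _).2 this, one_mul]

/-- Hilbert's Theorem 90. -/
lemma exists_rho_eq {x : Eˣ} (hx : nm p σ x = 1) : ∃ y, rho σ y = x := by
  have := hk.finiteDimensional
  choose n hn1 hn2 using hk.exists_pow_eq
  -- The cocycle is `σ^n ↦ P n`. Since `P p = N(x) = 1`, `P` has period `p`, so the choice of the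
  -- exponents is immaterial.
  let P : ℕ → Eˣ := fun n => ∏ s ∈ Finset.range n, act (σ ^ s) x
  have hP : ∀ n m, P (n + m) = act (σ ^ n) (P m) * P n := by
    intro n m
    simp only [P]
    rw [Finset.prod_range_add, mul_comm, map_prod]
    simp only [pow_add, act_mul]
  have hPp : P p = 1 := by rw [← hx, nm_apply]
  have hPm : ∀ m, P (p * m) = 1 := by
    intro m
    induction m with
    | zero => rw [mul_zero]; exact Finset.prod_range_zero _
    | succ m ih => rw [mul_add, mul_one, hP, hPp, ih, map_one, one_mul]
  have hmod : ∀ m, P m = P (m % p) := by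
    intro m
    conv_lhs => rw [← Nat.mod_add_div m p]
    rw [hP, hPm, map_one, one_mul]
  have hnP : ∀ m, P (n (σ ^ m)) = P m := by
    intro m
    have h1 := pow_inj_mod (n := m) (m := n (σ ^ m)) (x := σ)
    rw [hn2, hk.orderOf] at h1
    rw [hmod m, hmod (n _), h1.1 rfl]
  obtain ⟨β, hβ⟩ := groupCohomology.isMulCoboundary₁_of_isMulCocycle₁_of_aut_to_units
    (K := F) (fun g => P (n g)) (by
      intro g h
      have e1 : g * h = σ ^ (n g + n h) := by rw [pow_add, hn2, hn2]
      change P (n (g * h)) = g • P (n h) * P (n g)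
      rw [e1, hnP, hP, hn2]
      rfl)
  refine ⟨β, ?_⟩
  have h2 := hβ σ
  have h3 : P (n σ) = x := by
    have h4 := hnP 1
    rw [pow_one] at h4
    rw [h4]
    simp [P, act_one]
  change act σ β / β = x
  rw [← h3]
  exact h2

end IsKummer

/-- The subgroup of those `x` whose norm is the `p`-th power of an element of `F`. -/
def normPow {F E : Type*} [Field F] [Field E] [Algebra F E] (p : ℕ) (σ : E ≃ₐ[F] E) :
    Subgroup Eˣ :=
  (((incl E : Fˣ →* Eˣ).range).map (powMonoidHom p)).comap (nm p σ)

lemma mem_normPow {F E : Type*} [Field F] [Field E] [Algebra F E] {p : ℕ} {σ : E ≃ₐ[F] E}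
    {x : Eˣ} : x ∈ normPow p σ ↔ ∃ f : Fˣ, nm p σ x = incl E f ^ p := by
  simp only [normPow, Subgroup.mem_comap, Subgroup.mem_map, MonoidHom.mem_range,
    powMonoidHom_apply]
  constructor
  · rintro ⟨_, ⟨f, rfl⟩, h⟩; exact ⟨f, h.symm⟩
  · rintro ⟨f, h⟩; exact ⟨_, ⟨f, rfl⟩, h.symm⟩

/-! ### Elements whose norm is a `p`-th power in `F` -/

namespace IsKummer

variable {F E : Type*} [Field F] [Field E] [Algebra F E] {p : ℕ} [hpf : Fact p.Prime] {ξ : Fˣ}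
  {r : Eˣ} {σ : E ≃ₐ[F] E} (hk : IsKummer p ξ r σ)

lemma incl_mem_normPow (f : Fˣ) : incl E f ∈ normPow p σ := mem_normPow.2 ⟨f, nm_incl σ f⟩

include hk

lemma pow_mem_normPow (x : Eˣ) : x ^ p ∈ normPow p σ := by
  obtain ⟨f, hf⟩ := hk.exists_incl_eq (hk.act_nm x)
  exact mem_normPow.2 ⟨f, by rw [map_pow, hf]⟩

lemma rho_iterate_mem_normPow {k : ℕ} (h1 : 1 ≤ k) (x : Eˣ) : (rho σ)^[k] x ∈ normPow p σ :=
  mem_normPow.2 ⟨1, by rw [hk.nm_rho_iterate h1, map_one, one_pow]⟩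

lemma zpow_mem_normPow {m : ℤ} (hm : (p : ℤ) ∣ m) (x : Eˣ) : x ^ m ∈ normPow p σ := by
  obtain ⟨n, rfl⟩ := hm
  rw [zpow_mul, zpow_natCast]
  exact Subgroup.zpow_mem _ (hk.pow_mem_normPow x) n

lemma notMem_normPow_of_cls_ne {x : Eˣ} (h : cls p ((rho σ)^[p - 1] x) ≠ 1) :
    x ∉ normPow p σ := by
  intro hx
  obtain ⟨f, hf⟩ := mem_normPow.1 hx
  exact h (by rw [← cls_nm, hf, cls_pow_self])

/-- As `N(r) = r^p`, membership would make `r^m / f` a `p`-th root of unity for some `f ∈ F^×`,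
hence killed by `ρ`, whereas `ρ(r^m) = ξ^m ≠ 1`. -/
lemma r_pow_notMem_normPow {m : ℤ} (hm : ¬ (p : ℤ) ∣ m) : r ^ m ∉ normPow p σ := by
  intro h
  obtain ⟨f, hf⟩ := mem_normPow.1 h
  rw [map_zpow, hk.nm_r, ← zpow_natCast, zpow_comm, zpow_natCast] at hf
  have h1 : (r ^ m / incl E f) ^ p = 1 := by rw [div_pow, hf, div_self']
  obtain ⟨n, hn⟩ := hk.exists_incl_pow_eq h1
  have h2 := congrArg (rho σ) hn
  rw [map_div, map_pow, map_zpow, rho_incl, one_pow, hk.rho_r, rho_incl, div_one] at h2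
  exact hm ((hk.prim_incl.zpow_eq_one_iff_dvd m).1 h2.symm)

/-- If `N(x) = d^p`, then `ρ(d)^p = ρ(N(x)) = 1`, so `ρ(d) = ξ^n` and `d r^{-n}` lies in `F`. Since
`N(r) = r^p`, the factor `r^{-n}` corrects `x`. Hence `r` generates the quotient by `normPow`. -/
lemma exists_mul_r_mem_normPow {x : Eˣ} (hx : cls p ((rho σ)^[p - 1] x) = 1) :
    ∃ k : ℤ, x * r ^ k ∈ normPow p σ := by
  rw [← cls_nm, cls_eq_one] at hx
  obtain ⟨d, hd⟩ := hx
  have h1 : (rho σ d) ^ p = 1 := by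
    rw [← map_pow, hd, rho_apply, hk.act_nm, div_self']
  obtain ⟨n, hn⟩ := hk.exists_incl_pow_eq h1
  obtain ⟨f, hf⟩ := hk.exists_incl_eq (x := d * r ^ (-(n : ℤ))) (by
    rw [act_eq_rho_mul, map_mul, map_zpow, hk.rho_r, ← hn, zpow_neg, zpow_natCast,
      mul_inv_cancel, one_mul])
  refine ⟨-(n : ℤ), mem_normPow.2 ⟨f, ?_⟩⟩
  rw [hf, map_mul, map_zpow, hk.nm_r, mul_pow, hd, ← zpow_natCast, ← zpow_natCast, zpow_comm]

lemma exists_zpow_mul_mem_normPow {x y : Eˣ} (hx : cls p ((rho σ)^[p - 1] x) = 1)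
    (hy : cls p ((rho σ)^[p - 1] y) = 1) (hx' : x ∉ normPow p σ) (hy' : y ∉ normPow p σ) :
    ∃ m : ℤ, ¬ (p : ℤ) ∣ m ∧ x ^ m * y⁻¹ ∈ normPow p σ := by
  obtain ⟨k, hkx⟩ := hk.exists_mul_r_mem_normPow hx
  obtain ⟨l, hly⟩ := hk.exists_mul_r_mem_normPow hy
  have hk' : ¬ (p : ℤ) ∣ k := fun h =>
    hx' ((Subgroup.mul_mem_cancel_right _ (hk.zpow_mem_normPow h r)).1 hkx)
  have hl' : ¬ (p : ℤ) ∣ l := fun h =>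
    hy' ((Subgroup.mul_mem_cancel_right _ (hk.zpow_mem_normPow h r)).1 hly)
  have hpp : Prime (p : ℤ) := Nat.prime_iff_prime_int.1 hpf.out
  obtain ⟨u, v, huv⟩ := (hpp.coprime_iff_not_dvd).2 hk'
  -- With `v` inverse to `k` modulo `p`, the powers of `r` in `(x r^k)^{vl} (y r^l)^{-1}` cancel up
  -- to a `p`-th power.
  have hm : (p : ℤ) ∣ k * (v * l) - l := ⟨-(u * l), by linear_combination l * huv⟩
  refine ⟨v * l, fun h => hl' ?_, ?_⟩
  · exact (dvd_sub_right (Dvd.dvd.mul_left h k)).1 hm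
  · have h1 := Subgroup.mul_mem _ (Subgroup.zpow_mem _ hkx (v * l)) (Subgroup.inv_mem _ hly)
    have h2 := hk.zpow_mem_normPow hm r
    rw [← Subgroup.mul_mem_cancel_right _ h2]
    convert h1 using 1
    rw [mul_zpow, zpow_sub, ← zpow_mul, mul_inv]
    simp only [mul_comm, mul_left_comm, mul_assoc]

/-- Elements of length at most `i` with norm in `F^{×p}` lie in the image of `ρ^{p-i}`, up to
elements of `F^×`. -/
lemma exists_eq_incl_mul_rho {i t : ℕ} (hi : 1 ≤ i) (ht : 1 ≤ t) (hit : i + t = p) {x : Eˣ}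
    (hx : x ∈ normPow p σ) (hxi : cls p ((rho σ)^[i] x) = 1) :
    ∃ (f : Fˣ) (ω : Eˣ), x = incl E f * (rho σ)^[t] ω := by
  induction t, ht using Nat.le_induction generalizing i x with
  | base =>
    obtain ⟨f, hf⟩ := mem_normPow.1 hx
    obtain ⟨y, hy⟩ := hk.exists_rho_eq (x := x * (incl E f)⁻¹) (by
      rw [map_mul, map_inv, nm_incl, hf, mul_inv_cancel])
    exact ⟨f, y, by rw [Function.iterate_one, hy]; simp⟩
  | succ t ht ih =>
    obtain ⟨f, hf⟩ := mem_normPow.1 hx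
    obtain ⟨y, hy⟩ := hk.exists_rho_eq (x := x * (incl E f)⁻¹) (by
      rw [map_mul, map_inv, nm_incl, hf, mul_inv_cancel])
    have hyi : cls p ((rho σ)^[i + 1] y) = 1 := by
      rw [Function.iterate_succ_apply, hy, rho_iterate_mul, rho_iterate_inv,
        rho_iterate_incl σ hi, inv_one, mul_one, hxi]
    -- The preimage `y` has length at most `i + 1`, but need not lie in `normPow`. Multiplying by
    -- `r^k` repairs this without changing the length bound, since `i + 1 ≥ 2`; after applying `ρ`
    -- it costs only the factor `ξ^k ∈ F^×`.
    obtain ⟨k, hkk⟩ := hk.exists_mul_r_mem_normPow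
      (cls_rho_eq_one_of_le (show i + 1 ≤ p - 1 by omega) hyi)
    obtain ⟨f', ω, h⟩ := ih (show 1 ≤ i + 1 by omega) (by omega) hkk (by
      rw [rho_iterate_mul, rho_iterate_zpow, hk.rho_iterate_r (by omega), one_zpow, mul_one, hyi])
    refine ⟨f * ξ ^ (-k), ω, ?_⟩
    have h2 := congrArg (rho σ) h
    rw [map_mul, map_mul, map_zpow, hk.rho_r, hy, rho_incl, one_mul,
      ← Function.iterate_succ_apply' (rho σ)] at h2
    rw [← h2, map_mul, map_zpow, zpow_neg]
    generalize incl E f = u, incl E ξ ^ k = v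
    rw [mul_comm u, mul_assoc, mul_comm x, mul_assoc u⁻¹, mul_inv_cancel_left, mul_comm x,
      inv_mul_cancel_left]

end IsKummer

/-! ## Radical extensions inside `Ω` -/

section Restrict

variable {F Ω : Type*} [Field F] [Field Ω] [Algebra F Ω] {K E : IntermediateField F Ω}

lemma Restricts.one : Restricts (1 : K ≃ₐ[F] K) (1 : E ≃ₐ[F] E) := fun _ _ h => h

lemma Restricts.mul {t t' : K ≃ₐ[F] K} {g g' : E ≃ₐ[F] E} (h : Restricts t g)
    (h' : Restricts t' g') : Restricts (t * t') (g * g') := fun _ _ hxy => h _ _ (h' _ _ hxy)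

lemma Restricts.inv (hKE : K ≤ E) {t : K ≃ₐ[F] K} {g : E ≃ₐ[F] E} (h : Restricts t g) :
    Restricts t⁻¹ g⁻¹ := by
  intro x y hxy
  have h1 := h (t⁻¹ x) ⟨(t⁻¹ x : K), hKE (t⁻¹ x).2⟩ rfl
  have h2 : t (t⁻¹ x) = x := t.apply_symm_apply x
  rw [h2, hxy] at h1
  have h3 : y = g ⟨(t⁻¹ x : K), hKE (t⁻¹ x).2⟩ := Subtype.ext h1
  rw [h3]
  exact (congrArg Subtype.val (g.symm_apply_apply ⟨(t⁻¹ x : K), hKE (t⁻¹ x).2⟩)).symm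

lemma Restricts.pow {t : K ≃ₐ[F] K} {g : E ≃ₐ[F] E} (h : Restricts t g) (n : ℕ) :
    Restricts (t ^ n) (g ^ n) := by
  induction n with
  | zero => exact Restricts.one
  | succ n ih => rw [pow_succ, pow_succ]; exact ih.mul h

lemma Restricts.unique (hKE : K ≤ E) {t t' : K ≃ₐ[F] K} {g : E ≃ₐ[F] E} (h : Restricts t g)
    (h' : Restricts t' g) : t = t' := by
  apply AlgEquiv.ext
  intro x
  exact Subtype.ext ((h x ⟨x, hKE x.2⟩ rfl).trans (h' x ⟨x, hKE x.2⟩ rfl).symm)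

lemma exists_lift (hKE : K ≤ E) [Normal F K] [Normal F E] (t : K ≃ₐ[F] K) :
    ∃ g : E ≃ₐ[F] E, Restricts t g := by
  let _ : Algebra K E := (IntermediateField.inclusion hKE).toRingHom.toAlgebra
  have : IsScalarTower F K E := IsScalarTower.of_algebraMap_eq fun x => rfl
  refine ⟨t.liftNormal E, fun x y hxy => ?_⟩
  have h1 := t.liftNormal_commutes E x
  have h2 : algebraMap K E x = y := Subtype.ext hxy
  rw [h2] at h1
  exact (congrArg Subtype.val h1).symm

lemma exists_mem_eq_of_fixed (hKE : K ≤ E) [FiniteDimensional F E] [IsGalois F E] {x : E}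
    (hx : ∀ g : E ≃ₐ[F] E, Restricts (1 : K ≃ₐ[F] K) g → g x = x) : (x : Ω) ∈ K := by
  have h1 : x ∈ IntermediateField.fixedField
      (IntermediateField.fixingSubgroup (IntermediateField.restrict hKE)) := by
    rw [IntermediateField.mem_fixedField_iff]
    intro g hg
    refine hx g fun y z hyz => ?_
    have h2 := (IntermediateField.mem_fixingSubgroup_iff _ _).1 hg z
      ((IntermediateField.mem_restrict hKE z).2 (hyz ▸ y.2))
    rw [h2]; exact hyz
  rwa [IsGalois.fixedField_fixingSubgroup, IntermediateField.mem_restrict] at h1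

end Restrict

/-! ### Elements of `K` that become `p`-th powers in a larger field -/

section Roots

variable {F Ω : Type*} [Field F] [Field Ω] [Algebra F Ω] {K : IntermediateField F Ω} {p : ℕ}

/-- The subgroup of those `u ∈ K^×` that have a `p`-th root in `E`. -/
def rts (p : ℕ) (K E : IntermediateField F Ω) : Subgroup Kˣ where
  carrier := {u | ∃ c ∈ E, c ^ p = ((u : K) : Ω)}
  one_mem' := ⟨1, one_mem _, by simp⟩
  mul_mem' := by
    rintro u v ⟨c, hc, hcu⟩ ⟨d, hd, hdv⟩
    exact ⟨c * d, mul_mem hc hd, by rw [mul_pow, hcu, hdv]; simp⟩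
  inv_mem' := by
    rintro u ⟨c, hc, hcu⟩
    exact ⟨c⁻¹, inv_mem hc, by rw [inv_pow, hcu]; simp⟩

lemma rts_mono {E E' : IntermediateField F Ω} (h : E ≤ E') : rts p K E ≤ rts p K E' :=
  fun _ ⟨c, hc, hcu⟩ => ⟨c, h hc, hcu⟩

lemma pow_mem_rts {E : IntermediateField F Ω} (hKE : K ≤ E) (q : Kˣ) : q ^ p ∈ rts p K E :=
  ⟨q, hKE (q : K).2, by simp⟩

lemma mem_rts_congr {E : IntermediateField F Ω} (hKE : K ≤ E) {x y : Kˣ} (h : cls p x = cls p y) :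
    x ∈ rts p K E ↔ y ∈ rts p K E := by
  obtain ⟨q, rfl⟩ := cls_eq_cls.1 h
  exact Subgroup.mul_mem_cancel_right _ (pow_mem_rts hKE q)

lemma exists_root [IsAlgClosed Ω] [Fact p.Prime] (u : Kˣ) :
    ∃ c : Ω, c ^ p = ((u : K) : Ω) :=
  IsAlgClosed.exists_pow_nat_eq _ (Fact.out : p.Prime).pos

lemma root_ne_zero [Fact p.Prime] {u : Kˣ} {c : Ω} (hc : c ^ p = ((u : K) : Ω)) : c ≠ 0 := by
  rintro rfl
  rw [zero_pow (Fact.out : p.Prime).ne_zero] at hc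
  exact u.ne_zero (Subtype.ext hc.symm)

lemma rts_stable {E : IntermediateField F Ω} {t : K ≃ₐ[F] K} {g : E ≃ₐ[F] E}
    (htg : Restricts t g) {u : Kˣ} {c : E} (hc : (c : Ω) ^ p = ((u : K) : Ω)) :
    ((g c : E) : Ω) ^ p = ((act t u : Kˣ) : K) := by
  rw [coe_act, htg u (c ^ p) (by rw [← hc]; rfl), map_pow]
  rfl

lemma act_mem_rts {E : IntermediateField F Ω} (hKE : K ≤ E) [Normal F K] [Normal F E]
    (t : K ≃ₐ[F] K) {u : Kˣ} (hu : u ∈ rts p K E) : act t u ∈ rts p K E := by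
  obtain ⟨g, hg⟩ := exists_lift hKE t
  obtain ⟨c, hc, hcu⟩ := hu
  exact ⟨_, (g ⟨c, hc⟩).2, rts_stable hg hcu⟩

lemma rho_mem_rts {E : IntermediateField F Ω} (hKE : K ≤ E) [Normal F K] [Normal F E]
    (t : K ≃ₐ[F] K) {u : Kˣ} (hu : u ∈ rts p K E) : rho t u ∈ rts p K E :=
  div_mem (act_mem_rts hKE t hu) hu

lemma rho_iterate_mem_rts {E : IntermediateField F Ω} (hKE : K ≤ E) [Normal F K] [Normal F E]
    (t : K ≃ₐ[F] K) {u : Kˣ} (hu : u ∈ rts p K E) (k : ℕ) : (rho t)^[k] u ∈ rts p K E := by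
  induction k with
  | zero => exact hu
  | succ k ih => rw [Function.iterate_succ_apply']; exact rho_mem_rts hKE t ih

/-- The conjugates of `β`. -/
def orbit (t : K ≃ₐ[F] K) (β : Kˣ) : Set Kˣ := Set.range fun s : ℕ => act (t ^ s) β

lemma orbit_subset_rts {E : IntermediateField F Ω} (hKE : K ≤ E) [Normal F K] [Normal F E]
    (t : K ≃ₐ[F] K) {u : Kˣ} (hu : u ∈ rts p K E) : orbit t u ⊆ rts p K E := by
  rintro _ ⟨s, rfl⟩
  exact act_mem_rts hKE _ hu

/-- Conjugates in terms of iterates of `ρ`. -/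
lemma orbit_subset_of_rho {t : K ≃ₐ[F] K} {β : Kˣ} {R : Subgroup Kˣ}
    (h : ∀ k, (rho t)^[k] β ∈ R) : orbit t β ⊆ R := by
  have key : ∀ (s k : ℕ), (rho t)^[k] (act (t ^ s) β) ∈ R := by
    intro s
    induction s with
    | zero => intro k; rw [pow_zero, act_one]; exact h k
    | succ s ih =>
      intro k
      rw [pow_succ', act_mul, act_eq_rho_mul, rho_iterate_mul, ← Function.iterate_succ_apply]
      exact mul_mem (ih _) (ih k)
  rintro _ ⟨s, rfl⟩
  exact key s 0

lemma mem_adjoinRoots {E : IntermediateField F Ω} {S : Set Kˣ} {u : Kˣ} (hu : u ∈ S) {x : Ω}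
    (hx : x ^ p = ((u : K) : Ω)) : x ∈ adjoinRoots p E S :=
  IntermediateField.subset_adjoin _ _ (Or.inr ⟨u, hu, hx⟩)

lemma le_adjoinRoots {E : IntermediateField F Ω} (S : Set Kˣ) : E ≤ adjoinRoots p E S :=
  fun _ hx => IntermediateField.subset_adjoin _ _ (Or.inl hx)

lemma subset_rts_adjoinRoots [IsAlgClosed Ω] [Fact p.Prime] {E : IntermediateField F Ω}
    (S : Set Kˣ) : S ⊆ rts p K (adjoinRoots p E S) := by
  intro u hu
  obtain ⟨c, hc⟩ := exists_root (p := p) u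
  exact ⟨c, mem_adjoinRoots hu hc, hc⟩

end Roots

/-! ### Galois radical extensions of `K` -/

namespace IsKummer

variable {F Ω : Type*} [Field F] [Field Ω] [Algebra F Ω] {K E : IntermediateField F Ω} {p : ℕ}
  [hpf : Fact p.Prime] {ξ : Fˣ} {r : Kˣ} {σ : K ≃ₐ[F] K} (hk : IsKummer p ξ r σ)

include hk

lemma normal : Normal F K := by
  have := hk.isGalois
  infer_instance

lemma exists_root_eq {x y : Ω} (hy : y ≠ 0) (h : x ^ p = y ^ p) :
    ∃ n : ZMod p, x = algebraMap F Ω (ξ : F) ^ n.val * y := by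
  have h1 : IsPrimitiveRoot (algebraMap F Ω (ξ : F)) p :=
    (IsPrimitiveRoot.coe_units_iff.2 hk.prim).map_of_injective (algebraMap F Ω).injective
  have : NeZero p := ⟨hpf.out.ne_zero⟩
  obtain ⟨n, hn, hn'⟩ := h1.eq_pow_of_pow_eq_one (ξ := x / y) (by
    rw [div_pow, h, div_self (pow_ne_zero _ hy)])
  refine ⟨n, ?_⟩
  rw [ZMod.val_natCast_of_lt hn, hn', div_mul_cancel₀ _ hy]

lemma root_mem {u : Kˣ} (hu : u ∈ rts p K E) {x : Ω} (hx : x ^ p = ((u : K) : Ω)) : x ∈ E := by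
  obtain ⟨c, hc, hcu⟩ := hu
  obtain ⟨n, rfl⟩ := hk.exists_root_eq (root_ne_zero hcu) (hx.trans hcu.symm)
  exact mul_mem (_root_.pow_mem (E.algebraMap_mem _) _) hc

lemma adjoinRoots_le {L : IntermediateField F Ω} {S : Set Kˣ} (hL : L ≤ E) (hS : S ⊆ rts p K E) :
    adjoinRoots p L S ≤ E := by
  rw [adjoinRoots, IntermediateField.adjoin_le_iff, Set.union_subset_iff]
  refine ⟨hL, ?_⟩
  rintro x ⟨s, hs, hx⟩
  exact hk.root_mem (hS hs) hx

/-- The image of `r` is another `p`-th root of `a`, so it is `ξ^n r`, and `r` generates `K`. -/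
lemma exists_algHom_eq (f : K →ₐ[F] Ω) : ∃ n : ℕ, ∀ x : K, f x = ((σ ^ n) x : K) := by
  obtain ⟨a, ha⟩ := hk.pow_mem
  have hra : ((r : K) : Ω) ^ p = algebraMap F Ω a := congrArg (fun u : Kˣ => ((u : K) : Ω)) ha
  have hfr : f r ^ p = algebraMap F Ω a := by
    rw [← map_pow, ← f.commutes (a : F)]
    exact congrArg (fun u : Kˣ => f u) ha
  have hr0 : ((r : K) : Ω) ≠ 0 := fun h => r.ne_zero (Subtype.ext h)
  obtain ⟨n, hn⟩ := hk.exists_root_eq hr0 (hfr.trans hra.symm)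
  refine ⟨n.val, fun x => ?_⟩
  have hx : x ∈ IntermediateField.adjoin F {(r : K)} := hk.adjoin ▸ IntermediateField.mem_top
  induction hx using IntermediateField.adjoin_induction with
  | mem x hx =>
    rw [Set.mem_singleton_iff.1 hx, hn]
    have := congrArg (fun u : Kˣ => ((u : K) : Ω)) (hk.act_pow_r n.val)
    simp only [coe_act] at this
    rw [this]
    simp [coe_incl]
  | algebraMap x => rw [f.commutes, AlgEquiv.commutes]; rfl
  | add x y _ _ hx hy => rw [map_add, map_add, hx, hy]; rfl
  | inv x _ hx => rw [map_inv₀, map_inv₀, hx]; rfl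
  | mul x y _ _ hx hy => rw [map_mul, map_mul, hx, hy]; rfl

lemma exists_restricts (hKE : K ≤ E) (g : E ≃ₐ[F] E) : ∃ n : ℕ, Restricts (σ ^ n) g := by
  obtain ⟨n, hn⟩ := hk.exists_algHom_eq
    (E.val.comp ((g : E →ₐ[F] E).comp (IntermediateField.inclusion hKE)))
  refine ⟨n, fun x y hxy => ?_⟩
  rw [← hn x]
  have : IntermediateField.inclusion hKE x = y := Subtype.ext hxy
  rw [AlgHom.comp_apply, AlgHom.comp_apply, this]
  rfl

lemma natCast_ne_zero : (p : F) ≠ 0 := by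
  have : NeZero p := ⟨hpf.out.ne_zero⟩
  have h1 := IsPrimitiveRoot.coe_units_iff.2 hk.prim
  exact (h1.neZero').out

lemma isSeparable_root {u : Kˣ} {x : Ω} (hx : x ^ p = ((u : K) : Ω)) : IsSeparable F x := by
  have := hk.isGalois
  have hp : (p : K) ≠ 0 := by
    have := (map_ne_zero (algebraMap F K)).2 hk.natCast_ne_zero
    rwa [map_natCast] at this
  have h1 : IsSeparable K x :=
    (Polynomial.separable_X_pow_sub_C (u : K) hp u.ne_zero).of_dvd (minpoly.dvd K x (by
      simp only [map_sub, map_pow, Polynomial.aeval_X, Polynomial.aeval_C]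
      rw [hx]
      exact sub_self _))
  exact IsSeparable.of_algebra_isSeparable_of_isSeparable F h1

lemma finiteDimensional_adjoinRoots {S : Set Kˣ} (hS : S.Finite) :
    FiniteDimensional F (adjoinRoots p K S) := by
  have := hk.finiteDimensional
  have hT : {x : Ω | ∃ s ∈ S, x ^ p = ((s : K) : Ω)}.Finite := by
    have : {x : Ω | ∃ s ∈ S, x ^ p = ((s : K) : Ω)} =
        ⋃ s ∈ S, {x | x ^ p = ((s : K) : Ω)} := by ext; simp
    rw [this]
    refine hS.biUnion fun s _ => ?_
    refine (Polynomial.nthRoots p ((s : K) : Ω)).finite_toSet.subset fun x hx => ?_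
    exact (Polynomial.mem_nthRoots hpf.out.pos).2 hx
  have := hT.to_subtype
  rw [adjoinRoots, IntermediateField.adjoin_union, IntermediateField.adjoin_self]
  have : FiniteDimensional F
      (IntermediateField.adjoin F {x : Ω | ∃ s ∈ S, x ^ p = ((s : K) : Ω)}) :=
    IntermediateField.finiteDimensional_adjoin fun x hx => by
      obtain ⟨s, -, hx⟩ := hx
      exact (hk.isSeparable_root hx).isIntegral
  exact IntermediateField.finiteDimensional_sup _ _

lemma isSeparable_adjoinRoots (S : Set Kˣ) : Algebra.IsSeparable F (adjoinRoots p K S) := by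
  have := hk.isGalois
  rw [adjoinRoots, IntermediateField.isSeparable_adjoin_iff_isSeparable]
  rintro x (hx | ⟨s, -, hx⟩)
  · have := Algebra.IsSeparable.isSeparable F (⟨x, hx⟩ : K)
    exact IsSeparable.map (K := K) (x := ⟨x, hx⟩) K.val K.val.injective this
  · exact hk.isSeparable_root hx

/-- An embedding of `K(ᵖ√s : s ∈ S₀)` into `Ω` takes values in `K(ᵖ√s : s ∈ S)` when `S ⊇ S₀` is stable
under conjugation. -/
lemma fieldRange_le {S₀ S : Set Kˣ} (hS₀ : S₀ ⊆ S) (hS : ∀ u ∈ S, ∀ n : ℕ, act (σ ^ n) u ∈ S)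
    (f : adjoinRoots p K S₀ →ₐ[F] Ω) : f.fieldRange ≤ adjoinRoots p K S := by
  obtain ⟨n, hn⟩ := hk.exists_algHom_eq
    (f.comp (IntermediateField.inclusion (le_adjoinRoots (p := p) (E := K) S₀)))
  have hn' : ∀ (x : Ω) (hx : x ∈ K), f ⟨x, le_adjoinRoots S₀ hx⟩ = ((σ ^ n) ⟨x, hx⟩ : K) :=
    fun x hx => hn ⟨x, hx⟩
  rintro _ ⟨⟨x, hx⟩, rfl⟩
  change f ⟨x, hx⟩ ∈ _
  refine IntermediateField.adjoin_induction F
    (p := fun y (hy : y ∈ adjoinRoots p K S₀) => f ⟨y, hy⟩ ∈ adjoinRoots p K S)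
    ?_ ?_ ?_ ?_ ?_ hx
  · rintro x (hx | ⟨s, hs, hx'⟩)
    · rw [hn' x hx]
      exact le_adjoinRoots S ((σ ^ n) ⟨x, hx⟩).2
    · refine mem_adjoinRoots (hS s (hS₀ hs) n) ?_
      rw [← map_pow]
      exact (congrArg f (Subtype.ext hx')).trans (hn' ((s : K) : Ω) (s : K).2)
  · intro x
    have : f (algebraMap F _ x) = algebraMap F Ω x := f.commutes x
    exact Eq.mpr (congrArg (· ∈ _) this) (IntermediateField.algebraMap_mem _ _)
  · intro x y hx hy ihx ihy
    exact Eq.mpr (congrArg (· ∈ _) (map_add f ⟨x, hx⟩ ⟨y, hy⟩)) (add_mem ihx ihy)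
  · intro x hx ihx
    exact Eq.mpr (congrArg (· ∈ _) (map_inv₀ f ⟨x, hx⟩)) (inv_mem ihx)
  · intro x y hx hy ihx ihy
    exact Eq.mpr (congrArg (· ∈ _) (map_mul f ⟨x, hx⟩ ⟨y, hy⟩)) (mul_mem ihx ihy)

lemma isGalois_adjoinRoots [IsAlgClosed Ω] {S : Set Kˣ}
    (hS : ∀ u ∈ S, ∀ n : ℕ, act (σ ^ n) u ∈ S) : IsGalois F (adjoinRoots p K S) := by
  have h1 := hk.isSeparable_adjoinRoots S
  have h2 : IntermediateField.normalClosure F (adjoinRoots p K S) Ω = adjoinRoots p K S := by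
    apply le_antisymm
    · exact normalClosure_le_iff.2 fun f => hk.fieldRange_le subset_rfl hS f
    · exact (AlgHom.fieldRange_le_normalClosure (adjoinRoots p K S).val).trans' (by
        rw [IntermediateField.fieldRange_val])
  have h3 : Algebra.IsAlgebraic F (adjoinRoots p K S) := inferInstance
  have h4 : Normal F (IntermediateField.normalClosure F (adjoinRoots p K S) Ω) :=
    (h3.isNormalClosure_normalClosure fun x => IsAlgClosed.splits _).normal
  rw [h2] at h4
  exact ⟨⟩

lemma act_mem_orbit (β : Kˣ) : ∀ u ∈ orbit σ β, ∀ n : ℕ, act (σ ^ n) u ∈ orbit σ β := by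
  rintro _ ⟨s, rfl⟩ n
  exact ⟨n + s, by simp only [pow_add, act_mul]⟩

lemma act_pow_mod (s : ℕ) (β : Kˣ) : act (σ ^ (s % p)) β = act (σ ^ s) β := by
  conv_rhs => rw [← Nat.mod_add_div s p, pow_add, pow_mul, hk.pow_prime, one_pow, mul_one]

lemma finite_orbit (β : Kˣ) : (orbit σ β).Finite := by
  refine ((Finset.range p).finite_toSet.image fun s => act (σ ^ s) β).subset ?_
  rintro _ ⟨s, rfl⟩
  exact ⟨s % p, by simpa using Nat.mod_lt _ hpf.out.pos, hk.act_pow_mod s β⟩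

lemma self_mem_orbit (β : Kˣ) : β ∈ orbit σ β := ⟨0, act_one β⟩

/-- An embedding of `K(ᵖ√γ)` sends roots of `γ` to roots of conjugates of `γ`; conversely, a normal
field with a root of `γ` contains roots of all its conjugates. -/
lemma normalClosure_eq [IsAlgClosed Ω] {γ : Kˣ} {L : IntermediateField F Ω}
    (hL : L = IntermediateField.normalClosure F (adjoinRoots p K {γ}) Ω) :
    L = adjoinRoots p K (orbit σ γ) := by
  have h0 := hk.normal
  have hle : adjoinRoots p K {γ} ≤ L := by
    rw [hL]
    exact (AlgHom.fieldRange_le_normalClosure (adjoinRoots p K {γ}).val).trans' (by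
        rw [IntermediateField.fieldRange_val])
  have h1 := hk.isSeparable_adjoinRoots {γ}
  have h3 : Algebra.IsAlgebraic F (adjoinRoots p K {γ}) := inferInstance
  have h4 : Normal F L := by
    rw [hL]
    exact (h3.isNormalClosure_normalClosure fun x => IsAlgClosed.splits _).normal
  have hKL : K ≤ L := (le_adjoinRoots _).trans hle
  apply le_antisymm
  · rw [hL]
    exact normalClosure_le_iff.2 fun f => hk.fieldRange_le
      (Set.singleton_subset_iff.2 (hk.self_mem_orbit γ)) (hk.act_mem_orbit γ) f
  · exact hk.adjoinRoots_le hKL (orbit_subset_rts hKL σ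
      (rts_mono hle (subset_rts_adjoinRoots {γ} rfl)))

end IsKummer

/-! ## The Kummer pairing -/

open Classical in
/-- The Kummer pairing: the exponent `n` with `g(c) = ξ ^ n c` for every `p`-th root `c` of `u`
in `E`. -/
def pair (p : ℕ) {F Ω : Type*} [Field F] [Field Ω] [Algebra F Ω] {K E : IntermediateField F Ω}
    (ξ : Fˣ) (g : E ≃ₐ[F] E) (u : Kˣ) : ZMod p :=
  -- If `u` has no `p`-th root in `E`, the condition is vacuous and the value arbitrary; hence the
  -- hypotheses `u ∈ rts p K E` below.
  if h : ∃ n : ZMod p, ∀ c : E, (c : Ω) ^ p = ((u : K) : Ω) →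
    g c = algebraMap F E (ξ : F) ^ n.val * c then h.choose else 0

namespace IsKummer

variable {F Ω : Type*} [Field F] [Field Ω] [Algebra F Ω] {K E : IntermediateField F Ω} {p : ℕ}
  [hpf : Fact p.Prime] {ξ : Fˣ} {r : Kˣ} {σ : K ≃ₐ[F] K} (hk : IsKummer p ξ r σ)

include hk

lemma prim_alg (E : IntermediateField F Ω) : IsPrimitiveRoot (algebraMap F E (ξ : F)) p :=
  (IsPrimitiveRoot.coe_units_iff.2 hk.prim).map_of_injective (algebraMap F E).injective

lemma alg_pow_add (m n : ZMod p) : algebraMap F E (ξ : F) ^ (m + n).val =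
    algebraMap F E (ξ : F) ^ m.val * algebraMap F E (ξ : F) ^ n.val := by
  rw [← pow_add, ZMod.val_add]
  conv_rhs => rw [← Nat.mod_add_div (m.val + n.val) p, pow_add, pow_mul, (hk.prim_alg E).pow_eq_one,
    one_pow, mul_one]

lemma alg_pow_inj {m n : ZMod p} (h : algebraMap F E (ξ : F) ^ m.val =
    algebraMap F E (ξ : F) ^ n.val) : m = n := by
  have : NeZero p := ⟨hpf.out.ne_zero⟩
  exact ZMod.val_injective p ((hk.prim_alg E).pow_inj (ZMod.val_lt m) (ZMod.val_lt n) h)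

lemma exists_root_eq' {x y : E} (hy : y ≠ 0) (h : (x : Ω) ^ p = (y : Ω) ^ p) :
    ∃ n : ZMod p, x = algebraMap F E (ξ : F) ^ n.val * y := by
  obtain ⟨n, hn⟩ := hk.exists_root_eq (x := (x : Ω)) (y := (y : Ω))
    (fun h0 => hy (Subtype.ext h0)) h
  exact ⟨n, Subtype.ext (by rw [hn]; rfl)⟩

lemma root_ne_zero' {u : Kˣ} {c : E} (hc : (c : Ω) ^ p = ((u : K) : Ω)) : c ≠ 0 :=
  fun h => root_ne_zero hc (by rw [h]; rfl)

/-- The exponent is independent of the root: two roots differ by a power of `ξ ∈ F`, which `g`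
fixes. -/
lemma pair_spec {g : E ≃ₐ[F] E} (hg : Restricts (1 : K ≃ₐ[F] K) g) {u : Kˣ} {c : E}
    (hc : (c : Ω) ^ p = ((u : K) : Ω)) :
    g c = algebraMap F E (ξ : F) ^ (pair p ξ g u).val * c := by
  have h : ∃ n : ZMod p, ∀ c : E, (c : Ω) ^ p = ((u : K) : Ω) →
      g c = algebraMap F E (ξ : F) ^ n.val * c := by
    obtain ⟨n, hn⟩ := hk.exists_root_eq' (x := g c) (hk.root_ne_zero' hc)
      ((rts_stable hg hc).trans hc.symm)
    refine ⟨n, fun d hd => ?_⟩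
    obtain ⟨m, rfl⟩ := hk.exists_root_eq' (x := d) (hk.root_ne_zero' hc) (hd.trans hc.symm)
    rw [map_mul, map_pow, g.commutes, hn, mul_left_comm]
  rw [pair, dif_pos h]
  exact h.choose_spec c hc

lemma pair_eq {g : E ≃ₐ[F] E} (hg : Restricts (1 : K ≃ₐ[F] K) g) {u : Kˣ} {c : E}
    (hc : (c : Ω) ^ p = ((u : K) : Ω)) {n : ZMod p}
    (h : g c = algebraMap F E (ξ : F) ^ n.val * c) : pair p ξ g u = n :=
  hk.alg_pow_inj (mul_right_cancel₀ (hk.root_ne_zero' hc) ((hk.pair_spec hg hc).symm.trans h))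

lemma pair_eq_zero_iff {g : E ≃ₐ[F] E} (hg : Restricts (1 : K ≃ₐ[F] K) g) {u : Kˣ}
    {c : E} (hc : (c : Ω) ^ p = ((u : K) : Ω)) : pair p ξ g u = 0 ↔ g c = c := by
  constructor
  · intro h
    rw [hk.pair_spec hg hc, h, ZMod.val_zero, pow_zero, one_mul]
  · intro h
    exact hk.pair_eq hg hc (by rw [ZMod.val_zero, pow_zero, one_mul, h])

lemma pair_mul {g : E ≃ₐ[F] E} (hg : Restricts (1 : K ≃ₐ[F] K) g) {u v : Kˣ}
    (hu : u ∈ rts p K E) (hv : v ∈ rts p K E) :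
    pair p ξ g (u * v) = pair p ξ g u + pair p ξ g v := by
  obtain ⟨c, hc, hcu⟩ := hu
  obtain ⟨d, hd, hdv⟩ := hv
  have h1 := hk.pair_spec (c := ⟨c, hc⟩) hg hcu
  have h2 := hk.pair_spec (c := ⟨d, hd⟩) hg hdv
  refine hk.pair_eq (c := ⟨c, hc⟩ * ⟨d, hd⟩) hg ?_ ?_
  · change (c * d) ^ p = _
    rw [mul_pow, hcu, hdv]
    rfl
  · rw [map_mul, h1, h2, hk.alg_pow_add]
    ring

lemma pair_one {u : Kˣ} (hu : u ∈ rts p K E) :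
    pair p ξ (1 : E ≃ₐ[F] E) u = 0 := by
  obtain ⟨c, hc, hcu⟩ := hu
  exact (hk.pair_eq_zero_iff (c := ⟨c, hc⟩) Restricts.one hcu).2 rfl

lemma pair_mul_left {g h : E ≃ₐ[F] E} (hg : Restricts (1 : K ≃ₐ[F] K) g)
    (hh : Restricts (1 : K ≃ₐ[F] K) h) {u : Kˣ} (hu : u ∈ rts p K E) :
    pair p ξ (g * h) u = pair p ξ g u + pair p ξ h u := by
  obtain ⟨c, hc, hcu⟩ := hu
  have h1 := hk.pair_spec (c := ⟨c, hc⟩) hg hcu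
  have h2 := hk.pair_spec (c := ⟨c, hc⟩) hh hcu
  refine hk.pair_eq (c := ⟨c, hc⟩) (by simpa using hg.mul hh) hcu ?_
  rw [AlgEquiv.mul_apply, h2, map_mul, map_pow, g.commutes, h1, hk.alg_pow_add]
  ring

/-- The lift `s` carries roots of `u` to roots of `t(u)` and fixes `ξ`. This is the `G`-invariance
of the pairing. -/
lemma pair_conj {g s : E ≃ₐ[F] E} {t : K ≃ₐ[F] K} (hKE : K ≤ E)
    (hg : Restricts (1 : K ≃ₐ[F] K) g) (hs : Restricts t s) {u : Kˣ} (hu : u ∈ rts p K E) :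
    pair p ξ (s * g * s⁻¹) (act t u) = pair p ξ g u := by
  obtain ⟨c, hc, hcu⟩ := hu
  have h1 := hk.pair_spec (c := ⟨c, hc⟩) hg hcu
  refine hk.pair_eq (c := s ⟨c, hc⟩) ?_ (rts_stable hs hcu) ?_
  · simpa using (hs.mul hg).mul (hs.inv hKE)
  · have : s⁻¹ (s ⟨c, hc⟩) = ⟨c, hc⟩ := s.symm_apply_apply _
    rw [AlgEquiv.mul_apply, AlgEquiv.mul_apply, this, h1, map_mul, map_pow, s.commutes]

lemma pair_pow_self {g : E ≃ₐ[F] E} (hKE : K ≤ E) (hg : Restricts (1 : K ≃ₐ[F] K) g) (q : Kˣ) :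
    pair p ξ g (q ^ p) = 0 :=
  (hk.pair_eq_zero_iff (c := ⟨(q : K), hKE (q : K).2⟩) hg (by simp)).2
    (Subtype.ext (hg (q : K) _ rfl).symm)

lemma pair_congr {g : E ≃ₐ[F] E} (hKE : K ≤ E) (hg : Restricts (1 : K ≃ₐ[F] K) g) {u v : Kˣ}
    (hu : u ∈ rts p K E) (h : cls p u = cls p v) : pair p ξ g u = pair p ξ g v := by
  obtain ⟨q, hq⟩ := cls_eq_cls.1 h.symm
  rw [hq, hk.pair_mul hg hu (pow_mem_rts hKE q), hk.pair_pow_self hKE hg, add_zero]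

/-- Nondegeneracy on the side of `J`: a root fixed by `Gal(E/K)` lies in `K`. -/
lemma cls_eq_one_of_pair [FiniteDimensional F E] [IsGalois F E] (hKE : K ≤ E) {u : Kˣ}
    (hu : u ∈ rts p K E)
    (h : ∀ g : E ≃ₐ[F] E, Restricts (1 : K ≃ₐ[F] K) g → pair p ξ g u = 0) : cls p u = 1 := by
  obtain ⟨c, hc, hcu⟩ := hu
  have h1 : c ∈ K := exists_mem_eq_of_fixed (x := ⟨c, hc⟩) hKE fun g hg =>
    (hk.pair_eq_zero_iff (c := ⟨c, hc⟩) hg hcu).1 (h g hg)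
  have h0 : (⟨c, h1⟩ : K) ≠ 0 := fun h => root_ne_zero hcu (congrArg Subtype.val h)
  exact cls_eq_one.2 ⟨Units.mk0 ⟨c, h1⟩ h0, Units.ext (Subtype.ext hcu)⟩

lemma cls_eq_of_pair [FiniteDimensional F E] [IsGalois F E] (hKE : K ≤ E) {u v : Kˣ}
    (hu : u ∈ rts p K E) (hv : v ∈ rts p K E)
    (h : ∀ g : E ≃ₐ[F] E, Restricts (1 : K ≃ₐ[F] K) g → pair p ξ g u = pair p ξ g v) :
    cls p u = cls p v := by
  rw [← div_eq_one, ← cls_div]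
  refine hk.cls_eq_one_of_pair hKE (div_mem hu hv) fun g hg => ?_
  have h1 := hk.pair_mul hg (div_mem hu hv) hv
  rwa [div_mul_cancel, h g hg, right_eq_add] at h1

/-- An automorphism over `K` of `K(ᵖ√s : s ∈ S)` is determined by its pairings with `S`. -/
lemma eq_one_of_pair [IsAlgClosed Ω] {S : Set Kˣ} (hE : E = adjoinRoots p K S) {g : E ≃ₐ[F] E}
    (hg : Restricts (1 : K ≃ₐ[F] K) g) (h : ∀ u ∈ S, pair p ξ g u = 0) : g = 1 := by
  subst hE
  have hKE : K ≤ adjoinRoots p K S := le_adjoinRoots S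
  apply AlgEquiv.ext
  rintro ⟨x, hx⟩
  refine IntermediateField.adjoin_induction F
    (p := fun y (hy : y ∈ adjoinRoots p K S) => g ⟨y, hy⟩ = ⟨y, hy⟩) ?_ ?_ ?_ ?_ ?_ hx
  · rintro x (hx | ⟨s, hs, hx'⟩)
    · exact Subtype.ext (hg ⟨x, hx⟩ ⟨x, hKE hx⟩ rfl).symm
    · exact (hk.pair_eq_zero_iff hg hx').1 (h s hs)
  · intro x
    exact g.commutes x
  · intro x y hx hy ihx ihy
    exact (map_add g ⟨x, hx⟩ ⟨y, hy⟩).trans (by rw [ihx, ihy])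
  · intro x hx ihx
    exact (map_inv₀ g ⟨x, hx⟩).trans (by rw [ihx])
  · intro x y hx hy ihx ihy
    exact (map_mul g ⟨x, hx⟩ ⟨y, hy⟩).trans (by rw [ihx, ihy])

end IsKummer

/-! ## Galois extensions with group `B_{i,e}` -/

section GroupB

variable {p : ℕ} [hpf : Fact p.Prime] {i : ℕ} {e : ZMod p}

/-- The inclusion of `A / A_i` into `B_{i,e}`, as a map on `A`. -/
def B.inj (i : ℕ) (e : ZMod p) (x : A p) : B p i e := ⟨Ideal.Quotient.mk (Asub p i) x, 0⟩

/-- The lift of `σ` in `B_{i,e}`. -/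
def B.gen (p i : ℕ) (e : ZMod p) : B p i e := ⟨0, 1⟩

lemma carry_zero_left (t : ZMod p) : carry p 0 t = 0 := by
  have : NeZero p := ⟨hpf.out.ne_zero⟩
  simp [carry, Nat.div_eq_of_lt (ZMod.val_lt t)]

lemma carry_zero_right (t : ZMod p) : carry p t 0 = 0 := by
  have : NeZero p := ⟨hpf.out.ne_zero⟩
  simp [carry, Nat.div_eq_of_lt (ZMod.val_lt t)]

lemma B.inj_add (x y : A p) : B.inj i e (x + y) = B.inj i e x * B.inj i e y := by
  refine B.ext ?_ ?_
  · simp [B.mul_fst, B.inj, carry_zero_left, tauPow_zero]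
  · simp [B.mul_snd, B.inj]

lemma B.inj_eq_one {x : A p} : B.inj i e x = 1 ↔ x ∈ Asub p i := by
  rw [B.ext_iff, B.inj, B.one_fst, B.one_snd, Ideal.Quotient.eq_zero_iff_mem]
  simp

lemma B.exists_eq_inj {g : B p i e} (hg : g.snd = 0) : ∃ x, g = B.inj i e x := by
  obtain ⟨x, hx⟩ := Ideal.Quotient.mk_surjective g.fst
  exact ⟨x, B.ext hx.symm hg⟩

lemma B.gen_mul_inj (x : A p) : B.gen p i e * B.inj i e x = B.inj i e (tau p * x) * B.gen p i e := by
  refine B.ext ?_ ?_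
  · simp [B.mul_fst, B.inj, B.gen, carry_zero_left, carry_zero_right, tau]
  · simp [B.mul_snd, B.inj, B.gen]

lemma B.gen_pow {n : ℕ} (hn : n < p) : B.gen p i e ^ n = ⟨0, n⟩ := by
  induction n with
  | zero => rw [pow_zero, Nat.cast_zero]; rfl
  | succ n ih =>
    have : Fact (1 < p) := ⟨hpf.out.one_lt⟩
    rw [pow_succ, ih (by omega)]
    refine B.ext ?_ ?_
    · simp [B.mul_fst, B.gen, carry, ZMod.val_natCast_of_lt (show n < p by omega), ZMod.val_one,
        Nat.div_eq_of_lt hn]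
    · simp [B.mul_snd, B.gen]

lemma B.gen_pow_prime : B.gen p i e ^ p =
    B.inj i e (algebraMap (ZMod p) (A p) e * (tau p - 1) ^ (i - 1)) := by
  have hp := hpf.out.one_lt
  have : Fact (1 < p) := ⟨hp⟩
  have h1 : B.gen p i e ^ p = B.gen p i e ^ (p - 1) * B.gen p i e := by
    rw [← pow_succ, Nat.sub_add_cancel hp.le]
  rw [h1, B.gen_pow (by omega)]
  refine B.ext ?_ ?_
  · have : carry p ((p - 1 : ℕ) : ZMod p) 1 = 1 := by
      rw [carry, ZMod.val_natCast_of_lt (by omega), ZMod.val_one, Nat.sub_add_cancel hp.le,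
        Nat.div_self (by omega)]
    simp only [B.mul_fst, B.gen, this]
    simp [B.inj, topElt]
  · change ((p - 1 : ℕ) : ZMod p) + 1 = 0
    have h2 := Nat.cast_succ (R := ZMod p) (p - 1)
    rw [← h2, Nat.succ_eq_add_one, Nat.sub_add_cancel hp.le, CharP.cast_eq_zero]

end GroupB

/-! ### The `p`-th power of a lift of `σ` and the norm -/

section NormRoot

variable {F Ω : Type*} [Field F] [Field Ω] [Algebra F Ω] {K E : IntermediateField F Ω} {p : ℕ}
  [hpf : Fact p.Prime] {σ : K ≃ₐ[F] K}

lemma prod_pow_eq_nm {g : E ≃ₐ[F] E} (hg : Restricts σ g) {β : Kˣ} {c : E}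
    (hc : (c : Ω) ^ p = ((β : K) : Ω)) :
    ((∏ s ∈ Finset.range p, (g ^ s) c : E) : Ω) ^ p = ((nm p σ β : Kˣ) : K) := by
  rw [nm_apply, Units.coe_prod, ← IntermediateField.coe_val, map_prod, ← IntermediateField.coe_val,
    map_prod, ← Finset.prod_pow]
  exact Finset.prod_congr rfl fun s _ => rts_stable (hg.pow s) hc

lemma apply_prod_mul (g : E ≃ₐ[F] E) (c : E) (n : ℕ) :
    g (∏ s ∈ Finset.range n, (g ^ s) c) * c = (g ^ n) c * ∏ s ∈ Finset.range n, (g ^ s) c := by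
  have h := Finset.prod_range_succ (fun s => (g ^ s) c) n
  rw [Finset.prod_range_succ'] at h
  simp only [pow_succ', pow_zero, AlgEquiv.mul_apply, AlgEquiv.one_apply, ← map_prod] at h
  rw [h, mul_comm]

end NormRoot

namespace IsKummer

variable {F Ω : Type*} [Field F] [Field Ω] [Algebra F Ω] {K E : IntermediateField F Ω} {p : ℕ}
  [hpf : Fact p.Prime] {ξ : Fˣ} {r : Kˣ} {σ : K ≃ₐ[F] K} (hk : IsKummer p ξ r σ)

include hk

/-- For `P = ∏ g^s(c)`, telescoping gives `g(P) c = g^p(c) P`, and `d` differs from the root `P` of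
`N(β)` by a power of `ξ`. This turns the `p`-th power of a lift, hence the parameter `e`, into
arithmetic of `N(β)`. -/
lemma apply_prod_eq_iff {g : E ≃ₐ[F] E} {β : Kˣ} {c d : E} (hg : Restricts σ g)
    (hc : (c : Ω) ^ p = ((β : K) : Ω)) (hd : (d : Ω) ^ p = ((nm p σ β : Kˣ) : K)) :
    g d = d ↔ (g ^ p) c = c := by
  have hP := prod_pow_eq_nm hg hc
  have h1 := apply_prod_mul g c p
  obtain ⟨n, hn⟩ := hk.exists_root_eq' (hk.root_ne_zero' hd) (hP.trans hd.symm)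
  rw [hn, map_mul, map_pow, g.commutes] at h1
  have hξ : algebraMap F E (ξ : F) ^ n.val ≠ 0 :=
    pow_ne_zero _ ((hk.prim_alg E).ne_zero hpf.out.ne_zero)
  have hd0 := hk.root_ne_zero' hd
  have hc0 := hk.root_ne_zero' hc
  constructor
  · intro h
    rw [h, mul_comm] at h1
    exact (mul_right_cancel₀ (mul_ne_zero hξ hd0) h1).symm
  · intro h
    rw [h, mul_comm c] at h1
    exact mul_left_cancel₀ hξ (mul_right_cancel₀ hc0 h1)

lemma pow_apply_root_of_mem_normPow {g : E ≃ₐ[F] E} {β : Kˣ} {c : E} (hg : Restricts σ g)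
    (hc : (c : Ω) ^ p = ((β : K) : Ω)) (hβ : β ∈ normPow p σ) : (g ^ p) c = c := by
  obtain ⟨f, hf⟩ := mem_normPow.1 hβ
  refine (hk.apply_prod_eq_iff (d := algebraMap F E f) hg hc ?_).1 (g.commutes _)
  rw [hf]
  rfl

/-- If every lift `g` satisfied `g^p(c) = c`, then every lift would fix a root `d` of `N(β)`.
Quotients of lifts exhaust `Gal(E/K)`, so all of `Gal(E/F)` would fix `d`, and `N(β)` would be the
`p`-th power of `d ∈ F`. -/
lemma exists_lift_pow_apply_root_ne [FiniteDimensional F E] [IsGalois F E] (hKE : K ≤ E)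
    {β : Kˣ} {c : E} (hc : (c : Ω) ^ p = ((β : K) : Ω)) (hβ : β ∉ normPow p σ) :
    ∃ g : E ≃ₐ[F] E, Restricts σ g ∧ (g ^ p) c ≠ c := by
  have := hk.normal
  obtain ⟨g₀, hg₀⟩ := exists_lift hKE σ
  obtain ⟨d, hd⟩ : ∃ d : E, (d : Ω) ^ p = ((nm p σ β : Kˣ) : K) := ⟨_, prod_pow_eq_nm hg₀ hc⟩
  by_contra! h
  have h1 : ∀ g : E ≃ₐ[F] E, Restricts σ g → g d = d := fun g hg =>
    (hk.apply_prod_eq_iff hg hc hd).2 (h g hg)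
  have h2 : ∀ g : E ≃ₐ[F] E, Restricts (1 : K ≃ₐ[F] K) g → g d = d := by
    intro g hg
    have h3 := h1 (g * g₀) (by simpa using hg.mul hg₀)
    rwa [AlgEquiv.mul_apply, h1 g₀ hg₀] at h3
  have h3 : ∀ n : ℕ, (g₀ ^ n) d = d := by
    intro n
    induction n with
    | zero => rfl
    | succ n ih => rw [pow_succ, AlgEquiv.mul_apply, h1 g₀ hg₀, ih]
  have h4 : ∀ g : E ≃ₐ[F] E, g d = d := by
    intro g
    obtain ⟨n, hn⟩ := hk.exists_restricts hKE g
    have h5 := h2 (g * (g₀ ^ n)⁻¹) (by simpa using hn.mul ((hg₀.pow n).inv hKE))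
    rw [AlgEquiv.mul_apply] at h5
    have h6 : (g₀ ^ n)⁻¹ d = d := by
      conv_lhs => rw [← h3 n]
      exact (g₀ ^ n).symm_apply_apply d
    rwa [h6] at h5
  obtain ⟨f, hf⟩ := (IsGalois.mem_range_algebraMap_iff_fixed (F := F) d).2 h4
  have hf0 : f ≠ 0 := by
    rintro rfl
    exact hk.root_ne_zero' hd (by rw [← hf, map_zero])
  refine hβ (mem_normPow.2 ⟨Units.mk0 f hf0, Units.ext (Subtype.ext ?_)⟩)
  rw [← hd, ← hf]
  rfl

end IsKummer

/-! ### Kummer characters of a field with group `B_{i,e}` -/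

section Iota

variable {F Ω : Type*} [Field F] [Field Ω] [Algebra F Ω] {K E : IntermediateField F Ω} {p : ℕ}
  [hpf : Fact p.Prime] {i : ℕ} {e : ZMod p}

/-- The map `A → Gal(E/F)` attached to an isomorphism `Gal(E/F) ≃ B_{i,e}`. -/
def iota (ψ : (E ≃ₐ[F] E) ≃* B p i e) (x : A p) : E ≃ₐ[F] E := ψ.symm (B.inj i e x)

variable (ψ : (E ≃ₐ[F] E) ≃* B p i e)

lemma iota_add (x y : A p) : iota ψ (x + y) = iota ψ x * iota ψ y := by
  rw [iota, B.inj_add, map_mul, iota, iota]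

lemma iota_eq_one {x : A p} : iota ψ x = 1 ↔ x ∈ Asub p i := by
  rw [iota, EmbeddingLike.map_eq_one_iff, B.inj_eq_one]

lemma iota_tau_mul (x : A p) : iota ψ (tau p * x) =
    ψ.symm (B.gen p i e) * iota ψ x * (ψ.symm (B.gen p i e))⁻¹ := by
  rw [iota, iota, eq_mul_inv_iff_mul_eq, ← map_mul, ← map_mul, B.gen_mul_inj]

variable {σ : K ≃ₐ[F] K} {ψ} (hψ : IsGIso σ ψ)

include hψ

lemma restricts_iota (x : A p) : Restricts (1 : K ≃ₐ[F] K) (iota ψ x) := by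
  have h := hψ (iota ψ x)
  rwa [iota, MulEquiv.apply_symm_apply, B.inj, ZMod.val_zero, pow_zero] at h

lemma restricts_gen : Restricts σ (ψ.symm (B.gen p i e)) := by
  have : Fact (1 < p) := ⟨hpf.out.one_lt⟩
  have h := hψ (ψ.symm (B.gen p i e))
  rwa [MulEquiv.apply_symm_apply, B.gen, ZMod.val_one, pow_one] at h

end Iota

namespace IsKummer

variable {F Ω : Type*} [Field F] [Field Ω] [Algebra F Ω] {K E : IntermediateField F Ω} {p : ℕ}
  [hpf : Fact p.Prime] {ξ : Fˣ} {r : Kˣ} {σ : K ≃ₐ[F] K} (hk : IsKummer p ξ r σ)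
  {i : ℕ} {e : ZMod p} {ψ : (E ≃ₐ[F] E) ≃* B p i e} (hψ : IsGIso σ ψ)

include hk hψ

lemma exists_eq_iota (hKE : K ≤ E) {g : E ≃ₐ[F] E} (hg : Restricts (1 : K ≃ₐ[F] K) g) :
    ∃ x, g = iota ψ x := by
  have : NeZero p := ⟨hpf.out.ne_zero⟩
  have h1 := (hψ g).unique hKE hg
  rw [hk.pow_eq_one_iff] at h1
  have h2 := Nat.eq_zero_of_dvd_of_lt h1 (ZMod.val_lt _)
  obtain ⟨x, hx⟩ := B.exists_eq_inj ((ZMod.val_eq_zero _).1 h2)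
  exact ⟨x, by rw [iota, ← hx, MulEquiv.symm_apply_apply]⟩

lemma exists_character {u : Kˣ} (hu : u ∈ rts p K E) :
    ∃ χ : A p →ₗ[ZMod p] ZMod p, ∀ x, χ x = pair p ξ (iota ψ x) u := by
  refine ⟨AddMonoidHom.toZModLinearMap p
    { toFun := fun x => pair p ξ (iota ψ x) u
      map_zero' := ?_
      map_add' := fun x y => ?_ }, fun x => rfl⟩
  · rw [(iota_eq_one ψ).2 (zero_mem _), hk.pair_one hu]
  · rw [iota_add, hk.pair_mul_left (restricts_iota hψ x) (restricts_iota hψ y) hu]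

lemma pair_iota_sub (x y : A p) {u : Kˣ} (hu : u ∈ rts p K E) :
    pair p ξ (iota ψ (x - y)) u = pair p ξ (iota ψ x) u - pair p ξ (iota ψ y) u := by
  obtain ⟨χ, hχ⟩ := hk.exists_character hψ hu
  rw [← hχ, ← hχ, ← hχ, map_sub]

lemma pair_iota_act (hKE : K ≤ E) (s : ℕ) (x : A p) {u : Kˣ} [Normal F K] [Normal F E]
    (hu : u ∈ rts p K E) :
    pair p ξ (iota ψ (tau p ^ s * x)) (act (σ ^ s) u) = pair p ξ (iota ψ x) u := by
  induction s with
  | zero => rw [pow_zero, one_mul, pow_zero, act_one]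
  | succ s ih =>
    rw [pow_succ', mul_assoc, iota_tau_mul, pow_succ', act_mul,
      hk.pair_conj hKE (restricts_iota hψ _) (restricts_gen hψ) (act_mem_rts hKE _ hu), ih]

/-- From `⟨τy, σu⟩ = ⟨y, u⟩` and `σ = 1 + ρ` one gets `⟨τy, ρu⟩ = ⟨y, u⟩ - ⟨τy, u⟩ = ⟨(1 - τ)y, u⟩`;
iterate. -/
lemma pair_iota_rho (hKE : K ≤ E) [Normal F K] [Normal F E] (k : ℕ) (x : A p) {u : Kˣ}
    (hu : u ∈ rts p K E) :
    pair p ξ (iota ψ (tau p ^ k * x)) ((rho σ)^[k] u) =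
      pair p ξ (iota ψ ((1 - tau p) ^ k * x)) u := by
  induction k generalizing x with
  | zero => rw [pow_zero, pow_zero]; rfl
  | succ k ih =>
    have hv := rho_iterate_mem_rts hKE σ hu k
    have h1 : ∀ y, pair p ξ (iota ψ (tau p * y)) (rho σ ((rho σ)^[k] u)) =
        pair p ξ (iota ψ ((1 - tau p) * y)) ((rho σ)^[k] u) := by
      intro y
      have h2 := hk.pair_iota_act hψ hKE 1 y hv
      rw [pow_one, pow_one, act_eq_rho_mul, hk.pair_mul (restricts_iota hψ _)
        (rho_mem_rts hKE σ hv) hv] at h2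
      rw [sub_mul, one_mul, hk.pair_iota_sub hψ _ _ hv, ← h2, add_sub_cancel_right]
    rw [Function.iterate_succ_apply', pow_succ', mul_assoc, h1, mul_left_comm, ih, ← mul_assoc,
      ← pow_succ]

/-- Translates the length of a class into vanishing of its character on `A_k`. As `τ` is a unit, the
twist by `τ^k` in `pair_iota_rho` loses nothing. -/
lemma cls_rho_eq_one_iff [FiniteDimensional F E] [IsGalois F E] (hKE : K ≤ E) (k : ℕ) {u : Kˣ}
    (hu : u ∈ rts p K E) : cls p ((rho σ)^[k] u) = 1 ↔
      ∀ x, pair p ξ (iota ψ ((1 - tau p) ^ k * x)) u = 0 := by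
  have := hk.normal
  have hv := rho_iterate_mem_rts hKE σ hu k
  constructor
  · intro h x
    rw [← hk.pair_iota_rho hψ hKE k x hu,
      hk.pair_congr hKE (restricts_iota hψ _) hv (v := 1 ^ p) (by rw [h, cls_pow_self]),
      hk.pair_pow_self hKE (restricts_iota hψ _)]
  · intro h
    refine hk.cls_eq_one_of_pair hKE hv fun g hg => ?_
    obtain ⟨x, rfl⟩ := hk.exists_eq_iota hψ hKE hg
    obtain ⟨y, rfl⟩ : tau p ^ k ∣ x := ((isUnit_tau (p := p)).pow k).dvd
    rw [hk.pair_iota_rho hψ hKE k y hu, h y]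

/-- If `u` has trivial pairing with a submodule of `A / A_i`, so have its conjugates. -/
lemma iota_eq_one_of_forall [IsAlgClosed Ω] [FiniteDimensional F E] [IsGalois F E] {u : Kˣ}
    (hE : E = adjoinRoots p K (orbit σ u)) {x : A p}
    (h : ∀ y, pair p ξ (iota ψ (x * y)) u = 0) : x ∈ Asub p i := by
  have := hk.normal
  have hKE : K ≤ E := hE ▸ le_adjoinRoots _
  have hu : u ∈ rts p K E := hE ▸ subset_rts_adjoinRoots _ (hk.self_mem_orbit u)
  rw [← iota_eq_one ψ]
  refine hk.eq_one_of_pair hE (restricts_iota hψ x) ?_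
  rintro _ ⟨s, rfl⟩
  obtain ⟨y, hy⟩ := ((isUnit_tau (p := p)).pow s).exists_right_inv
  have h1 := hk.pair_iota_act hψ hKE s (x * y) hu
  rwa [mul_left_comm, hy, mul_one, h] at h1

omit hψ in
/-- A Kummer generator of a field with group `B_{j,e}` has length `j`. -/
lemma length_of_hasGroupB [IsAlgClosed Ω] {j : ℕ} (hj : 1 ≤ j) (hjp : j ≤ p) {γ : Kˣ}
    (hE : E = adjoinRoots p K (orbit σ γ)) (hB : HasGroupB p σ E j e) :
    cls p ((rho σ)^[j] γ) = 1 ∧ cls p ((rho σ)^[j - 1] γ) ≠ 1 := by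
  obtain ⟨hKE, hGal, ψ, hψ⟩ := hB
  have : FiniteDimensional F E := hE ▸ hk.finiteDimensional_adjoinRoots (hk.finite_orbit γ)
  have hu : γ ∈ rts p K E := hE ▸ subset_rts_adjoinRoots _ (hk.self_mem_orbit γ)
  have h1 : ∀ k : ℕ, (1 - tau p) ^ k = (-1) ^ k * (tau p - 1) ^ k := fun k => by
    rw [← mul_pow, neg_one_mul, neg_sub]
  constructor
  · rw [hk.cls_rho_eq_one_iff hψ hKE _ hu]
    intro x
    have : (1 - tau p) ^ j * x ∈ Asub p j := mem_Asub.2 ⟨(-1) ^ j * x, by rw [h1]; ring⟩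
    rw [(iota_eq_one ψ).2 this, hk.pair_one hu]
  · rw [Ne, hk.cls_rho_eq_one_iff hψ hKE _ hu]
    -- If `[γ]^{ρ^{j-1}} = 1`, then `(1 - τ)^(j-1)` pairs trivially with all conjugates of `γ`, so
    -- it acts trivially on `E` and lies in `A_j`, which is false.
    intro h
    have h2 := hk.iota_eq_one_of_forall hψ hE h
    refine pow_mem_Asub_succ (p := p) (n := j - 1) (by omega) ?_
    rw [Nat.sub_add_cancel hj]
    have h3 := Ideal.mul_mem_left _ ((-1) ^ (j - 1)) h2
    rwa [h1, ← mul_assoc, ← mul_pow, neg_one_mul, neg_neg, one_pow, one_mul] at h3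

end IsKummer

/-! ## Fields with group `B_{i,e}` from Kummer generators, and conversely -/

lemma exists_apply_eq_mul {M N : Type*} [Field M] [Field N] [Algebra M N] [FiniteDimensional M N]
    (f : (N ≃ₐ[M] N) → Nˣ) (hf : ∀ g h, ((f (g * h) : Nˣ) : N) = g (f h) * f g) :
    ∃ b : Nˣ, ∀ g : N ≃ₐ[M] N, g b = f g * b := by
  obtain ⟨b, hb⟩ := groupCohomology.isMulCoboundary₁_of_isMulCocycle₁_of_aut_to_units f
    fun g h => Units.ext (hf g h)
  refine ⟨b, fun g => ?_⟩
  rw [← hb g, Units.val_div_eq_div_val, div_mul_cancel₀ _ b.ne_zero]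
  rfl

namespace IsKummer

variable {F Ω : Type*} [Field F] [Field Ω] [Algebra F Ω] {K E : IntermediateField F Ω} {p : ℕ}
  [hpf : Fact p.Prime] {ξ : Fˣ} {r : Kˣ} {σ : K ≃ₐ[F] K} (hk : IsKummer p ξ r σ)

include hk

/-- A character of `Gal(E/K)` with values in the `p`-th roots of unity is the Kummer character of an
element of `K^×`. -/
lemma exists_kummer_character [FiniteDimensional F E] [IsGalois F E] (hKE : K ≤ E)
    (f : (E ≃ₐ[F] E) → ZMod p) (hf : ∀ g h : E ≃ₐ[F] E, Restricts (1 : K ≃ₐ[F] K) g →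
      Restricts (1 : K ≃ₐ[F] K) h → f (g * h) = f g + f h) :
    ∃ β ∈ rts p K E, ∀ g : E ≃ₐ[F] E, Restricts (1 : K ≃ₐ[F] K) g → pair p ξ g β = f g := by
  -- `K` viewed inside `E`. The character, read as a cocycle on `Gal(E/K')` with values in powers of
  -- `ξ`, is a coboundary; the resulting `b` is multiplied by roots of unity, so `b^p` lies in `K`.
  let K' : IntermediateField F E := IntermediateField.restrict hKE
  have hres : ∀ g : E ≃ₐ[K'] E, Restricts (1 : K ≃ₐ[F] K) (g.restrictScalars F) := by
    intro g x y hxy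
    have h1 := g.commutes ⟨y, (IntermediateField.mem_restrict hKE y).2 (hxy ▸ x.2)⟩
    have h2 : g.restrictScalars F y = y := h1
    rw [h2]; exact hxy
  let z : Eˣ := incl E ξ
  have hz : ∀ n : ZMod p, ((z ^ n.val : Eˣ) : E) = algebraMap F E (ξ : F) ^ n.val := fun n => by
    rw [Units.val_pow_eq_pow_val]; rfl
  obtain ⟨b, hb⟩ := exists_apply_eq_mul (M := K') (N := E)
    (fun g => z ^ (f (g.restrictScalars F)).val) (by
      intro g h
      have h1 : f ((g * h).restrictScalars F) =
          f (g.restrictScalars F) + f (h.restrictScalars F) := hf _ _ (hres g) (hres h)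
      rw [hz, hz, hz, h1, hk.alg_pow_add, mul_comm]
      congr 1
      have h2 := (g.restrictScalars F).commutes ((ξ : F) ^ (f (h.restrictScalars F)).val)
      rw [map_pow (algebraMap F E)] at h2
      exact h2.symm)
  have hgb : ∀ g : E ≃ₐ[F] E, Restricts (1 : K ≃ₐ[F] K) g →
      g b = algebraMap F E (ξ : F) ^ (f g).val * b := by
    intro g hg
    let g' : E ≃ₐ[K'] E := { g with
      commutes' := fun x => by
        have hx : ((x : E) : Ω) ∈ K := (IntermediateField.mem_restrict hKE _).1 x.2
        exact Subtype.ext (hg ⟨_, hx⟩ (x : E) rfl).symm }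
    have h1 := hb g'
    rw [hz] at h1
    exact h1
  have hbK : ((b : E) : Ω) ^ p ∈ K := by
    refine exists_mem_eq_of_fixed (x := (b : E) ^ p) hKE fun g hg => ?_
    rw [map_pow, hgb g hg, mul_pow, ← pow_mul, mul_comm _ p, pow_mul,
      (hk.prim_alg E).pow_eq_one, one_pow, one_mul]
  have hb0 : ((b : E) : Ω) ≠ 0 := fun h => b.ne_zero (Subtype.ext h)
  let β : Kˣ := Units.mk0 ⟨_, hbK⟩ fun h => pow_ne_zero p hb0 (congrArg Subtype.val h)
  exact ⟨β, ⟨b, (b : E).2, rfl⟩, fun g hg => hk.pair_eq (u := β) (c := b) hg rfl (hgb g hg)⟩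

/-- A field with group `B_{i,e}` containing a `p`-th root of an element `γ` of length `j` is generated
by an element `β` with `β^{ρ^{i-j}} = γ` whose norm is not in `F^{×p}`. -/
lemma exists_generator [IsAlgClosed Ω] {k j : ℕ} {e : ZMod p} (hj : 1 ≤ j) (hkj : k + j ≤ p)
    (he : e ≠ 0) (hB : HasGroupB p σ E (k + j) e) {γ : Kˣ} (hγ : γ ∈ rts p K E)
    (h1 : cls p ((rho σ)^[j] γ) = 1) (h2 : cls p ((rho σ)^[j - 1] γ) ≠ 1) :
    ∃ β : Kˣ, cls p ((rho σ)^[k] β) = cls p γ ∧ β ∉ normPow p σ ∧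
      E = adjoinRoots p K (orbit σ β) := by
  obtain ⟨hKE, hGal, ψ, hψ⟩ := hB
  have : Finite (B p (k + j) e) := Finite.of_injective (fun g => (g.fst, g.snd))
    fun g h hgh => B.ext (congrArg Prod.fst hgh) (congrArg Prod.snd hgh)
  have : Finite (E ≃ₐ[F] E) := Finite.of_equiv _ ψ.symm.toEquiv
  have : FiniteDimensional F E := IsGalois.finiteDimensional_of_finite F E
  have := hk.normal
  obtain ⟨χ, hχ⟩ := hk.exists_character hψ hγ
  have hχj : ∀ x ∈ Asub p j, χ x = 0 := by
    intro x hx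
    obtain ⟨y, rfl⟩ := mem_Asub.1 hx
    have h3 := (hk.cls_rho_eq_one_iff hψ hKE j hγ).1 h1 ((-1) ^ j * y)
    rw [hχ, ← h3, ← neg_sub (tau p) 1, neg_pow, mul_mul_mul_comm, ← mul_pow, neg_one_mul, neg_neg,
      one_pow, one_mul]
  -- `l` is the character prescribed for `β`: dividing the character of `γ` by `(1 - τ)^k` amounts
  -- to solving `[β]^{ρ^k} = [γ]`.
  obtain ⟨l, hl, hlχ⟩ := exists_functional hkj hχj
  choose x hx using fun (g : E ≃ₐ[F] E) (hg : Restricts (1 : K ≃ₐ[F] K) g) =>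
    hk.exists_eq_iota hψ hKE hg
  have hlι : ∀ y y', iota ψ y = iota ψ y' → l y = l y' := by
    intro y y' hyy
    rw [← sub_eq_zero, ← map_sub]
    apply hl
    rw [← iota_eq_one ψ]
    have h3 := iota_add ψ (y - y') y'
    rw [sub_add_cancel, hyy] at h3
    exact right_eq_mul.1 h3
  classical
  obtain ⟨β, hβE, hβ⟩ := hk.exists_kummer_character hKE
    (fun g => if hg : Restricts (1 : K ≃ₐ[F] K) g then l (x g hg) else 0) (by
      intro g h hg hh
      have hgh : Restricts (1 : K ≃ₐ[F] K) (g * h) := by simpa using hg.mul hh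
      rw [dif_pos hg, dif_pos hh, dif_pos hgh, ← map_add]
      apply hlι
      rw [iota_add, ← hx, ← hx, ← hx])
  have hβl : ∀ y, pair p ξ (iota ψ y) β = l y := by
    intro y
    have hy := restricts_iota hψ y
    rw [hβ _ hy, dif_pos hy]
    exact hlι _ _ (hx _ hy).symm
  have hβγ : cls p ((rho σ)^[k] β) = cls p γ := by
    refine hk.cls_eq_of_pair hKE (rho_iterate_mem_rts hKE σ hβE k) hγ fun g hg => ?_
    obtain ⟨y, rfl⟩ := hk.exists_eq_iota hψ hKE hg
    obtain ⟨y, rfl⟩ : tau p ^ k ∣ y := ((isUnit_tau (p := p)).pow k).dvd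
    rw [hk.pair_iota_rho hψ hKE k y hβE, hβl, hlχ, hχ]
  -- Were `l` zero on the socle, `[γ]^{ρ^{j-1}} = [β]^{ρ^{k+j-1}}` would be trivial.
  have hsoc : l ((tau p - 1) ^ (k + j - 1)) ≠ 0 := by
    intro h0
    apply h2
    rw [cls_rho_iterate, ← hβγ, ← cls_rho_iterate, rho_iterate_add,
      show j - 1 + k = k + j - 1 by omega, hk.cls_rho_eq_one_iff hψ hKE _ hβE]
    intro y
    rw [hβl]
    exact functional_eq_zero_of_socle (by omega) hl h0 y
  refine ⟨β, hβγ, fun hn => ?_, ?_⟩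
  -- If `β ∈ normPow`, the `p`-th power of the lift would fix a root of `β`; but it is `ι(e (τ -
  -- 1)^(k+j-1))`, which pairs with `β` to `e` times the nonzero value `hsoc`.
  · obtain ⟨c, hc, hcβ⟩ := hβE
    have h3 := hk.pow_apply_root_of_mem_normPow (c := ⟨c, hc⟩) (restricts_gen hψ) hcβ hn
    rw [← map_pow, B.gen_pow_prime] at h3
    have h4 := (hk.pair_eq_zero_iff (c := ⟨c, hc⟩) (restricts_iota hψ _) hcβ).2 h3
    rw [hβl, ← Algebra.smul_def, map_smul, smul_eq_mul] at h4
    exact (mul_ne_zero he hsoc) h4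
  · apply le_antisymm
    · intro y hy
      have hKE' : K ≤ adjoinRoots p K (orbit σ β) := le_adjoinRoots _
      have hE' : adjoinRoots p K (orbit σ β) ≤ E :=
        hk.adjoinRoots_le hKE (orbit_subset_rts hKE σ hβE)
      refine exists_mem_eq_of_fixed (x := ⟨y, hy⟩) hE' fun g hg => ?_
      have hgK : Restricts (1 : K ≃ₐ[F] K) g := fun a b hab => hg ⟨a, hKE' a.2⟩ b hab
      obtain ⟨z, rfl⟩ := hk.exists_eq_iota hψ hKE hgK
      suffices hz : z ∈ Asub p (k + j) by rw [(iota_eq_one ψ).2 hz]; rfl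
      refine mem_Asub_of_functional hl hsoc fun w => ?_
      -- An element `ι(z)` fixing the roots of all conjugates of `β` satisfies `l(z τ^s) = 0` for
      -- all `s`; nonvanishing of `l` on the socle then forces `z ∈ A_{k+j}`.
      have hlin : l ∘ₗ LinearMap.mulLeft (ZMod p) z = 0 := by
        refine functional_ext fun s => ?_
        rw [LinearMap.comp_apply, LinearMap.mulLeft_apply, LinearMap.zero_apply]
        have hs : tau p ^ s.val = tauPow p s := by rw [tau_pow, ZMod.natCast_zmod_val]
        obtain ⟨v, hv⟩ : ∃ v : ℕ, tau p ^ v * tau p ^ s.val = 1 := by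
          -- A natural number representing `-s` modulo `p`.
          refine ⟨p * s.val - s.val, ?_⟩
          rw [← pow_add, Nat.sub_add_cancel (Nat.le_mul_of_pos_left _ hpf.out.pos), pow_mul,
            tau_pow_prime, one_pow]
        rw [← hβl, ← hk.pair_iota_act hψ hKE v _ hβE, ← hs, mul_comm z, ← mul_assoc, hv, one_mul]
        obtain ⟨c, hc, hcu⟩ := subset_rts_adjoinRoots (p := p) (E := K) (orbit σ β)
          ⟨v, rfl⟩
        exact (hk.pair_eq_zero_iff (c := ⟨c, hE' hc⟩) hgK hcu).2
          (Subtype.ext (hg ⟨c, hc⟩ ⟨c, hE' hc⟩ rfl).symm)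
      exact LinearMap.congr_fun hlin w
    · exact hk.adjoinRoots_le hKE (orbit_subset_rts hKE σ hβE)

end IsKummer

/-! ## Construction of fields with group `B_{i,e}` -/

section KummerFunctional

variable {F Ω : Type*} [Field F] [Field Ω] [Algebra F Ω] {K E : IntermediateField F Ω} {p : ℕ}
  [hpf : Fact p.Prime] {ξ : Fˣ} {σ : K ≃ₐ[F] K}

/-- The functional `τ^s ↦ ⟨h, σ^{-s}(u)⟩` on `A`. -/
def kummerFunctional (ξ : Fˣ) (σ : K ≃ₐ[F] K) (h : E ≃ₐ[F] E) (u : Kˣ) :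
    A p →ₗ[ZMod p] ZMod p :=
  functional fun s => pair p ξ h (act (σ ^ (-s).val) u)

lemma kummerFunctional_tauPow (h : E ≃ₐ[F] E) (u : Kˣ) (s : ZMod p) :
    kummerFunctional ξ σ h u (tauPow p s) = pair p ξ h (act (σ ^ (-s).val) u) :=
  functional_tauPow _ s

lemma kummerFunctional_one (h : E ≃ₐ[F] E) (u : Kˣ) :
    kummerFunctional ξ σ h u 1 = pair p ξ h u := by
  rw [← tauPow_zero, kummerFunctional_tauPow, neg_zero, ZMod.val_zero, pow_zero, act_one]

end KummerFunctional

namespace IsKummer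

variable {F Ω : Type*} [Field F] [Field Ω] [Algebra F Ω] {K E : IntermediateField F Ω} {p : ℕ}
  [hpf : Fact p.Prime] {ξ : Fˣ} {r : Kˣ} {σ : K ≃ₐ[F] K} (hk : IsKummer p ξ r σ)

include hk

/-- Recognition of `B_{i,e}`: it suffices to identify `Gal(E/K)` with `A / A_i` and to have a lift of
`σ` with the correct action and the correct `p`-th power. -/
lemma hasGroupB_of_hom (hKE : K ≤ E) [IsGalois F E] {i : ℕ} {e : ZMod p} {g : E ≃ₐ[F] E}
    (hg : Restricts σ g) (ι : A p → (E ≃ₐ[F] E)) (hι : ∀ x, Restricts (1 : K ≃ₐ[F] K) (ι x))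
    (hadd : ∀ x y, ι (x + y) = ι x * ι y) (hker : ∀ x, ι x = 1 ↔ x ∈ Asub p i)
    (hsurj : ∀ h : E ≃ₐ[F] E, Restricts (1 : K ≃ₐ[F] K) h → ∃ x, ι x = h)
    (htau : ∀ x, ι (tau p * x) = g * ι x * g⁻¹)
    (hpow : ι (algebraMap (ZMod p) (A p) e * (tau p - 1) ^ (i - 1)) = g ^ p) :
    HasGroupB p σ E i e := by
  have : NeZero p := ⟨hpf.out.ne_zero⟩
  have hcongr : ∀ x y, Ideal.Quotient.mk (Asub p i) x = Ideal.Quotient.mk (Asub p i) y →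
      ι x = ι y := by
    intro x y hxy
    have h1 := hadd (x - y) y
    rwa [sub_add_cancel, (hker _).2 (Ideal.Quotient.eq.1 hxy), one_mul] at h1
  let out : AQuot p i → A p := Function.surjInv Ideal.Quotient.mk_surjective
  have hout : ∀ X, Ideal.Quotient.mk (Asub p i) (out X) = X :=
    Function.surjInv_eq Ideal.Quotient.mk_surjective
  have htauS : ∀ (n : ℕ) x, ι (tau p ^ n * x) * g ^ n = g ^ n * ι x := by
    intro n
    induction n with
    | zero => intro x; simp
    | succ n ih =>
      intro x
      rw [pow_succ', mul_assoc, htau, pow_succ', ← mul_assoc, inv_mul_cancel_right, mul_assoc, ih,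
        mul_assoc]
  have hnsmul : ∀ (n : ℕ) x, ι (n • x) = ι x ^ n := by
    intro n x
    induction n with
    | zero => rw [zero_smul, pow_zero, hker]; exact zero_mem _
    | succ n ih => rw [succ_nsmul, hadd, ih, pow_succ]
  -- The element `⟨x, s⟩` goes to `ι(x) g^s`. When exponents add up to at least `p`, the surplus
  -- `g^p` is `ι(e (τ - 1)^(i-1))` by `hpow`, matching the carry term in `B`.
  let Θ : B p i e →* (E ≃ₐ[F] E) := MonoidHom.mk' (fun b => ι (out b.fst) * g ^ b.snd.val) (by
    intro a b
    have h1 : ι (out (a * b).fst) = ι (out a.fst) * ι (tau p ^ a.snd.val * out b.fst) *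
        ι (carry p a.snd b.snd • (algebraMap (ZMod p) (A p) e * (tau p - 1) ^ (i - 1))) := by
      rw [← hadd, ← hadd]
      apply hcongr
      rw [hout, map_add, map_add, map_mul, hout, hout, map_nsmul, B.mul_fst, tau_pow,
        ZMod.natCast_zmod_val]
      rfl
    have h2 : a.snd.val + b.snd.val = p * carry p a.snd b.snd + (a.snd + b.snd).val := by
      rw [ZMod.val_add, carry, Nat.div_add_mod]
    rw [h1, hnsmul, hpow, ← pow_mul, B.mul_snd, mul_assoc, ← pow_add, ← h2, pow_add,
      mul_assoc, ← mul_assoc _ (g ^ a.snd.val), htauS, mul_assoc, mul_assoc])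
  have hΘ : ∀ b, Θ b = ι (out b.fst) * g ^ b.snd.val := fun b => rfl
  have hres : ∀ b, Restricts (σ ^ b.snd.val) (Θ b) := fun b => by
    rw [hΘ]
    simpa using (hι (out b.fst)).mul (hg.pow b.snd.val)
  have hbij : Function.Bijective Θ := by
    constructor
    · rw [injective_iff_map_eq_one]
      intro b hb
      have h1 := hres b
      rw [hb] at h1
      have h2 := (hk.pow_eq_one_iff _).1 (h1.unique hKE Restricts.one)
      have h3 : b.snd = 0 :=
        (ZMod.val_eq_zero _).1 (Nat.eq_zero_of_dvd_of_lt h2 (ZMod.val_lt _))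
      rw [hΘ, h3, ZMod.val_zero, pow_zero, mul_one, hker, ← Ideal.Quotient.eq_zero_iff_mem,
        hout] at hb
      exact B.ext hb h3
    · intro h
      obtain ⟨n, hn⟩ := hk.exists_restricts hKE h
      have hn' : Restricts (σ ^ (n : ZMod p).val) h := by
        convert hn using 1
        rw [ZMod.val_natCast]
        conv_rhs => rw [← Nat.mod_add_div n p, pow_add, pow_mul, hk.pow_prime, one_pow, mul_one]
      obtain ⟨x, hx⟩ := hsurj (h * (g ^ (n : ZMod p).val)⁻¹) (by
        simpa using hn'.mul ((hg.pow (n : ZMod p).val).inv hKE))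
      refine ⟨⟨Ideal.Quotient.mk _ x, n⟩, ?_⟩
      rw [hΘ, hcongr _ x (hout _), hx, inv_mul_cancel_right]
  let ψ := (MulEquiv.ofBijective Θ hbij).symm
  refine ⟨hKE, inferInstance, ψ, fun h => ?_⟩
  have h1 := hres (ψ h)
  have h2 : Θ (ψ h) = h := (MulEquiv.ofBijective Θ hbij).apply_symm_apply h
  rwa [h2] at h1

lemma act_pow_congr {m n : ℕ} (h : (m : ZMod p) = n) (u : Kˣ) : act (σ ^ m) u = act (σ ^ n) u := by
  rw [← hk.act_pow_mod m, ← hk.act_pow_mod n, (ZMod.natCast_eq_natCast_iff' m n p).1 h]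

section

variable (hKE : K ≤ E) [Normal F K] [Normal F E] {u : Kˣ} (hu : u ∈ rts p K E)

include hKE hu

omit [Normal F K] [Normal F E] in
lemma act_val_tauPow (s : ZMod p) (v : Kˣ) :
    act (σ ^ (-s).val) v = act (σ ^ (-(s + 1)).val) (act σ v) := by
  have : NeZero p := ⟨hpf.out.ne_zero⟩
  rw [← act_mul, ← pow_succ]
  apply hk.act_pow_congr
  push_cast
  rw [ZMod.natCast_zmod_val, ZMod.natCast_zmod_val]
  ring

lemma kummerFunctional_mul {h h' : E ≃ₐ[F] E} (hh : Restricts (1 : K ≃ₐ[F] K) h)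
    (hh' : Restricts (1 : K ≃ₐ[F] K) h') :
    (kummerFunctional ξ σ (h * h') u : A p →ₗ[ZMod p] ZMod p) =
      kummerFunctional ξ σ h u + kummerFunctional ξ σ h' u := by
  refine functional_ext fun s => ?_
  rw [LinearMap.add_apply, kummerFunctional_tauPow, kummerFunctional_tauPow,
    kummerFunctional_tauPow, hk.pair_mul_left hh hh' (act_mem_rts hKE _ hu)]

/-- The inverse exponent in `kummerFunctional` is there so that conjugation by a lift of `σ` becomes
multiplication by `τ`. -/
lemma kummerFunctional_conj {h g : E ≃ₐ[F] E} (hh : Restricts (1 : K ≃ₐ[F] K) h)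
    (hg : Restricts σ g) (x : A p) :
    kummerFunctional ξ σ (g * h * g⁻¹) u x = kummerFunctional ξ σ h u (tau p * x) := by
  have : (kummerFunctional ξ σ (g * h * g⁻¹) u : A p →ₗ[ZMod p] ZMod p) =
      kummerFunctional ξ σ h u ∘ₗ LinearMap.mulLeft (ZMod p) (tau p) := by
    refine functional_ext fun s => ?_
    rw [LinearMap.comp_apply, LinearMap.mulLeft_apply, tau, ← tauPow_add, kummerFunctional_tauPow,
      kummerFunctional_tauPow, add_comm 1 s, hk.act_val_tauPow hKE hu s u,
      ← hk.pair_conj hKE hh hg (act_mem_rts hKE _ hu), ← act_mul, ← act_mul, ← pow_succ,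
      ← pow_succ']
  rw [this]; rfl

lemma kummerFunctional_rho {h : E ≃ₐ[F] E} (hh : Restricts (1 : K ≃ₐ[F] K) h) (k : ℕ) (x : A p) :
    kummerFunctional ξ σ h ((rho σ)^[k] u) (tau p ^ k * x) =
      kummerFunctional ξ σ h u ((1 - tau p) ^ k * x) := by
  induction k generalizing x with
  | zero => rw [pow_zero, pow_zero]; rfl
  | succ k ih =>
    have hv := rho_iterate_mem_rts hKE σ hu k
    have h1 : (kummerFunctional ξ σ h (rho σ ((rho σ)^[k] u)) : A p →ₗ[ZMod p] ZMod p) ∘ₗ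
        LinearMap.mulLeft (ZMod p) (tau p) =
        kummerFunctional ξ σ h ((rho σ)^[k] u) ∘ₗ LinearMap.mulLeft (ZMod p) (1 - tau p) := by
      refine functional_ext fun s => ?_
      rw [LinearMap.comp_apply, LinearMap.mulLeft_apply, LinearMap.comp_apply,
        LinearMap.mulLeft_apply, sub_mul, one_mul, map_sub, tau, ← tauPow_add,
        kummerFunctional_tauPow, kummerFunctional_tauPow, kummerFunctional_tauPow, add_comm 1 s,
        hk.act_val_tauPow hKE hu s ((rho σ)^[k] u), act_eq_rho_mul σ ((rho σ)^[k] u), map_mul,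
        hk.pair_mul hh (act_mem_rts hKE _ (rho_mem_rts hKE σ hv)) (act_mem_rts hKE _ hv),
        add_sub_cancel_right]
    have h2 := LinearMap.congr_fun h1 (tau p ^ k * x)
    simp only [LinearMap.comp_apply, LinearMap.mulLeft_apply] at h2
    rw [Function.iterate_succ_apply', pow_succ', mul_assoc, h2, mul_left_comm, ih, ← mul_assoc,
      ← pow_succ]

omit [Normal F K] [Normal F E] in
lemma kummerFunctional_of_cls_eq_one {h : E ≃ₐ[F] E} (hh : Restricts (1 : K ≃ₐ[F] K) h)
    {v : Kˣ} (hv : cls p v = 1) : (kummerFunctional ξ σ h v : A p →ₗ[ZMod p] ZMod p) = 0 := by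
  obtain ⟨q, rfl⟩ := cls_eq_one.1 hv
  refine functional_ext fun s => ?_
  rw [kummerFunctional_tauPow, map_pow, hk.pair_pow_self hKE hh]
  rfl

lemma kummerFunctional_mem {h : E ≃ₐ[F] E} (hh : Restricts (1 : K ≃ₐ[F] K) h) {i : ℕ}
    (hi : cls p ((rho σ)^[i] u) = 1) {x : A p} (hx : x ∈ Asub p i) :
    kummerFunctional ξ σ h u x = 0 := by
  obtain ⟨y, rfl⟩ := mem_Asub.1 hx
  have h1 := hk.kummerFunctional_rho hKE hu hh i ((-1) ^ i * y)
  rw [hk.kummerFunctional_of_cls_eq_one hKE hu hh hi, LinearMap.zero_apply] at h1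
  rw [h1, ← neg_sub (tau p) 1, neg_pow, mul_mul_mul_comm, ← mul_pow, neg_one_mul, neg_neg,
    one_pow, one_mul]

end

/-- An element `β` of length `i` whose norm is not in `F^{×p}` generates a field with group
`B_{i,e}`. -/
lemma hasGroupB_adjoinRoots [IsAlgClosed Ω] {i : ℕ} {e : ZMod p} (hi : 1 ≤ i) (he : e ≠ 0) {β : Kˣ}
    (h1 : cls p ((rho σ)^[i] β) = 1) (h2 : cls p ((rho σ)^[i - 1] β) ≠ 1)
    (h3 : β ∉ normPow p σ) : HasGroupB p σ (adjoinRoots p K (orbit σ β)) i e := by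
  have : NeZero p := ⟨hpf.out.ne_zero⟩
  have := hk.normal
  obtain ⟨E, hE⟩ : ∃ E, E = adjoinRoots p K (orbit σ β) := ⟨_, rfl⟩
  have : IsGalois F E := hE ▸ hk.isGalois_adjoinRoots (hk.act_mem_orbit β)
  have : FiniteDimensional F E := hE ▸ hk.finiteDimensional_adjoinRoots (hk.finite_orbit β)
  rw [← hE]
  have hKE : K ≤ E := hE ▸ le_adjoinRoots _
  have hβ : β ∈ rts p K E := hE ▸ subset_rts_adjoinRoots _ (hk.self_mem_orbit β)
  obtain ⟨c, hc, hcβ⟩ := hβ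
  obtain ⟨g, hg, hgp⟩ := hk.exists_lift_pow_apply_root_ne (c := ⟨c, hc⟩) hKE hcβ h3
  have hβ : β ∈ rts p K E := ⟨c, hc, hcβ⟩
  have hgpr : Restricts (1 : K ≃ₐ[F] K) (g ^ p) := by simpa [hk.pow_prime] using hg.pow p
  -- `Φ` embeds `Gal(E/K)` into the dual of `A / A_i`. An element `h₀` with `Φ h₀` nonzero on the
  -- socle makes `x ↦ Φ h₀ (x ·)` an isomorphism from `A / A_i` onto that dual.
  let Φ : (E ≃ₐ[F] E) → (A p →ₗ[ZMod p] ZMod p) := fun h => kummerFunctional ξ σ h β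
  have hΦmul : ∀ h h' : E ≃ₐ[F] E, Restricts (1 : K ≃ₐ[F] K) h → Restricts (1 : K ≃ₐ[F] K) h' →
      Φ (h * h') = Φ h + Φ h' := fun h h' hh hh' => hk.kummerFunctional_mul hKE hβ hh hh'
  have hΦker : ∀ h : E ≃ₐ[F] E, Restricts (1 : K ≃ₐ[F] K) h → ∀ x ∈ Asub p i, Φ h x = 0 :=
    fun h hh x hx => hk.kummerFunctional_mem hKE hβ hh h1 hx
  have hΦ1 : ∀ h : E ≃ₐ[F] E, Restricts (1 : K ≃ₐ[F] K) h → Φ h = 0 → h = 1 := by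
    intro h hh h0
    refine hk.eq_one_of_pair hE hh ?_
    rintro _ ⟨s, rfl⟩
    have h4 := LinearMap.congr_fun h0 (tauPow p (-(s : ZMod p)))
    simp only [Φ] at h4
    rw [kummerFunctional_tauPow, neg_neg, hk.act_pow_congr (n := s) (ZMod.natCast_zmod_val _)] at h4
    exact h4
  have hΦinj : ∀ h h' : E ≃ₐ[F] E, Restricts (1 : K ≃ₐ[F] K) h → Restricts (1 : K ≃ₐ[F] K) h' →
      Φ h = Φ h' → h = h' := by
    intro h h' hh hh' heq
    have hh'' : Restricts (1 : K ≃ₐ[F] K) (h * h'⁻¹) := by simpa using hh.mul (hh'.inv hKE)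
    have h4 := hΦmul _ _ hh'' hh'
    rw [inv_mul_cancel_right, heq, right_eq_add] at h4
    exact mul_inv_eq_one.1 (hΦ1 _ hh'' h4)
  have hΦpow : ∀ (h : E ≃ₐ[F] E) (n : ℕ), Restricts (1 : K ≃ₐ[F] K) h →
      Φ (h ^ n) = n • Φ h := by
    intro h n hh
    induction n with
    | zero =>
      have h4 := hΦmul 1 1 Restricts.one Restricts.one
      rw [one_mul, right_eq_add] at h4
      rw [pow_zero, zero_smul, h4]
    | succ n ih =>
      rw [pow_succ, hΦmul _ _ (by simpa using hh.pow n) hh, ih, succ_nsmul]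
  obtain ⟨h₁, hh₁, hsoc⟩ : ∃ h : E ≃ₐ[F] E, Restricts (1 : K ≃ₐ[F] K) h ∧
      Φ h ((tau p - 1) ^ (i - 1)) ≠ 0 := by
    by_contra! h0
    refine h2 (hk.cls_eq_one_of_pair hKE (rho_iterate_mem_rts hKE σ hβ _) fun h hh => ?_)
    obtain ⟨y, hy⟩ := ((isUnit_tau (p := p)).pow (i - 1)).exists_right_inv
    rw [← kummerFunctional_one (σ := σ), ← hy, hk.kummerFunctional_rho hKE hβ hh]
    exact functional_eq_zero_of_socle hi (hΦker h hh) (h0 h hh) y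
  have hε : pair p ξ (g ^ p) β ≠ 0 := fun h0 =>
    hgp ((hk.pair_eq_zero_iff (c := ⟨c, hc⟩) hgpr hcβ).1 h0)
  -- Replacing `h₁` by a power realises any prescribed `e ≠ 0`. The right side is nonzero by the
  -- choice of `g`, so `Φ h₀` remains nonzero on the socle.
  obtain ⟨h₀, hh₀, hval⟩ : ∃ h : E ≃ₐ[F] E, Restricts (1 : K ≃ₐ[F] K) h ∧
      e * Φ h ((tau p - 1) ^ (i - 1)) = pair p ξ (g ^ p) β := by
    set v := Φ h₁ ((tau p - 1) ^ (i - 1))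
    refine ⟨h₁ ^ (pair p ξ (g ^ p) β / (e * v)).val, by simpa using hh₁.pow _, ?_⟩
    rw [hΦpow _ _ hh₁, LinearMap.smul_apply, nsmul_eq_mul, ZMod.natCast_zmod_val]
    change e * (_ * v) = _
    field_simp
  have hsoc₀ : Φ h₀ ((tau p - 1) ^ (i - 1)) ≠ 0 := by
    intro h0
    rw [h0, mul_zero] at hval
    exact hε hval.symm
  have hex : ∀ x : A p, ∃ h : E ≃ₐ[F] E, Restricts (1 : K ≃ₐ[F] K) h ∧
      ∀ y, Φ h y = Φ h₀ (x * y) := by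
    intro x
    induction x using MonoidAlgebra.induction_on with
    | of m =>
      have hm : MonoidAlgebra.of (ZMod p) _ m = tau p ^ (Multiplicative.toAdd m).val := by
        rw [tau_pow, ZMod.natCast_zmod_val, tauPow, ofAdd_toAdd]
      rw [hm]
      generalize (Multiplicative.toAdd m).val = n
      induction n with
      | zero => exact ⟨h₀, hh₀, fun y => by rw [pow_zero, one_mul]⟩
      | succ n ih =>
        obtain ⟨h, hh, hy⟩ := ih
        refine ⟨g * h * g⁻¹, by simpa using (hg.mul hh).mul (hg.inv hKE), fun y => ?_⟩
        rw [pow_succ (tau p), mul_assoc (tau p ^ n), ← hy]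
        exact hk.kummerFunctional_conj hKE hβ hh hg y
    | add x y hx hy =>
      obtain ⟨h, hh, hx⟩ := hx
      obtain ⟨h', hh', hy⟩ := hy
      exact ⟨h * h', by simpa using hh.mul hh', fun z => by
        rw [hΦmul _ _ hh hh', LinearMap.add_apply, hx, hy, add_mul, map_add]⟩
    | smul n x hx =>
      obtain ⟨h, hh, hx⟩ := hx
      refine ⟨h ^ n.val, by simpa using hh.pow _, fun z => ?_⟩
      rw [hΦpow _ _ hh, LinearMap.smul_apply, hx, smul_mul_assoc, map_smul, nsmul_eq_mul,
        ZMod.natCast_zmod_val, smul_eq_mul]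
  choose ι hι hιΦ using hex
  refine hk.hasGroupB_of_hom hKE hg ι hι ?_ ?_ ?_ ?_ ?_
  · intro x y
    refine hΦinj _ _ (hι _) (by simpa using (hι x).mul (hι y)) (LinearMap.ext fun z => ?_)
    rw [hΦmul _ _ (hι x) (hι y), LinearMap.add_apply, hιΦ, hιΦ, hιΦ, add_mul, map_add]
  · intro x
    constructor
    · intro hx
      refine mem_Asub_of_functional (hΦker h₀ hh₀) hsoc₀ fun y => ?_
      have h4 := hΦpow 1 0 Restricts.one
      rw [pow_zero, zero_smul] at h4
      rw [← hιΦ, hx, h4, LinearMap.zero_apply]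
    · intro hx
      refine hΦ1 _ (hι x) (LinearMap.ext fun y => ?_)
      rw [hιΦ, hΦker h₀ hh₀ _ (Ideal.mul_mem_right _ _ hx), LinearMap.zero_apply]
  · intro h hh
    obtain ⟨x, hx⟩ := exists_mul_functional (hΦker h₀ hh₀) hsoc₀ (hΦker h hh)
    exact ⟨x, hΦinj _ _ (hι x) hh (LinearMap.ext fun y => by rw [hιΦ, hx])⟩
  · intro x
    refine hΦinj _ _ (hι _) (by simpa using (hg.mul (hι x)).mul (hg.inv hKE))
      (LinearMap.ext fun y => ?_)
    have h4 : Φ (g * ι x * g⁻¹) y = Φ (ι x) (tau p * y) :=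
      hk.kummerFunctional_conj hKE hβ (hι x) hg y
    rw [h4, hιΦ, hιΦ, mul_left_comm, mul_assoc]
  -- `g^p` commutes with `g`, so it pairs equally with all conjugates of `β`. The functional
  -- attached to `e (τ - 1)^(i-1)` is likewise constant on the `τ^s`, since `τ^s ≡ 1` modulo `τ -
  -- 1`.
  · refine hΦinj _ _ (hι _) hgpr (functional_ext fun s => ?_)
    have h4 : ∀ n : ℕ, pair p ξ (g ^ p) (act (σ ^ n) β) = pair p ξ (g ^ p) β := by
      intro n
      have h5 := hk.pair_conj hKE hgpr (hg.pow n) hβ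
      rwa [(Commute.pow_pow_self g n p).eq, mul_inv_cancel_right] at h5
    have h6 : Φ (g ^ p) (tauPow p s) = pair p ξ (g ^ p) β := by
      simp only [Φ]
      rw [kummerFunctional_tauPow, h4]
    obtain ⟨y, hy⟩ := sub_one_dvd_tauPow_sub_one s
    have h7 : algebraMap (ZMod p) (A p) e * (tau p - 1) ^ (i - 1) * tauPow p s =
        e • (tau p - 1) ^ (i - 1) + (tau p - 1) ^ i * (algebraMap (ZMod p) (A p) e * y) := by
      obtain ⟨n, rfl⟩ := Nat.exists_eq_add_of_le' hi
      rw [Nat.add_sub_cancel, ← sub_add_cancel (tauPow p s) 1, hy, Algebra.smul_def]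
      ring
    rw [hιΦ, h7, map_add, map_smul, hΦker h₀ hh₀ _ (mem_Asub.2 ⟨_, rfl⟩), add_zero, h6, smul_eq_mul,
      hval]

end IsKummer

/-! ## Solutions of the embedding problem -/

/-! ### Polynomials in `ρ` with constant term prime to `p` -/

section RhoPoly

variable {F E : Type*} [Field F] [Field E] [Algebra F E] {p : ℕ} {σ : E ≃ₐ[F] E}

lemma rhoPoly_succ (n : ℕ) (c : ℕ → ℤ) (ω : Eˣ) : rhoPoly σ (n + 1) c ω =
    ω ^ c 0 * ∏ k ∈ Finset.range n, ((rho σ)^[k + 1] ω) ^ c (k + 1) := by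
  rw [rhoPoly, Finset.prod_range_succ', mul_comm]
  rfl

lemma rhoPoly_const {i : ℕ} (hi : 1 ≤ i) (m : ℤ) (ω : Eˣ) :
    rhoPoly σ i (fun k => if k = 0 then m else 0) ω = ω ^ m := by
  obtain ⟨n, rfl⟩ := Nat.exists_eq_add_of_le' hi
  rw [rhoPoly_succ, if_pos rfl, Finset.prod_eq_one, mul_one]
  intro k _
  rw [if_neg (Nat.succ_ne_zero k), zpow_zero]

lemma rho_iterate_rhoPoly (k i : ℕ) (c : ℕ → ℤ) (ω : Eˣ) :
    (rho σ)^[k] (rhoPoly σ i c ω) = rhoPoly σ i c ((rho σ)^[k] ω) := by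
  have h1 : ∀ s : Finset ℕ, ∀ f : ℕ → Eˣ,
      (rho σ)^[k] (∏ l ∈ s, f l) = ∏ l ∈ s, (rho σ)^[k] (f l) := by
    intro s f
    classical
    induction s using Finset.induction_on with
    | empty => rw [Finset.prod_empty, Finset.prod_empty, rho_iterate_one]
    | insert a s ha ih => rw [Finset.prod_insert ha, Finset.prod_insert ha, rho_iterate_mul, ih]
  rw [rhoPoly, rhoPoly, h1]
  exact Finset.prod_congr rfl fun l _ => by
    rw [rho_iterate_zpow, rho_iterate_add, rho_iterate_add, add_comm]

lemma cls_rhoPoly_congr {x y : Eˣ} (h : cls p x = cls p y) (i : ℕ) (c : ℕ → ℤ) :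
    cls p (rhoPoly σ i c x) = cls p (rhoPoly σ i c y) := by
  obtain ⟨q, rfl⟩ := cls_eq_cls.1 h
  refine cls_eq_cls.2 ⟨rhoPoly σ i c q, ?_⟩
  rw [rhoPoly, rhoPoly, rhoPoly, ← Finset.prod_pow, ← Finset.prod_mul_distrib]
  exact Finset.prod_congr rfl fun l _ => by
    rw [rho_iterate_mul, rho_iterate_pow, mul_zpow, ← zpow_natCast, ← zpow_natCast, zpow_comm]

lemma cls_zpow_eq_one [Fact p.Prime] {x : Eˣ} {m : ℤ} (hm : ¬ (p : ℤ) ∣ m)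
    (h : cls p x ^ m = 1) : cls p x = 1 := by
  have hpp : Prime (p : ℤ) := Nat.prime_iff_prime_int.1 Fact.out
  obtain ⟨u, v, huv⟩ := hpp.coprime_iff_not_dvd.2 hm
  obtain ⟨q, hq⟩ := cls_eq_one.1 ((cls_zpow x m).trans h)
  refine cls_eq_one.2 ⟨x ^ u * q ^ v, ?_⟩
  rw [mul_pow, ← zpow_natCast, ← zpow_natCast, ← zpow_mul, zpow_comm, zpow_natCast, hq, ← zpow_mul,
    ← zpow_add, mul_comm m, huv, zpow_one]

lemma cls_mul_right {x y : Eˣ} (h : cls p y = 1) : cls p (x * y) = cls p x := by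
  obtain ⟨q, rfl⟩ := cls_eq_one.1 h
  exact cls_eq_cls.2 ⟨q, rfl⟩

lemma cls_mul_left {x y : Eˣ} (h : cls p x = 1) : cls p (x * y) = cls p y := by
  rw [mul_comm, cls_mul_right h]

lemma cls_zpow_of_eq_one {x : Eˣ} (h : cls p x = 1) (m : ℤ) : cls p (x ^ m) = 1 := by
  obtain ⟨q, rfl⟩ := cls_eq_one.1 h
  exact cls_eq_one.2 ⟨q ^ m, by rw [← zpow_natCast, ← zpow_natCast, zpow_comm]⟩

lemma cls_zpow_congr {x y : Eˣ} (h : cls p x = cls p y) (m : ℤ) :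
    cls p (x ^ m) = cls p (y ^ m) := by
  rw [cls_zpow, cls_zpow, h]

/-- After `ρ^{j-1}`, only the constant term `c 0` acts nontrivially on a class killed by `ρ^j`, and
it is prime to `p`. -/
lemma cls_rhoPoly_ne_one [Fact p.Prime] {i j : ℕ} (hi : 1 ≤ i) (hj : 1 ≤ j) {c : ℕ → ℤ}
    (hc : ¬ (p : ℤ) ∣ c 0) {γ : Eˣ} (h1 : cls p ((rho σ)^[j] γ) = 1)
    (h2 : cls p ((rho σ)^[j - 1] γ) ≠ 1) : cls p ((rho σ)^[j - 1] (rhoPoly σ i c γ)) ≠ 1 := by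
  obtain ⟨n, rfl⟩ := Nat.exists_eq_add_of_le' hi
  rw [rho_iterate_rhoPoly, rhoPoly_succ]
  have h3 : ∀ n, cls p (∏ k ∈ Finset.range n,
      ((rho σ)^[k + 1] ((rho σ)^[j - 1] γ)) ^ c (k + 1)) = 1 := by
    intro n
    induction n with
    | zero => rw [Finset.prod_range_zero, cls_one]
    | succ n ih =>
      rw [Finset.prod_range_succ, cls_mul_left ih]
      apply cls_zpow_of_eq_one
      rw [rho_iterate_add, cls_rho_eq_one_of_le (by omega) h1]
  rw [cls_mul_right (h3 n)]
  exact fun h => h2 (cls_zpow_eq_one hc h)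

lemma cls_rhoPoly_eq_one {i j : ℕ} {c : ℕ → ℤ} {γ : Eˣ} (h1 : cls p ((rho σ)^[j] γ) = 1) :
    cls p ((rho σ)^[j] (rhoPoly σ i c γ)) = 1 := by
  rw [rho_iterate_rhoPoly, cls_rhoPoly_congr (h1.trans cls_one.symm), rhoPoly]
  rw [Finset.prod_eq_one, cls_one]
  intro k _
  rw [rho_iterate_one, one_zpow]

lemma mem_of_zpow_mem [Fact p.Prime] {R : Subgroup Eˣ} (hR : ∀ q, q ^ p ∈ R) {x : Eˣ} {m : ℤ}
    (hm : ¬ (p : ℤ) ∣ m) (h : x ^ m ∈ R) : x ∈ R := by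
  have hpp : Prime (p : ℤ) := Nat.prime_iff_prime_int.1 Fact.out
  obtain ⟨u, v, huv⟩ := hpp.coprime_iff_not_dvd.2 hm
  rw [← zpow_one x, ← huv, zpow_add, mul_comm u, zpow_mul, mul_comm v, zpow_mul, zpow_natCast]
  exact mul_mem (Subgroup.zpow_mem _ (hR x) u) (Subgroup.zpow_mem _ h v)

/-- `1 + c₁ ρ + ⋯` is invertible on elements killed by a power of `ρ`. -/
lemma mem_of_rhoPoly_mem [Fact p.Prime] {R : Subgroup Eˣ} (hR : ∀ q, q ^ p ∈ R)
    (hρ : ∀ x ∈ R, rho σ x ∈ R) {i j : ℕ} (hi : 1 ≤ i) {c : ℕ → ℤ} (hc : ¬ (p : ℤ) ∣ c 0) {γ : Eˣ}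
    (h1 : cls p ((rho σ)^[j] γ) = 1) (h : rhoPoly σ i c γ ∈ R) : γ ∈ R := by
  obtain ⟨n, rfl⟩ := Nat.exists_eq_add_of_le' hi
  have hρk : ∀ k, ∀ x ∈ R, (rho σ)^[k] x ∈ R := by
    intro k
    induction k with
    | zero => exact fun x hx => hx
    | succ k ih => intro x hx; rw [Function.iterate_succ_apply']; exact hρ _ (ih x hx)
  -- Descending induction on the power of `ρ`: in `ρ^l` of the polynomial expression, all terms but
  -- `(ρ^l γ)^{c 0}` are already known to lie in `R`.
  have key : ∀ m ≤ j, ∀ l, j - m ≤ l → (rho σ)^[l] γ ∈ R := by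
    intro m
    induction m with
    | zero =>
      intro _ l hl
      obtain ⟨q, hq⟩ := cls_eq_one.1 (cls_rho_eq_one_of_le hl h1)
      rw [← hq]; exact hR q
    | succ m ih =>
      intro hm l hl
      rcases eq_or_lt_of_le hl with rfl | hl
      · have h3 := hρk (j - (m + 1)) _ h
        rw [rho_iterate_rhoPoly, rhoPoly_succ] at h3
        refine mem_of_zpow_mem hR hc ((Subgroup.mul_mem_cancel_right _ ?_).1 h3)
        refine Subgroup.prod_mem _ fun k _ => Subgroup.zpow_mem _ ?_ _
        rw [rho_iterate_add]
        exact ih (by omega) _ (by omega)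
      · exact ih (by omega) l (by omega)
  exact key j le_rfl 0 (by omega)

end RhoPoly

section Restriction

variable {F Ω : Type*} [Field F] [Field Ω] [Algebra F Ω] {L E : IntermediateField F Ω}

lemma exists_restriction (hLE : L ≤ E) [Normal F L] (g : E ≃ₐ[F] E) :
    ∃ h : L ≃ₐ[F] L, Restricts h g := by
  let _ : Algebra L E := (IntermediateField.inclusion hLE).toRingHom.toAlgebra
  have : IsScalarTower F L E := IsScalarTower.of_algebraMap_eq fun x => rfl
  refine ⟨g.restrictNormal L, fun x y hxy => ?_⟩
  have h1 := g.restrictNormal_commutes L x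
  have h2 : algebraMap L E x = y := Subtype.ext hxy
  rw [h2] at h1
  exact congrArg Subtype.val h1

end Restriction

lemma B.proj_surjective {p : ℕ} [Fact p.Prime] {i j : ℕ} (h : j < i) (e : ZMod p) :
    Function.Surjective (B.proj h e) := by
  intro b
  obtain ⟨x, hx⟩ := Ideal.Quotient.mk_surjective b.fst
  exact ⟨⟨Ideal.Quotient.mk _ x, b.snd⟩, B.ext hx rfl⟩

instance {p : ℕ} [Fact p.Prime] {i : ℕ} {e : ZMod p} : Finite (B p i e) :=
  Finite.of_injective (fun g => (g.fst, g.snd))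
    fun _ _ hgh => B.ext (congrArg Prod.fst hgh) (congrArg Prod.snd hgh)

/-! ### From Kummer generators to solutions -/

namespace IsKummer

variable {F Ω : Type*} [Field F] [Field Ω] [Algebra F Ω] {K : IntermediateField F Ω} {p : ℕ}
  [hpf : Fact p.Prime] {ξ : Fˣ} {r : Kˣ} {σ : K ≃ₐ[F] K} (hk : IsKummer p ξ r σ)

include hk

/-- The compatibility of the isomorphisms in the definition of a solution can always be achieved. -/
lemma isSolution_of_hasGroupB [IsAlgClosed Ω] {i j : ℕ} (hij : j < i) {e : ZMod p}
    {L E : IntermediateField F Ω} {γ : Kˣ} (hL : L = adjoinRoots p K (orbit σ γ))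
    (hγ : cls p ((rho σ)^[j] γ) = 1) (hLE : L ≤ E) (hBL : HasGroupB p σ L j 0)
    (hB : HasGroupB p σ E i e) : IsSolution σ hij e L E := by
  obtain ⟨hKL, hGL, φ₀, hφ₀⟩ := hBL
  obtain ⟨hKE, hGE, ψ, hψ⟩ := hB
  have := hk.normal
  have : Finite (E ≃ₐ[F] E) := Finite.of_equiv _ ψ.symm.toEquiv
  have : FiniteDimensional F E := IsGalois.finiteDimensional_of_finite F E
  have hγL : γ ∈ rts p K L := hL ▸ subset_rts_adjoinRoots _ (hk.self_mem_orbit γ)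
  have hγE := rts_mono hLE hγL
  choose res hres using fun g : E ≃ₐ[F] E => exists_restriction hLE g
  let R : (E ≃ₐ[F] E) →* (L ≃ₐ[F] L) := MonoidHom.mk' res fun g h =>
    (hres (g * h)).unique hLE ((hres g).mul (hres h))
  let π : (E ≃ₐ[F] E) →* B p j 0 := (B.proj hij e).comp ψ.toMonoidHom
  have hπ : Function.Surjective π := (B.proj_surjective hij e).comp ψ.surjective
  have hπapp : ∀ g, π g = B.proj hij e (ψ g) := fun g => rfl
  -- The kernel of `π` is `ι(A_j)`. It fixes the roots of all conjugates of `γ`, because `[γ]^{ρ^j}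
  -- = 1`. So restriction to `L` factors through `B_{j,0}`.
  have hker : π.ker ≤ R.ker := by
    intro g hg
    rw [MonoidHom.mem_ker] at hg ⊢
    have h1 : (ψ g).snd = 0 := congrArg B.snd hg
    have h2 : quotMap p hij.le (ψ g).fst = 0 := congrArg B.fst hg
    obtain ⟨x, hx⟩ := B.exists_eq_inj h1
    have hgx : g = iota ψ x := by rw [iota, ← hx, MulEquiv.symm_apply_apply]
    have hxj : x ∈ Asub p j := by
      rw [hx, B.inj, quotMap_mk, Ideal.Quotient.eq_zero_iff_mem] at h2
      exact h2
    have hgK := restricts_iota hψ x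
    have hRK : Restricts (1 : K ≃ₐ[F] K) (R g) := by
      intro a b hab
      have h3 := hgK a ⟨b, hLE b.2⟩ hab
      rw [h3, ← hgx]
      exact (hres g b ⟨b, hLE b.2⟩ rfl).symm
    refine hk.eq_one_of_pair (p := p) (ξ := ξ) hL hRK ?_
    rintro _ ⟨s, rfl⟩
    obtain ⟨c, hc, hcu⟩ := act_mem_rts hKL (σ ^ s) hγL
    rw [hk.pair_eq_zero_iff (c := ⟨c, hc⟩) hRK hcu]
    apply Subtype.ext
    refine (hres g ⟨c, hc⟩ ⟨c, hLE hc⟩ rfl).trans ?_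
    have h4 : pair p ξ (iota ψ x) (act (σ ^ s) γ) = 0 := by
      obtain ⟨y, rfl⟩ := mem_Asub.1 hxj
      obtain ⟨z, hz⟩ := ((isUnit_tau (p := p)).pow s).exists_right_inv
      have h5 := hk.pair_iota_act hψ hKE s (z * ((tau p - 1) ^ j * y)) hγE
      rw [← mul_assoc, hz, one_mul] at h5
      rw [h5, ← (hk.cls_rho_eq_one_iff hψ hKE j hγE).1 hγ ((-1) ^ j * (z * y)),
        ← neg_sub (tau p) 1, neg_pow, mul_mul_mul_comm, ← mul_pow, neg_one_mul, neg_neg, one_pow,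
        one_mul, mul_left_comm]
    have h6 := (hk.pair_eq_zero_iff (c := ⟨c, hLE hc⟩) hgK hcu).1 h4
    rw [hgx, h6]
  have hR : Function.Surjective R := by
    intro h
    obtain ⟨g, hg⟩ := exists_lift hLE h
    exact ⟨g, (hres g).unique hLE hg⟩
  let Θ : B p j 0 →* (L ≃ₐ[F] L) :=
    π.liftOfRightInverse _ (Function.rightInverse_surjInv hπ) ⟨R, hker⟩
  have hΘ : ∀ g, Θ (π g) = R g := fun g =>
    π.liftOfRightInverse_comp_apply _ (Function.rightInverse_surjInv hπ) ⟨R, hker⟩ g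
  have hΘs : Function.Surjective Θ := by
    intro h
    obtain ⟨g, rfl⟩ := hR h
    exact ⟨π g, hΘ g⟩
  -- From `φ₀` only the order of `Gal(L/F)` is used; the identification that is compatible with `ψ`
  -- is the inverse of `Θ`.
  have hΘb : Function.Bijective Θ :=
    (Nat.bijective_iff_surjective_and_card Θ).2 ⟨hΘs, Nat.card_congr φ₀.symm.toEquiv⟩
  let φ := (MulEquiv.ofBijective Θ hΘb).symm
  have hφ : ∀ g, φ (R g) = π g := fun g => by
    rw [← hΘ g]
    exact (MulEquiv.ofBijective Θ hΘb).symm_apply_apply _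
  refine ⟨hKL, hLE, hGL, hGE, φ, ψ, ?_, hψ, ?_⟩
  · intro h
    obtain ⟨g, rfl⟩ := hR h
    rw [hφ]
    intro a b hab
    exact (hψ g a ⟨b, hLE b.2⟩ hab).trans (hres g b ⟨b, hLE b.2⟩ rfl).symm
  · intro h g hhg
    have : h = R g := hhg.unique hLE (hres g)
    rw [this, hφ, hπapp]

/-- Conjugates of `β` are products of powers of the `ρ^l β`, and for `l ≥ k` the class of `ρ^l β` is
that of `ρ^{l-k} γ`, which has a root in `L`. -/
lemma adjoinRoots_orbit_eq [IsAlgClosed Ω] {L : IntermediateField F Ω} (hKL : K ≤ L)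
    [Normal F L] {k : ℕ} {β γ : Kˣ} (hγ : γ ∈ rts p K L) (h : cls p ((rho σ)^[k] β) = cls p γ)
    (hLE : L ≤ adjoinRoots p K (orbit σ β)) :
    adjoinRoots p K (orbit σ β) = adjoinRoots p L {x | ∃ l, l < k ∧ x = (rho σ)^[l] β} := by
  have := hk.normal
  have hKE : K ≤ adjoinRoots p K (orbit σ β) := le_adjoinRoots _
  have hKL' := hKL.trans (le_adjoinRoots (p := p) {x : Kˣ | ∃ l, l < k ∧ x = (rho σ)^[l] β})
  have := hk.isGalois_adjoinRoots (hk.act_mem_orbit β)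
  apply le_antisymm
  · refine hk.adjoinRoots_le hKL' (orbit_subset_of_rho fun l => ?_)
    by_cases hl : l < k
    · exact subset_rts_adjoinRoots _ ⟨l, hl, rfl⟩
    · obtain ⟨m, rfl⟩ := Nat.exists_eq_add_of_le' (not_lt.1 hl)
      rw [← rho_iterate_add, mem_rts_congr hKL' (cls_rho_congr h m)]
      exact rts_mono (le_adjoinRoots _) (rho_iterate_mem_rts hKL σ hγ m)
  · refine hk.adjoinRoots_le hLE ?_
    rintro _ ⟨l, -, rfl⟩
    exact rho_iterate_mem_rts hKE σ (subset_rts_adjoinRoots _ (hk.self_mem_orbit β)) l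

lemma adjoinRoots_le_of_cls [IsAlgClosed Ω] {L : IntermediateField F Ω} (hKL : K ≤ L)
    {S T : Set Kˣ} (h : ∀ s ∈ S, ∃ t ∈ T, ∃ m : ℤ, ¬ (p : ℤ) ∣ m ∧ cls p (s ^ m) = cls p t) :
    adjoinRoots p L S ≤ adjoinRoots p L T := by
  have hKL' := hKL.trans (le_adjoinRoots (p := p) T)
  refine hk.adjoinRoots_le (le_adjoinRoots _) fun s hs => ?_
  obtain ⟨t, ht, m, hm, hst⟩ := h s hs
  exact mem_of_zpow_mem (pow_mem_rts hKL') hm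
    ((mem_rts_congr hKL' hst).2 (subset_rts_adjoinRoots _ ht))

lemma not_dvd_one : ¬ (p : ℤ) ∣ 1 := fun h => hpf.out.one_lt.ne'
  (by exact_mod_cast Int.eq_one_of_dvd_one (by positivity) h)

lemma adjoinRoots_congr [IsAlgClosed Ω] {L : IntermediateField F Ω} (hKL : K ≤ L)
    {S T : Set Kˣ} (h1 : ∀ s ∈ S, ∃ t ∈ T, cls p s = cls p t)
    (h2 : ∀ t ∈ T, ∃ s ∈ S, cls p t = cls p s) :
    adjoinRoots p L S = adjoinRoots p L T := by
  apply le_antisymm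
  · refine hk.adjoinRoots_le_of_cls hKL fun s hs => ?_
    obtain ⟨t, ht, h⟩ := h1 s hs
    exact ⟨t, ht, 1, hk.not_dvd_one, by rw [zpow_one, h]⟩
  · refine hk.adjoinRoots_le_of_cls hKL fun s hs => ?_
    obtain ⟨t, ht, h⟩ := h2 s hs
    exact ⟨t, ht, 1, hk.not_dvd_one, by rw [zpow_one, h]⟩

lemma exists_zpow_inv {m : ℤ} (hm : ¬ (p : ℤ) ∣ m) :
    ∃ n : ℤ, ¬ (p : ℤ) ∣ n ∧ ∀ x : Kˣ, cls p (x ^ (m * n)) = cls p x := by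
  have hpp : Prime (p : ℤ) := Nat.prime_iff_prime_int.1 Fact.out
  obtain ⟨u, v, huv⟩ := hpp.coprime_iff_not_dvd.2 hm
  refine ⟨v, fun hv => hk.not_dvd_one ?_, fun x => ?_⟩
  · rw [← huv]
    exact dvd_add (Dvd.intro_left u rfl) (Dvd.dvd.mul_right hv m)
  · refine cls_eq_cls.2 ⟨x ^ (-u), ?_⟩
    rw [show m * v = 1 + -u * p by linear_combination huv, zpow_add, zpow_one, zpow_mul,
      zpow_natCast]

section Solutions

variable [IsAlgClosed Ω] {i j : ℕ} (hj : 1 ≤ j) (hij : j < i) (hi : i ≤ p) {γ : Kˣ}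
  {L : IntermediateField F Ω} (hL : L = adjoinRoots p K (orbit σ γ)) (hB : HasGroupB p σ L j 0)
  {e : ZMod p} (he : e ≠ 0)

include hj hij hi hL hB he

/-- Every solution is generated over `L` by the `ρ`-orbit of an element `β`. -/
lemma exists_of_isSolution {L' : IntermediateField F Ω} (h : IsSolution σ hij e L L') :
    ∃ β : Kˣ, cls p ((rho σ)^[i - j] β) = cls p γ ∧ β ∉ normPow p σ ∧
      L' = adjoinRoots p L {x | ∃ l, l < i - j ∧ x = (rho σ)^[l] β} := by
  obtain ⟨h1, h2⟩ := hk.length_of_hasGroupB hj (by omega) hL hB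
  obtain ⟨hKL, hLL', hGL, hGL', φ, ψ, -, hψ, -⟩ := h
  have hγL : γ ∈ rts p K L := hL ▸ subset_rts_adjoinRoots _ (hk.self_mem_orbit γ)
  have hB' : HasGroupB p σ L' i e := ⟨hKL.trans hLL', hGL', ψ, hψ⟩
  obtain ⟨k, rfl⟩ := Nat.exists_eq_add_of_le' hij.le
  obtain ⟨β, hβ, hβn, hE⟩ := hk.exists_generator hj hi he hB' (rts_mono hLL' hγL) h1 h2
  rw [Nat.add_sub_cancel]
  exact ⟨β, hβ, hβn, hE.trans (hk.adjoinRoots_orbit_eq hKL hγL hβ (hE ▸ hLL'))⟩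

/-- Construction of solutions. -/
lemma isSolution_of {β : Kˣ} {n : ℕ} (hn : 1 ≤ n) {c : ℕ → ℤ} (hc : ¬ (p : ℤ) ∣ c 0)
    (hβ : cls p ((rho σ)^[i - j] β) = cls p (rhoPoly σ n c γ)) (hβn : i = p ∨ β ∉ normPow p σ) :
    IsSolution σ hij e L (adjoinRoots p L {x | ∃ l, l < i - j ∧ x = (rho σ)^[l] β}) := by
  have := hk.normal
  obtain ⟨h1, h2⟩ := hk.length_of_hasGroupB hj (by omega) hL hB
  have hKL := hB.1
  have := hB.2.1
  have hγL : γ ∈ rts p K L := hL ▸ subset_rts_adjoinRoots _ (hk.self_mem_orbit γ)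
  have h3 : cls p ((rho σ)^[i] β) = 1 := by
    rw [show i = j + (i - j) by omega, ← rho_iterate_add, cls_rho_congr hβ, cls_rhoPoly_eq_one h1]
  have h4 : cls p ((rho σ)^[i - 1] β) ≠ 1 := by
    rw [show i - 1 = j - 1 + (i - j) by omega, ← rho_iterate_add, cls_rho_congr hβ]
    exact cls_rhoPoly_ne_one hn hj hc h1 h2
  -- For `i = p` this is automatic: `[N(β)] = [β]^{ρ^{p-1}} ≠ 1`.
  have h5 : β ∉ normPow p σ := by
    rcases hβn with rfl | hβn
    · exact hk.notMem_normPow_of_cls_ne h4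
    · exact hβn
  have hE := hk.hasGroupB_adjoinRoots (by omega) he h3 h4 h5
  have hKE := hE.1
  have := hE.2.1
  have hβE : β ∈ rts p K (adjoinRoots p K (orbit σ β)) :=
    subset_rts_adjoinRoots _ (hk.self_mem_orbit β)
  have hγE : γ ∈ rts p K (adjoinRoots p K (orbit σ β)) :=
    mem_of_rhoPoly_mem (pow_mem_rts hKE) (fun x hx => rho_mem_rts hKE σ hx) hn hc h1
      ((mem_rts_congr hKE hβ).1 (rho_iterate_mem_rts hKE σ hβE _))
  have hLE : L ≤ adjoinRoots p K (orbit σ β) := by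
    rw [hL]
    exact hk.adjoinRoots_le hKE (orbit_subset_rts hKE σ hγE)
  have hγ'L : rhoPoly σ n c γ ∈ rts p K L :=
    Subgroup.prod_mem _ fun k _ => Subgroup.zpow_mem _ (rho_iterate_mem_rts hKL σ hγL k) _
  rw [← hk.adjoinRoots_orbit_eq hKL hγ'L hβ hLE]
  exact hk.isSolution_of_hasGroupB hij hL h1 hLE hB hE

/-- The solutions in terms of an element `α ∉ N^{-1}(F^{×p})` killed by `ρ^{i-j}`. -/
lemma isSolution_iff_of_notMem {α : Kˣ} (hα : α ∉ normPow p σ)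
    (hαρ : cls p ((rho σ)^[i - j] α) = 1) (L' : IntermediateField F Ω) :
    IsSolution σ hij e L L' ↔
      ∃ (f : Fˣ) (ω ω' : Kˣ) (c : ℕ → ℤ), cls p γ = cls p ((rho σ)^[p - j] ω) ∧
        ¬ (p : ℤ) ∣ c 0 ∧ ω' = rhoPoly σ i c ω ∧
        L' = adjoinRoots p L {x | ∃ l, l < i - j ∧
          x = (rho σ)^[l] (incl K f * α * (rho σ)^[p - i] ω')} := by
  obtain ⟨h1, h2⟩ := hk.length_of_hasGroupB hj (by omega) hL hB
  constructor
  · intro h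
    obtain ⟨β, hβγ, hβ, rfl⟩ := hk.exists_of_isSolution hj hij hi hL hB he h
    have hβi : cls p ((rho σ)^[i] β) = 1 := by
      rw [show i = j + (i - j) by omega, ← rho_iterate_add, cls_rho_congr hβγ, h1]
    obtain ⟨m, f, ω₁, hm, hω₁⟩ : ∃ (m : ℤ) (f : Fˣ) (ω₁ : Kˣ), ¬ (p : ℤ) ∣ m ∧
        β ^ m = incl K f * α * (rho σ)^[p - i] ω₁ := by
      -- For `i = p` the exponent `p - i` is `0`, so `ω₁ = β / α` does. For `i < p`, both `β` and
      -- `α` generate the quotient by `normPow`, and a power of `β` agrees with `α` there.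
      rcases hi.eq_or_lt with rfl | hip
      · exact ⟨1, 1, β / α, hk.not_dvd_one, by simp⟩
      · obtain ⟨m, hm, hx⟩ := hk.exists_zpow_mul_mem_normPow
          (cls_rho_eq_one_of_le (by omega) hβi) (cls_rho_eq_one_of_le (by omega) hαρ) hβ hα
        obtain ⟨f, ω, h⟩ := hk.exists_eq_incl_mul_rho (i := i) (t := p - i) (by omega) (by omega)
          (by omega) hx (by
            rw [rho_iterate_mul, rho_iterate_zpow, rho_iterate_inv,
              cls_mul_left (cls_zpow_of_eq_one hβi m), cls_inv,
              cls_rho_eq_one_of_le (by omega) hαρ]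
            exact inv_one)
        exact ⟨m, f, ω, hm, by rw [mul_right_comm, ← h, inv_mul_cancel_right]⟩
    obtain ⟨n, hn, hmn⟩ := hk.exists_zpow_inv hm
    have hω' : rhoPoly σ i (fun k => if k = 0 then m else 0) (ω₁ ^ n) = ω₁ ^ (m * n) := by
      rw [rhoPoly_const (by omega), ← zpow_mul, mul_comm]
    -- Since `[ω₁]^{ρ^{p-j}} = [γ]^m`, the element with image `[γ]` is `ω = ω₁^n`, with `n` inverse
    -- to `m` modulo `p`. The constant polynomial `m` brings `ω'` back to the class of `ω₁`.
    refine ⟨f, ω₁ ^ n, _, fun k => if k = 0 then m else 0, ?_, by simpa using hm, rfl, ?_⟩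
    · have h3 := congrArg (fun x => cls p ((rho σ)^[i - j] x)) hω₁
      simp only [rho_iterate_mul, rho_iterate_zpow, rho_iterate_incl σ (show 1 ≤ i - j by omega),
        one_mul, cls_mul_left hαρ, rho_iterate_add] at h3
      rw [rho_iterate_zpow, ← hmn, zpow_mul, show p - j = i - j + (p - i) by omega]
      exact cls_zpow_congr ((cls_zpow_congr hβγ m).symm.trans h3) n
    · rw [hω']
      have key : ∀ l, cls p (((rho σ)^[l] β) ^ m) =
          cls p ((rho σ)^[l] (incl K f * α * (rho σ)^[p - i] (ω₁ ^ (m * n)))) := by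
        intro l
        rw [← rho_iterate_zpow, hω₁]
        refine cls_rho_congr ?_ l
        rw [cls_mul, cls_mul (incl K f * α), cls_rho_congr (hmn ω₁).symm]
      apply le_antisymm
      · refine hk.adjoinRoots_le_of_cls hB.1 ?_
        rintro _ ⟨l, hl, rfl⟩
        exact ⟨_, ⟨l, hl, rfl⟩, m, hm, key l⟩
      · refine hk.adjoinRoots_le_of_cls hB.1 ?_
        rintro _ ⟨l, hl, rfl⟩
        refine ⟨_, ⟨l, hl, rfl⟩, n, hn, ?_⟩
        rw [cls_zpow, ← key, ← cls_zpow, ← zpow_mul, hmn]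
  · rintro ⟨f, ω, ω', c, hω, hc, rfl, rfl⟩
    refine hk.isSolution_of hj hij hi hL hB he (n := i) (by omega) hc ?_ ?_
    · rw [rho_iterate_mul, rho_iterate_mul, rho_iterate_incl σ (by omega), one_mul,
        cls_mul_left hαρ, rho_iterate_add, show i - j + (p - i) = p - j by omega, rho_iterate_rhoPoly]
      exact (cls_rhoPoly_congr hω i c).symm
    · rcases hi.eq_or_lt with rfl | hip
      · exact Or.inl rfl
      · right
        rw [Subgroup.mul_mem_cancel_right _ (hk.rho_iterate_mem_normPow (by omega) _),
          Subgroup.mul_mem_cancel_left _ (incl_mem_normPow f)]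
        exact hα

end Solutions

end IsKummer

namespace IsKummer

variable {F Ω : Type*} [Field F] [Field Ω] [Algebra F Ω] [IsAlgClosed Ω]
  {K : IntermediateField F Ω} {p : ℕ}
  [hpf : Fact p.Prime] {ξ : Fˣ} {r : Kˣ} {σ : K ≃ₐ[F] K} (hk : IsKummer p ξ r σ)

include hk

/-! ## Cyclic extensions of degree `p ^ 2` -/

/-- The Galois group is abelian, so conjugation by a lift of `σ` is trivial and `pair_conj` gives
`σ(α)` and `α` the same character. -/
lemma cls_rho_eq_one_of_isCyclicOfDegree {α : Kˣ}
    (h : IsCyclicOfDegree (adjoinRoots p K {α}) (p ^ 2)) : cls p (rho σ α) = 1 := by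
  obtain ⟨hG, hC, hn⟩ := h
  have := hk.normal
  have : FiniteDimensional F (adjoinRoots p K {α}) :=
    Module.finite_of_finrank_pos (hn ▸ pow_pos hpf.out.pos 2)
  have hKE : K ≤ adjoinRoots p K {α} := le_adjoinRoots _
  have hα : α ∈ rts p K (adjoinRoots p K {α}) := subset_rts_adjoinRoots _ rfl
  obtain ⟨s, hs⟩ := exists_lift hKE σ
  rw [rho_apply, cls_div, div_eq_one]
  refine hk.cls_eq_of_pair hKE (act_mem_rts hKE σ hα) hα fun g hg => ?_
  have h1 := hk.pair_conj hKE hg hs hα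
  have : s * g * s⁻¹ = g := by
    obtain ⟨t, ht⟩ := hC.exists_generator
    obtain ⟨m, rfl⟩ := Subgroup.mem_zpowers_iff.1 (ht s)
    obtain ⟨n, rfl⟩ := Subgroup.mem_zpowers_iff.1 (ht g)
    rw [← zpow_add, ← zpow_neg, ← zpow_add, add_comm m, add_neg_cancel_right]
  rwa [this] at h1

/-- For `α ∈ normPow` a lift `s` of `σ` would satisfy `s^p = 1`. In a cyclic group of order `p^2`
this makes `s` a `p`-th power, which restricts trivially to `K`. -/
lemma notMem_normPow_of_isCyclicOfDegree {α : Kˣ}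
    (h : IsCyclicOfDegree (adjoinRoots p K {α}) (p ^ 2)) : α ∉ normPow p σ := by
  intro hα
  obtain ⟨hG, hC, hn⟩ := h
  have := hk.normal
  have : FiniteDimensional F (adjoinRoots p K {α}) :=
    Module.finite_of_finrank_pos (hn ▸ pow_pos hpf.out.pos 2)
  have hKE : K ≤ adjoinRoots p K {α} := le_adjoinRoots _
  obtain ⟨c, hc, hcα⟩ : α ∈ rts p K (adjoinRoots p K {α}) := subset_rts_adjoinRoots _ rfl
  obtain ⟨s, hs⟩ := exists_lift hKE σ
  have hs1 : Restricts (1 : K ≃ₐ[F] K) (s ^ p) := hk.pow_prime ▸ hs.pow p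
  have hsp : s ^ p = 1 := by
    refine hk.eq_one_of_pair (p := p) (ξ := ξ) rfl hs1 ?_
    rintro u rfl
    rw [hk.pair_eq_zero_iff (c := ⟨c, hc⟩) hs1 hcα]
    exact hk.pow_apply_root_of_mem_normPow hs hcα hα
  have hcard : Nat.card (adjoinRoots p K {α} ≃ₐ[F] adjoinRoots p K {α}) = p ^ 2 := by
    rw [IsGalois.card_aut_eq_finrank, hn]
  obtain ⟨t, ht⟩ := hC.exists_generator
  have hto : _root_.orderOf t = p ^ 2 := by rw [← hcard, orderOf_eq_card_of_forall_mem_zpowers ht]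
  obtain ⟨m, rfl⟩ := mem_powers_iff_mem_zpowers.2 (ht s)
  change (t ^ m) ^ p = 1 at hsp
  change Restricts σ (t ^ m) at hs
  rw [← pow_mul, ← orderOf_dvd_iff_pow_eq_one, hto, sq] at hsp
  obtain ⟨n, rfl⟩ := Nat.dvd_of_mul_dvd_mul_right hpf.out.pos hsp
  obtain ⟨k, hkt⟩ := hk.exists_restricts hKE t
  have h1 := hs.unique hKE (hkt.pow (p * n))
  rw [pow_mul, ← pow_mul σ, mul_comm k, pow_mul σ, hk.pow_prime, one_pow, one_pow] at h1
  exact hpf.out.one_lt.ne' (by rw [← hk.orderOf, h1, orderOf_one])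

lemma pair_pow_left {E : IntermediateField F Ω} {g : E ≃ₐ[F] E}
    (hg : Restricts (1 : K ≃ₐ[F] K) g) {u : Kˣ} (hu : u ∈ rts p K E) (n : ℕ) :
    pair p ξ (g ^ n) u = n * pair p ξ g u := by
  have hgn : ∀ n, Restricts (1 : K ≃ₐ[F] K) (g ^ n) := fun n => by simpa using hg.pow n
  induction n with
  | zero => rw [pow_zero, hk.pair_one hu, Nat.cast_zero, zero_mul]
  | succ n ih =>
    rw [pow_succ, hk.pair_mul_left (hgn n) hg hu, ih, Nat.cast_succ, add_mul, one_mul]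

/-- If `ρ(α) = z ^ p` with `N(z) = ξ`, then the `p`-th power of a lift of `σ` multiplies the `p`-th
roots of `α` by `ξ`. -/
lemma pair_pow_lift {E : IntermediateField F Ω} (hKE : K ≤ E) {s : E ≃ₐ[F] E}
    (hs : Restricts σ s) {α z : Kˣ} (hz : nm p σ z = incl K ξ) (hα : rho σ α = z ^ p)
    (hαE : α ∈ rts p K E) : pair p ξ (s ^ p) α = 1 := by
  have : Fact (1 < p) := ⟨hpf.out.one_lt⟩
  have hs1 : Restricts (1 : K ≃ₐ[F] K) (s ^ p) := hk.pow_prime ▸ hs.pow p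
  obtain ⟨c₀, hc₀, hcα⟩ := hαE
  obtain ⟨c, rfl⟩ : ∃ c : E, (c : Ω) = c₀ := ⟨⟨c₀, hc₀⟩, rfl⟩
  let ι := IntermediateField.inclusion hKE
  have hι : ∀ x : Kˣ, s (ι (x : K)) = ι ((act σ x : Kˣ) : K) := fun x =>
    Subtype.ext (hs (x : K) (ι x) rfl).symm
  have hz0 : ι (z : K) ≠ 0 := (map_ne_zero ι).2 z.ne_zero
  obtain ⟨n, hn⟩ := hk.exists_root_eq' (x := s c) (y := ι (z : K) * c)
    (mul_ne_zero hz0 (hk.root_ne_zero' hcα)) (by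
      rw [rts_stable hs hcα, act_eq_rho_mul, hα]
      change _ = (((z : K) : Ω) * (c : Ω)) ^ p
      rw [mul_pow, hcα]
      simp)
  -- At `m = p` the stray power of `ξ` disappears and the product becomes `N(z) = ξ`.
  have hm : ∀ m, (s ^ m) c = (algebraMap F E (ξ : F) ^ n.val) ^ m *
      (ι ((∏ l ∈ Finset.range m, act (σ ^ l) z : Kˣ) : K) * c) := by
    intro m
    induction m with
    | zero => simp
    | succ m ih =>
      have h1 : (∏ l ∈ Finset.range (m + 1), act (σ ^ l) z : Kˣ) =
          act σ (∏ l ∈ Finset.range m, act (σ ^ l) z) * z := by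
        rw [Finset.prod_range_succ', map_prod, pow_zero, act_one]
        simp only [pow_succ', act_mul]
      rw [pow_succ', AlgEquiv.mul_apply, ih, map_mul, map_mul, hι, hn, map_pow, map_pow, s.commutes,
        h1, Units.val_mul, map_mul]
      ring
  refine hk.pair_eq hs1 hcα ?_
  rw [hm, ← pow_mul, mul_comm n.val, pow_mul, (hk.prim_alg E).pow_eq_one, one_pow, one_mul,
    ← nm_apply, hz, ZMod.val_one, pow_one]
  rfl

/-- Since `N(z^p) = ξ^p = 1`, Hilbert 90 gives `α` with `ρ(α) = z^p`. Any lift of `σ` then has order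
`p^2` by `pair_pow_lift`, and it generates the group. -/
lemma exists_isCyclicOfDegree {z : Kˣ} (hz : nm p σ z = incl K ξ) :
    ∃ α : Kˣ, IsCyclicOfDegree (adjoinRoots p K {α}) (p ^ 2) := by
  have := hk.normal
  obtain ⟨α, hα⟩ := hk.exists_rho_eq (x := z ^ p) (by
    rw [map_pow, hz, hk.prim_incl.pow_eq_one])
  have hρ : cls p (rho σ α) = 1 := by rw [hα, cls_pow_self]
  have hEq : adjoinRoots p K (orbit σ α) = adjoinRoots p K {α} := by
    refine hk.adjoinRoots_congr le_rfl ?_ ?_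
    · rintro _ ⟨n, rfl⟩
      refine ⟨α, rfl, ?_⟩
      induction n with
      | zero => rfl
      | succ n ih =>
        change cls p (act (σ ^ (n + 1)) α) = _
        rw [pow_succ, act_mul, act_eq_rho_mul σ, map_mul, hα, map_pow, cls_mul_left (cls_pow_self _)]
        exact ih
    · rintro _ rfl
      exact ⟨_, hk.self_mem_orbit _, rfl⟩
  refine ⟨α, ?_⟩
  have hG : IsGalois F (adjoinRoots p K {α}) := hEq ▸ hk.isGalois_adjoinRoots (hk.act_mem_orbit α)
  have := hk.finiteDimensional_adjoinRoots (Set.finite_singleton α)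
  have hKE : K ≤ adjoinRoots p K {α} := le_adjoinRoots _
  have hαE : α ∈ rts p K (adjoinRoots p K {α}) := subset_rts_adjoinRoots _ rfl
  obtain ⟨s, hs⟩ := exists_lift hKE σ
  have hsp := hk.pair_pow_lift hKE hs hz hα hαE
  have hs1 : Restricts (1 : K ≃ₐ[F] K) (s ^ p) := hk.pow_prime ▸ hs.pow p
  have heq : ∀ g : adjoinRoots p K {α} ≃ₐ[F] adjoinRoots p K {α},
      Restricts (1 : K ≃ₐ[F] K) g → pair p ξ g α = 0 → g = 1 := fun g hg h =>
    hk.eq_one_of_pair rfl hg fun u hu => by rwa [Set.mem_singleton_iff.1 hu]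
  have hs1' : ∀ m, Restricts (1 : K ≃ₐ[F] K) ((s ^ p) ^ m) := fun m => by
    simpa using hs1.pow m
  have hso : _root_.orderOf s = p ^ 2 := by
    refine orderOf_eq_prime_pow ?_ ?_
    · rw [pow_one]
      intro h
      rw [h, hk.pair_one hαE] at hsp
      exact zero_ne_one hsp
    · rw [pow_succ, pow_one, pow_mul]
      refine heq _ (hs1' p) ?_
      rw [hk.pair_pow_left hs1 hαE, CharP.cast_eq_zero, zero_mul]
  have hgen : ∀ g, g ∈ Subgroup.zpowers s := by
    intro g
    obtain ⟨n, hn⟩ := hk.exists_restricts hKE g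
    have hg' : Restricts (1 : K ≃ₐ[F] K) (g * (s ^ n)⁻¹) := by
      simpa using hn.mul ((hs.pow n).inv hKE)
    have : NeZero p := ⟨hpf.out.ne_zero⟩
    have h1 := heq (g * (s ^ n)⁻¹ * (s ^ p) ^ (-pair p ξ (g * (s ^ n)⁻¹) α).val)
      (by simpa using hg'.mul (hs1' _))
      (by rw [hk.pair_mul_left hg' (hs1' _) hαE, hk.pair_pow_left hs1 hαE, hsp, mul_one,
        ZMod.natCast_zmod_val, add_neg_cancel])
    have hsz : ∀ k : ℕ, s ^ k ∈ Subgroup.zpowers s := fun k =>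
      Subgroup.npow_mem_zpowers s k
    rw [← Subgroup.mul_mem_cancel_right _ (inv_mem (hsz n)),
      ← Subgroup.mul_mem_cancel_right _ (Subgroup.pow_mem _ (hsz p) _), h1]
    exact one_mem _
  refine ⟨hG, ⟨s, hgen⟩, ?_⟩
  rw [← IsGalois.card_aut_eq_finrank, ← hso, orderOf_eq_card_of_forall_mem_zpowers hgen]

/-! ## Description of the solutions -/

section Solutions

variable {i j : ℕ} (hj : 1 ≤ j) (hij : j < i) (hi : i ≤ p) {γ : Kˣ}
  {L : IntermediateField F Ω} (hL : L = adjoinRoots p K (orbit σ γ)) (hB : HasGroupB p σ L j 0)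
  {e : ZMod p} (he : e ≠ 0)

include hj hij hi hL hB he

/-- As `[α]^ρ = 1`, `α` affects only the radical with `l = 0`. -/
lemma isSolution_iff_of_isCyclicOfDegree {α : Kˣ}
    (hα : IsCyclicOfDegree (adjoinRoots p K {α}) (p ^ 2)) (L' : IntermediateField F Ω) :
    IsSolution σ hij e L L' ↔
      ∃ (f : Fˣ) (ω ω' : Kˣ) (c : ℕ → ℤ), cls p γ = cls p ((rho σ)^[p - j] ω) ∧
        ¬ (p : ℤ) ∣ c 0 ∧ ω' = rhoPoly σ i c ω ∧
        L' = adjoinRoots p L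
          ({incl K f * α * (rho σ)^[p - i] ω'} ∪
            {x | ∃ k, p - i + 1 ≤ k ∧ k < p - j ∧ x = (rho σ)^[k] ω'}) := by
  have hρ := hk.cls_rho_eq_one_of_isCyclicOfDegree hα
  have hρl : ∀ l, 1 ≤ l → cls p ((rho σ)^[l] α) = 1 := fun l hl => cls_rho_eq_one_of_le hl hρ
  rw [hk.isSolution_iff_of_notMem hj hij hi hL hB he (hk.notMem_normPow_of_isCyclicOfDegree hα)
    (hρl _ (by omega))]
  refine exists_congr fun f => exists_congr fun ω => exists_congr fun ω' => exists_congr fun c =>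
    and_congr_right fun _ => and_congr_right fun _ => and_congr_right fun _ => ?_
  have key : ∀ l, 1 ≤ l → cls p ((rho σ)^[l] (incl K f * α * (rho σ)^[p - i] ω')) =
      cls p ((rho σ)^[p - i + l] ω') := by
    intro l hl
    rw [rho_iterate_mul, rho_iterate_mul, rho_iterate_incl σ hl, one_mul, cls_mul_left (hρl l hl),
      rho_iterate_add, add_comm]
  rw [hk.adjoinRoots_congr hB.1 (T := {incl K f * α * (rho σ)^[p - i] ω'} ∪
    {x | ∃ k, p - i + 1 ≤ k ∧ k < p - j ∧ x = (rho σ)^[k] ω'})]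
  · rintro _ ⟨l, hl, rfl⟩
    rcases Nat.eq_zero_or_pos l with rfl | hl0
    · exact ⟨_, Or.inl rfl, rfl⟩
    · exact ⟨_, Or.inr ⟨p - i + l, by omega, by omega, rfl⟩, key l hl0⟩
  · rintro _ (rfl | ⟨k, hk1, hk2, rfl⟩)
    · exact ⟨_, ⟨0, by omega, rfl⟩, rfl⟩
    · refine ⟨_, ⟨k - (p - i), by omega, rfl⟩, ?_⟩
      rw [key _ (by omega), show p - i + (k - (p - i)) = k by omega]

/-- Here `r` plays the role of `α`: `ρ(r) = ξ` appears in the second radical and `ρ^2(r) = 1`, so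
`r` is killed by `ρ^{i-j}` because `i - j ≥ 2`. -/
lemma isSolution_iff_of_lt (hij' : j + 1 < i) (L' : IntermediateField F Ω) :
    IsSolution σ hij e L L' ↔
      ∃ (f : Fˣ) (ω ω' : Kˣ) (c : ℕ → ℤ), cls p γ = cls p ((rho σ)^[p - j] ω) ∧
        ¬ (p : ℤ) ∣ c 0 ∧ ω' = rhoPoly σ i c ω ∧
        L' = adjoinRoots p L
          ({incl K f * r * (rho σ)^[p - i] ω', incl K ξ * (rho σ)^[p - i + 1] ω'} ∪
            {x | ∃ k, p - i + 2 ≤ k ∧ k < p - j ∧ x = (rho σ)^[k] ω'}) := by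
  have hr : r ∉ normPow p σ := by simpa using hk.r_pow_notMem_normPow hk.not_dvd_one
  rw [hk.isSolution_iff_of_notMem hj hij hi hL hB he hr
    (by rw [hk.rho_iterate_r (by omega), cls_one])]
  refine exists_congr fun f => exists_congr fun ω => exists_congr fun ω' => exists_congr fun c =>
    and_congr_right fun _ => and_congr_right fun _ => and_congr_right fun _ => ?_
  have key1 : (rho σ)^[1] (incl K f * r * (rho σ)^[p - i] ω') =
      incl K ξ * (rho σ)^[p - i + 1] ω' := by
    rw [rho_iterate_mul, rho_iterate_mul, rho_iterate_incl σ le_rfl, one_mul, rho_iterate_add,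
      add_comm, Function.iterate_one, hk.rho_r]
  have key2 : ∀ l, 2 ≤ l → (rho σ)^[l] (incl K f * r * (rho σ)^[p - i] ω') =
      (rho σ)^[p - i + l] ω' := by
    intro l hl
    rw [rho_iterate_mul, rho_iterate_mul, rho_iterate_incl σ (by omega), one_mul,
      hk.rho_iterate_r hl, one_mul, rho_iterate_add, add_comm]
  have hset : {x | ∃ l, l < i - j ∧ x = (rho σ)^[l] (incl K f * r * (rho σ)^[p - i] ω')} =
      {incl K f * r * (rho σ)^[p - i] ω', incl K ξ * (rho σ)^[p - i + 1] ω'} ∪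
        {x | ∃ k, p - i + 2 ≤ k ∧ k < p - j ∧ x = (rho σ)^[k] ω'} := by
    apply Set.Subset.antisymm
    · rintro _ ⟨l, hl, rfl⟩
      rcases (by omega : l = 0 ∨ l = 1 ∨ 2 ≤ l) with rfl | rfl | hl2
      · exact Or.inl (Or.inl rfl)
      · exact Or.inl (Or.inr key1)
      · exact Or.inr ⟨p - i + l, by omega, by omega, key2 l hl2⟩
    · rintro _ ((rfl | rfl) | ⟨k, hk1, hk2, rfl⟩)
      · exact ⟨0, by omega, rfl⟩
      · exact ⟨1, by omega, key1.symm⟩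
      · refine ⟨k - (p - i), by omega, ?_⟩
        rw [key2 _ (by omega), show p - i + (k - (p - i)) = k by omega]
  rw [hset]

omit [IsAlgClosed Ω] hk hj hij hi hL hB he hpf in
lemma setOf_lt_one (β : Kˣ) : {x | ∃ l, l < 1 ∧ x = (rho σ)^[l] β} = {β} := by
  ext x
  simp

/-- Now `i = p`, there is no norm condition, and `β` itself serves as `ω` and `ω'`. -/
lemma isSolution_iff_of_eq (hjp : j = p - 1) (L' : IntermediateField F Ω) :
    IsSolution σ hij e L L' ↔
      ∃ (f : Fˣ) (ω ω' : Kˣ) (c : ℕ → ℤ), cls p γ = cls p ((rho σ)^[p - j] ω) ∧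
        ¬ (p : ℤ) ∣ c 0 ∧ ω' = rhoPoly σ i c ω ∧ L' = adjoinRoots p L {incl K f * ω'} := by
  have h1 : i - j = 1 := by omega
  have h2 : p - j = 1 := by omega
  rw [h2]
  constructor
  · intro h
    obtain ⟨β, hβ, -, rfl⟩ := hk.exists_of_isSolution hj hij hi hL hB he h
    rw [h1] at hβ ⊢
    refine ⟨1, β, β, fun k => if k = 0 then 1 else 0, hβ.symm, by simpa using hk.not_dvd_one, ?_, ?_⟩
    · rw [rhoPoly_const (by omega), zpow_one]
    · rw [setOf_lt_one, map_one, one_mul]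
  · rintro ⟨f, ω, ω', c, hω, hc, rfl, rfl⟩
    have h := hk.isSolution_of hj hij hi hL hB he (n := i) (β := incl K f * rhoPoly σ i c ω)
      (by omega) hc (by
        rw [h1, rho_iterate_mul, rho_iterate_incl σ le_rfl, one_mul, rho_iterate_rhoPoly]
        exact (cls_rhoPoly_congr hω i c).symm) (Or.inl (by omega))
    rwa [h1, setOf_lt_one] at h

/-- A single `ρ` separates `β` from `γ` and turns `r^m` into `ξ^m`. The factor `ξ^m` stays in the
class of `γ`, so `m` becomes part of the data. -/
lemma isSolution_iff_of_succ (hij' : i = j + 1) (L' : IntermediateField F Ω) :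
    IsSolution σ hij e L L' ↔
      ∃ (f : Fˣ) (ω : Kˣ) (m : ℤ), ¬ (p : ℤ) ∣ m ∧
        cls p γ = cls p (incl K ξ) ^ m * cls p ((rho σ)^[p - j] ω) ∧
        L' = adjoinRoots p L {incl K f * r ^ m * (rho σ)^[p - j - 1] ω} := by
  have h1 : i - j = 1 := by omega
  have key : ∀ (f : Fˣ) (ω : Kˣ) (m : ℤ),
      cls p ((rho σ)^[1] (incl K f * r ^ m * (rho σ)^[p - j - 1] ω)) =
        cls p (incl K ξ) ^ m * cls p ((rho σ)^[p - j] ω) := by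
    intro f ω m
    rw [rho_iterate_mul, rho_iterate_mul, rho_iterate_incl σ le_rfl, one_mul, rho_iterate_add,
      rho_iterate_zpow, Function.iterate_one, hk.rho_r, show 1 + (p - j - 1) = p - j by omega]
    rfl
  constructor
  · intro h
    obtain ⟨β, hβγ, hβ, rfl⟩ := hk.exists_of_isSolution hj hij hi hL hB he h
    rw [h1] at hβγ ⊢
    obtain ⟨f, ω, m, hm, hω⟩ : ∃ (f : Fˣ) (ω : Kˣ) (m : ℤ), ¬ (p : ℤ) ∣ m ∧
        β = incl K f * r ^ m * (rho σ)^[p - j - 1] ω := by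
      rcases hi.eq_or_lt with hip | hip
      -- With `i = p` the exponent `p - j - 1` is `0`, so any `m` prime to `p` would do.
      · refine ⟨1, β / r, 1, hk.not_dvd_one, ?_⟩
        rw [show p - j - 1 = 0 by omega]
        simp
      · have hβi : cls p ((rho σ)^[i] β) = 1 := by
          rw [hij', ← rho_iterate_add, cls_rho_congr hβγ]
          exact (hk.length_of_hasGroupB hj (by omega) hL hB).1
        obtain ⟨k, hkβ⟩ := hk.exists_mul_r_mem_normPow
          (cls_rho_eq_one_of_le (show i ≤ p - 1 by omega) hβi)
        obtain ⟨f, ω, h⟩ := hk.exists_eq_incl_mul_rho (i := i) (t := p - i) (by omega) (by omega)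
          (by omega) hkβ (by
            rw [rho_iterate_mul, rho_iterate_zpow, hk.rho_iterate_r (by omega), one_zpow, mul_one,
              hβi])
        -- If `p` divided `k`, then `r^k` would lie in `normPow`, and so would `β`.
        refine ⟨f, ω, -k, fun hd => hβ ?_, ?_⟩
        · exact (Subgroup.mul_mem_cancel_right _
            (hk.zpow_mem_normPow ((dvd_neg).1 hd) r)).1 hkβ
        · rw [mul_right_comm, show p - j - 1 = p - i by omega, ← h, zpow_neg, mul_inv_cancel_right]
    exact ⟨f, ω, m, hm, by rw [← key f, ← hω, hβγ], by rw [setOf_lt_one, hω]⟩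
  · rintro ⟨f, ω, m, hm, hω, rfl⟩
    have h := hk.isSolution_of hj hij hi hL hB he (n := 1)
      (β := incl K f * r ^ m * (rho σ)^[p - j - 1] ω) (c := fun k => if k = 0 then 1 else 0)
      le_rfl (by simpa using hk.not_dvd_one) (by
        rw [h1, key, rhoPoly_const le_rfl, zpow_one, hω]) (by
        rcases hi.eq_or_lt with hip | hip
        · exact Or.inl hip
        · right
          rw [Subgroup.mul_mem_cancel_right _ (hk.rho_iterate_mem_normPow (by omega) _),
            Subgroup.mul_mem_cancel_left _ (incl_mem_normPow f)]
          exact hk.r_pow_notMem_normPow hm)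
    rwa [h1, setOf_lt_one] at h

end Solutions

omit [IsAlgClosed Ω] in
lemma exists_iff_of_forall_iff {i j : ℕ} {γ : Kˣ} {P : IntermediateField F Ω → Prop}
    {T : Fˣ → Kˣ → Kˣ → IntermediateField F Ω}
    (h : ∀ L', P L' ↔ ∃ (f : Fˣ) (ω ω' : Kˣ) (c : ℕ → ℤ), cls p γ = cls p ((rho σ)^[p - j] ω) ∧
      ¬ (p : ℤ) ∣ c 0 ∧ ω' = rhoPoly σ i c ω ∧ L' = T f ω ω') :
    (∃ L', P L') ↔ ∃ ω : Kˣ, cls p γ = cls p ((rho σ)^[p - j] ω) := by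
  constructor
  · rintro ⟨L', hL'⟩
    obtain ⟨-, ω, -, -, hω, -⟩ := (h L').1 hL'
    exact ⟨ω, hω⟩
  · rintro ⟨ω, hω⟩
    exact ⟨_, (h _).2 ⟨1, ω, _, fun _ => 1, hω, hk.not_dvd_one, rfl, rfl⟩⟩

omit [IsAlgClosed Ω] hk hpf in
lemma upsilon_eq_zero_or_one : Upsilon K ξ = 0 ∨ Upsilon K ξ = 1 := by
  rw [Upsilon]
  split_ifs
  · exact Or.inr rfl
  · exact Or.inl rfl

lemma exists_isCyclicOfDegree_of_upsilon (h : Upsilon K ξ = 1) :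
    ∃ α : Kˣ, IsCyclicOfDegree (adjoinRoots p K {α}) (p ^ 2) := by
  have h1 : ∃ z : Kˣ, Algebra.norm F (z : K) = ξ := by
    by_contra hn
    rw [Upsilon, if_neg hn] at h
    exact zero_ne_one h
  obtain ⟨z, hz⟩ := h1
  exact hk.exists_isCyclicOfDegree (z := z) (Units.ext (by rw [hk.coe_nm, hz, coe_incl]))

end IsKummer

end

end CyclicEmbedding

open CyclicEmbedding in
theorem theorem3 {F Ω : Type*} [Field F] [Field Ω] [Algebra F Ω] [IsAlgClosed Ω]
    {p : ℕ} [Fact p.Prime] (hp : 2 < p)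
    (ξ : Fˣ) (hξ : IsPrimitiveRoot ξ p)
    (K : IntermediateField F Ω) (hKdeg : Module.finrank F K = p)
    (a : Fˣ) (r : Kˣ) (hr : r ^ p = incl K a) (hK : IntermediateField.adjoin F {(r : K)} = ⊤)
    (σ : K ≃ₐ[F] K) (hσ : σ (r : K) = (incl K ξ * r : Kˣ))
    (i j : ℕ) (hj : 1 ≤ j) (hij : j < i) (hi : i ≤ p)
    (γ : Kˣ) (L : IntermediateField F Ω)
    (hL : L = IntermediateField.normalClosure F (adjoinRoots p K {γ}) Ω)
    (hGal : HasGroupB p σ L j 0)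
    (e : ZMod p) (he : e ≠ 0) :
    ((j + 1 - Upsilon K ξ < i ∨ j = p - 1) →
      ((∃ L', IsSolution σ hij e L L') ↔ ∃ ω : Kˣ, cls p γ = cls p ((rho σ)^[p - j] ω)) ∧
      (Upsilon K ξ = 1 →
        (∃ α : Kˣ, IsCyclicOfDegree (adjoinRoots p K {α}) (p ^ 2)) ∧
        ∀ α : Kˣ, IsCyclicOfDegree (adjoinRoots p K {α}) (p ^ 2) →
          ∀ L', IsSolution σ hij e L L' ↔
            ∃ (f : Fˣ) (ω ω' : Kˣ) (c : ℕ → ℤ), cls p γ = cls p ((rho σ)^[p - j] ω) ∧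
              ¬ (p : ℤ) ∣ c 0 ∧ ω' = rhoPoly σ i c ω ∧
              L' = adjoinRoots p L
                ({incl K f * α * (rho σ)^[p - i] ω'} ∪
                  {x | ∃ k, p - i + 1 ≤ k ∧ k < p - j ∧ x = (rho σ)^[k] ω'})) ∧
      (Upsilon K ξ = 0 → j + 1 < i →
        ∀ L', IsSolution σ hij e L L' ↔
          ∃ (f : Fˣ) (ω ω' : Kˣ) (c : ℕ → ℤ), cls p γ = cls p ((rho σ)^[p - j] ω) ∧
            ¬ (p : ℤ) ∣ c 0 ∧ ω' = rhoPoly σ i c ω ∧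
            L' = adjoinRoots p L
              ({incl K f * r * (rho σ)^[p - i] ω', incl K ξ * (rho σ)^[p - i + 1] ω'} ∪
                {x | ∃ k, p - i + 2 ≤ k ∧ k < p - j ∧ x = (rho σ)^[k] ω'})) ∧
      (Upsilon K ξ = 0 → j = p - 1 →
        ∀ L', IsSolution σ hij e L L' ↔
          ∃ (f : Fˣ) (ω ω' : Kˣ) (c : ℕ → ℤ), cls p γ = cls p ((rho σ)^[p - j] ω) ∧
            ¬ (p : ℤ) ∣ c 0 ∧ ω' = rhoPoly σ i c ω ∧
            L' = adjoinRoots p L {incl K f * ω'})) ∧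
    (i = j + 1 → Upsilon K ξ = 0 →
      ((∃ L', IsSolution σ hij e L L') ↔
        ∃ (ω : Kˣ) (m : ℤ), ¬ (p : ℤ) ∣ m ∧
          cls p γ = cls p (incl K ξ) ^ m * cls p ((rho σ)^[p - j] ω)) ∧
      ∀ L', IsSolution σ hij e L L' ↔
        ∃ (f : Fˣ) (ω : Kˣ) (m : ℤ), ¬ (p : ℤ) ∣ m ∧
          cls p γ = cls p (incl K ξ) ^ m * cls p ((rho σ)^[p - j] ω) ∧
          L' = adjoinRoots p L {incl K f * r ^ m * (rho σ)^[p - j - 1] ω}) := by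
  have hk : IsKummer p ξ r σ :=
    { odd := (Fact.out : p.Prime).odd_of_ne_two hp.ne'
      prim := hξ
      finrank := hKdeg
      pow_mem := ⟨a, hr⟩
      adjoin := hK
      act_r := Units.ext hσ }
  have hL' := hk.normalClosure_eq hL
  refine ⟨fun h => ⟨?_, fun hΥ => ⟨hk.exists_isCyclicOfDegree_of_upsilon hΥ, fun α hα =>
    hk.isSolution_iff_of_isCyclicOfDegree hj hij hi hL' hGal he hα⟩, fun _ hlt =>
    hk.isSolution_iff_of_lt hj hij hi hL' hGal he hlt, fun _ hjp =>
    hk.isSolution_iff_of_eq hj hij hi hL' hGal he hjp⟩, fun hij' _ => ?_⟩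
  -- Solvability is read off from the description of the solutions: with `r` or `i = p` when `Υ =
  -- 0`, and with any `α` of degree `p^2` when `Υ = 1`.
  · rcases IsKummer.upsilon_eq_zero_or_one (K := K) (ξ := ξ) with hΥ | hΥ
    · rcases h with h | h
      · exact hk.exists_iff_of_forall_iff
          (hk.isSolution_iff_of_lt hj hij hi hL' hGal he (by omega))
      · exact hk.exists_iff_of_forall_iff (hk.isSolution_iff_of_eq hj hij hi hL' hGal he h)
    · obtain ⟨α, hα⟩ := hk.exists_isCyclicOfDegree_of_upsilon hΥ
      exact hk.exists_iff_of_forall_iff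
        (hk.isSolution_iff_of_isCyclicOfDegree hj hij hi hL' hGal he hα)
  · have hsol := hk.isSolution_iff_of_succ hj hij hi hL' hGal he hij'
    refine ⟨⟨?_, ?_⟩, hsol⟩
    · rintro ⟨L', h⟩
      obtain ⟨-, ω, m, hm, hω, -⟩ := (hsol L').1 h
      exact ⟨ω, m, hm, hω⟩
    · rintro ⟨ω, m, hm, hω⟩
      exact ⟨_, (hsol _).2 ⟨1, ω, m, hm, hω, rfl⟩⟩
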